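/- Let $Q$ be a finite quiver that is separated (its vertex set $Q_v$ is the disjoint union of a set of even and a set of odd vertices, and each arrow starts at an even and ends at an odd vertex) and has no multiple arrows, and let its underlying graph $G$ be a Dynkin graph $A_n,D_n,E_6,E_7,E_8$ or an extended Dynkin graph $\widetilde A_n,\widetilde D_n,\widetilde E_6,\widetilde E_7,\widetilde E_8$. A representation $T$ of $Q$ in finite-dimensional Hilbert spaces over $\mathbb C$ is orthoscalar with character $\chi=(\chi_i)_{i\in Q_v}$, $\chi_i\ge 0$, if $\sum_{h(\alpha)=i}T_\alpha T_\alpha^*=\chi_i I$ for each odd vertex $i$ and $\sum_{t(\alpha)=j}T_\alpha^*T_\alpha=\chi_j I$ for each even vertex $j$, where $t(\alpha)$ and $h(\alpha)$ are the tail and the head of the arrow $\alpha$. Indecomposability means that $T\neq0$ is not an orthogonal direct sum of two nonzero representations, and equivalence means unitary equivalence. Let $d\in\mathbb Z^{Q_v}$ be an exact real root, that is, all $d_i>0$ and $\sum_i d_i^2-\sum_\alpha d_{t(\alpha)}d_{h(\alpha)}=1$. Call $d$ regular if $c^t(d)\ge 0$ for all $t\in\mathbb Z$ (where $c$ is the Coxeter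 transformation: the simple reflections at all odd vertices followed by those at all even vertices), and singular otherwise. If $G$ is extended Dynkin, let $\delta$ be its minimal positive imaginary root. (1) If $G$ is Dynkin, or if $G$ is extended Dynkin and $d$ is singular or $d<\delta$, then the indecomposable orthoscalar representations of $Q$ of dimension $d$ depend on exactly $|Q_v|-1$ positive parameters: there are an injective linear map $L:\mathbb R^{|Q_v|-1}\to\mathbb R^{Q_v}$ and, for each $p\in(0,\infty)^{|Q_v|-1}$, an indecomposable orthoscalar representation $F_p$ of dimension $d$ with character $L(p)$, such that every indecomposable orthoscalar representation of dimension $d$ is unitarily equivalent to $F_p$ for exactly one $p$. (2) If $G$ is extended Dynkin, $d$ is regular and $d\not<\delta$, then there is no indecomposable orthoscalar representation of dimension $d$. -/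

import Mathlib

universe u v w

namespace Orthoscalar


/-! ### Dynkin graphs and extended Dynkin graphs (simply laced) -/

/-- `D_n` on the vertices `0, …, n-1`: the path `0 - 1 - ⋯ - (n-2)`, and `n-1` joined to `n-3`. -/
def graphD (n : ℕ) : SimpleGraph (Fin n) :=
  SimpleGraph.fromRel fun a b =>
    (a.val + 1 = b.val ∧ b.val + 1 < n) ∨ (a.val + 3 = n ∧ b.val + 1 = n)

/-- The path `0 - 1 - ⋯ - (n-2)` with one more vertex `n-1` joined to the vertex `k`. -/
def graphBranch (n k : ℕ) : SimpleGraph (Fin n) :=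
  SimpleGraph.fromRel fun a b =>
    (a.val + 1 = b.val ∧ b.val + 1 < n) ∨ (a.val = k ∧ b.val + 1 = n)

/-- The extended Dynkin graph of type `D_n`, with `n + 1` vertices: the path
`0 - 1 - ⋯ - (n-2)`, the vertex `n-1` joined to `1`, and the vertex `n` joined to `n-3`. -/
def graphExtD (n : ℕ) : SimpleGraph (Fin (n + 1)) :=
  SimpleGraph.fromRel fun a b =>
    (a.val + 1 = b.val ∧ b.val + 2 ≤ n) ∨ (a.val = 1 ∧ b.val + 1 = n) ∨
      (a.val + 3 = n ∧ b.val = n)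

/-- The extended Dynkin graph of type `E_6`: the path `0 - 1 - 2 - 3 - 4` and the arm
`2 - 5 - 6`. -/
def graphExtE6 : SimpleGraph (Fin 7) :=
  SimpleGraph.fromRel fun a b =>
    (a.val + 1 = b.val ∧ b.val ≤ 4) ∨ (a.val = 2 ∧ b.val = 5) ∨ (a.val = 5 ∧ b.val = 6)

/-- `G` is one of the Dynkin graphs `A_n` (`n ≥ 1`), `D_n` (`n ≥ 4`), `E_6`, `E_7`, `E_8`. -/
def IsDynkin {V : Type u} (G : SimpleGraph V) : Prop :=
  (∃ n : ℕ, 1 ≤ n ∧ Nonempty (G ≃g SimpleGraph.pathGraph n)) ∨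
  (∃ n : ℕ, 4 ≤ n ∧ Nonempty (G ≃g graphD n)) ∨
  Nonempty (G ≃g graphBranch 6 2) ∨
  Nonempty (G ≃g graphBranch 7 2) ∨
  Nonempty (G ≃g graphBranch 8 2)

/-- `G` is one of the extended Dynkin graphs (without multiple edges and loops): a cycle with at
least three vertices, or one of the extended graphs of types `D_n` (`n ≥ 4`), `E_6`, `E_7`,
`E_8`. -/
def IsExtendedDynkin {V : Type u} (G : SimpleGraph V) : Prop :=
  (∃ n : ℕ, 3 ≤ n ∧ Nonempty (G ≃g SimpleGraph.cycleGraph n)) ∨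
  (∃ n : ℕ, 4 ≤ n ∧ Nonempty (G ≃g graphExtD n)) ∨
  Nonempty (G ≃g graphExtE6) ∨
  Nonempty (G ≃g graphBranch 8 3) ∨
  Nonempty (G ≃g graphBranch 9 2)

/-! ### Separated quivers, the Tits form, roots, the Coxeter transformation -/

/-- The quiver on `V` is separated, with set `ev` of even vertices: each arrow starts in `ev` and
ends in the complement of `ev` (the odd vertices). -/
def IsSeparated {V : Type u} [Quiver.{v + 1} V] (ev : Set V) : Prop :=
  ∀ (j i : V), (j ⟶ i) → j ∈ ev ∧ i ∉ ev

/-- The underlying graph of a quiver (used for quivers without loops and multiple arrows). -/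
def quiverGraph (V : Type u) [Quiver.{v + 1} V] : SimpleGraph V :=
  SimpleGraph.fromRel fun j i : V => Nonempty (j ⟶ i)

/-- The Tits form `q(x) = ∑_i x_i² - ∑_α x_{t(α)} x_{h(α)}`. -/
def titsForm {V : Type u} [Fintype V] [Quiver.{v + 1} V] [∀ j i : V, Fintype (j ⟶ i)]
    (x : V → ℤ) : ℤ :=
  ∑ i, x i ^ 2 - ∑ j, ∑ i, ∑ _a : (j ⟶ i), x j * x i

/-- Positive real roots (of a quiver whose graph is Dynkin or extended Dynkin). -/
def IsRealRoot {V : Type u} [Fintype V] [Quiver.{v + 1} V] [∀ j i : V, Fintype (j ⟶ i)]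
    (x : V → ℤ) : Prop :=
  x ≠ 0 ∧ 0 ≤ x ∧ titsForm x = 1

/-- Positive imaginary roots (of a quiver whose graph is Dynkin or extended Dynkin). -/
def IsImaginaryRoot {V : Type u} [Fintype V] [Quiver.{v + 1} V] [∀ j i : V, Fintype (j ⟶ i)]
    (x : V → ℤ) : Prop :=
  x ≠ 0 ∧ 0 ≤ x ∧ titsForm x = 0

open Classical in
/-- The reflection at all vertices of `S`: `x_i` becomes `-x_i + ∑_{j - i} x_j` for `i ∈ S`, and
stays for `i ∉ S`. (It is used for sets `S` of pairwise non-adjacent vertices, for which it is the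
product of the simple reflections at the vertices of `S`.) -/
noncomputable def reflection {V : Type u} [Fintype V] [Quiver.{v + 1} V] (S : Set V)
    (x : V → ℤ) : V → ℤ :=
  fun i => if i ∈ S then -x i + ∑ j with (quiverGraph V).Adj j i, x j else x i

/-- A vector is regular if all its images under the powers `c ^ t`, `t ∈ ℤ`, of the Coxeter
transformation (first the reflection at the odd vertices, then the one at the even vertices) are
nonnegative. As both reflections are involutions, the powers of `c⁻¹` are those of the composition
in the other order. -/
def IsRegularVector {V : Type u} [Fintype V] [Quiver.{v + 1} V] (ev : Set V) (x : V → ℤ) : Prop :=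
  ∀ t : ℕ, 0 ≤ (reflection ev ∘ reflection evᶜ)^[t] x ∧ 0 ≤ (reflection evᶜ ∘ reflection ev)^[t] x

/-! ### Representations in finite-dimensional Hilbert spaces -/

/-- A representation of a quiver in finite-dimensional Hilbert (unitary) spaces. -/
structure HilbertRep (V : Type u) [Quiver.{v + 1} V] where
  /-- the space at a vertex -/
  space : V → Type w
  [normed : ∀ i, NormedAddCommGroup (space i)]
  [inner : ∀ i, InnerProductSpace ℂ (space i)]
  [finite : ∀ i, FiniteDimensional ℂ (space i)]
  /-- the linear map at an arrow -/
  map : ∀ {j i : V}, (j ⟶ i) → (space j →ₗ[ℂ] space i)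

attribute [instance] HilbertRep.normed HilbertRep.inner HilbertRep.finite

namespace HilbertRep

variable {V : Type u} [Quiver.{v + 1} V]

/-- The dimension vector. -/
noncomputable def dim (T : HilbertRep.{u, v, w} V) : V → ℤ :=
  fun i => (Module.finrank ℂ (T.space i) : ℤ)

/-- `T` is orthoscalar with character `χ`: for an odd vertex `i` the sum of `T_α T_α^*` over the
arrows `α` into `i` is `χ_i` times the identity, and for an even vertex `j` the sum of
`T_α^* T_α` over the arrows `α` from `j` is `χ_j` times the identity. -/
def HasCharacter [Fintype V] [∀ j i : V, Fintype (j ⟶ i)] (ev : Set V)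
    (T : HilbertRep.{u, v, w} V) (χ : V → ℝ) : Prop :=
  (∀ i, 0 ≤ χ i) ∧
  (∀ i, i ∉ ev → ∑ j, ∑ a : (j ⟶ i), T.map a ∘ₗ LinearMap.adjoint (T.map a) =
    (χ i : ℂ) • LinearMap.id) ∧
  (∀ j, j ∈ ev → ∑ i, ∑ a : (j ⟶ i), LinearMap.adjoint (T.map a) ∘ₗ T.map a =
    (χ j : ℂ) • LinearMap.id)

/-- `T` is orthoscalar. -/
def IsOrthoscalar [Fintype V] [∀ j i : V, Fintype (j ⟶ i)] (ev : Set V)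
    (T : HilbertRep.{u, v, w} V) : Prop :=
  ∃ χ : V → ℝ, T.HasCharacter ev χ

/-- Unitary equivalence. -/
def UnitarilyEquivalent (T T' : HilbertRep.{u, v, w} V) : Prop :=
  ∃ U : ∀ i, T.space i ≃ₗᵢ[ℂ] T'.space i,
    ∀ (j i : V) (a : j ⟶ i) (x : T.space j), U i (T.map a x) = T'.map a (U j x)

/-- `T` is indecomposable (as a representation in Hilbert spaces): it is nonzero, and it is not an
orthogonal direct sum `W ⊕ Wᗮ` of two nonzero subrepresentations. -/
def IsIndecomposable (T : HilbertRep.{u, v, w} V) : Prop :=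
  (∃ i, Nontrivial (T.space i)) ∧
  ∀ W : ∀ i, Submodule ℂ (T.space i),
    (∀ (j i : V) (a : j ⟶ i), ∀ x ∈ W j, T.map a x ∈ W i) →
    (∀ (j i : V) (a : j ⟶ i), ∀ x ∈ (W j)ᗮ, T.map a x ∈ (W i)ᗮ) →
    (∀ i, W i = ⊥) ∨ (∀ i, W i = ⊤)

end HilbertRep

/-- The indecomposable orthoscalar representations of dimension `d` depend on exactly `k` positive
parameters: there is a family `F p` of such representations, indexed by all vectors `p` of `k`
positive numbers, whose characters are the values at `p` of an injective linear map, and each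
indecomposable orthoscalar representation of dimension `d` is unitarily equivalent to `F p` for
exactly one `p`. (So the characters that occur form an open simplicial cone in a `k`-dimensional
subspace, which determines `k`, and the character determines the representation.) -/
def DependOnPositiveParameters {V : Type u} [Fintype V] [Quiver.{v + 1} V]
    [∀ j i : V, Fintype (j ⟶ i)] (ev : Set V) (d : V → ℤ) (k : ℕ) : Prop :=
  ∃ (F : {p : Fin k → ℝ // ∀ s, 0 < p s} → HilbertRep.{u, v, w} V)
    (L : (Fin k → ℝ) →ₗ[ℝ] (V → ℝ)),
    Function.Injective L ∧
    (∀ p, (F p).IsIndecomposable ∧ (F p).dim = d ∧ (F p).HasCharacter ev (L p.1)) ∧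
    ∀ T : HilbertRep.{u, v, w} V, T.IsIndecomposable → T.dim = d → T.IsOrthoscalar ev →
      ∃! p, T.UnitarilyEquivalent (F p)

end Orthoscalar

/-! Choosing orthonormal bases turns a representation into matrices `A i j` with `(A i j)ᴴ = A j i`,
so the orientation of arrows disappears and indecomposability says that the commutant is scalar
(`IsIrred`). The engine is the reflection functor `Realizes.refl`. At a vertex `i` of one side `O`,
orthoscalarity says that the block row `(A i j)_j` is `√χ_i` times a coisometry; completing it to a
multiple of a unitary and keeping only the new rows gives an irreducible orthoscalar representation
again. Its dimension is reflected at `O` and its character at `Oᶜ`.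

For (1), alternate reflections at `O` and `Oᶜ`. As soon as the dimension vanishes at a vertex of its
support, that vertex drops out; going back, its character value is an arbitrary positive number,
hence one new parameter (`HasCone.of_refl`). The descent ends at a single vertex of dimension one,
which has no parameter, so the number of parameters is one less than the number of vertices. The
descent always starts: for Dynkin graphs because strictly superharmonic weights give a quantity that
strictly decreases (`exists_alternate_neg`), for singular roots by definition, and for `d < δ`
because `δ - d` would otherwise be a root that dies out (`exists_alternate_nonpos_of_lt`). The
supports left after the first loss have a positive definite Tits form. The character determines the
representation because `q(d) = 1 > 0` forces a nonzero intertwiner by counting dimensions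
(`exists_unitary`).

For (2), a regular `d` with `d ≮ δ` satisfies `d ≥ δ`, and all its images under the reflections stay
at least `δ`, hence positive. The functor then applies forever in both directions, so all reflected
characters are nonnegative, which forces the `δ`-weighted sums of `χ` over both sides to agree
(`defect_character_eq_zero`). Traces give the same balance with weights `d`. But the moment map is a
submersion at an irreducible representation up to the trace condition, so near `χ` the trace
condition is the only restriction (`Realizes.exists_near`). As `d` is not proportional to `δ`, these
statements conflict (`not_realizes_of_regular`). -/

namespace Orthoscalar

/-! ### Reflections, the Tits form and weighted defects on bipartite graphs. -/

section Combinatorics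

open Finset
open scoped Classical
set_option linter.unusedSectionVars false

variable {V : Type u} [Fintype V]

/-- The sum of the values of `x` at the neighbours of a vertex. -/
noncomputable def nbrSum {R : Type*} [AddCommMonoid R] (G : SimpleGraph V) (x : V → R) (i : V) : R :=
  ∑ j with G.Adj j i, x j

/-- The product of the simple reflections at the (pairwise non-adjacent) vertices of `O`. -/
noncomputable def refl {R : Type*} [Ring R] (G : SimpleGraph V) (O : Set V) (x : V → R) : V → R :=
  fun i => if i ∈ O then -x i + nbrSum G x i else x i

/-- Reflections at `O`, `Oᶜ`, `O`, … applied one after another. -/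
noncomputable def alternate {R : Type*} [Ring R] (G : SimpleGraph V) :
    ℕ → Set V → (V → R) → V → R
  | 0, _, x => x
  | t + 1, O, x => alternate G t Oᶜ (refl G O x)

/-- `O` and its complement form a bipartition of `G`. -/
def IsSide (G : SimpleGraph V) (O : Set V) : Prop := ∀ i j, G.Adj i j → (i ∈ O ↔ j ∉ O)

theorem IsSide.compl {G : SimpleGraph V} {O : Set V} (h : IsSide G O) : IsSide G Oᶜ := by
  intro i j hij
  have := h i j hij
  simp only [Set.mem_compl_iff]; tauto

theorem nbrSum_congr {R : Type*} [AddCommMonoid R] {G : SimpleGraph V} {x y : V → R} {i : V}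
    (h : ∀ j, G.Adj j i → x j = y j) :
    nbrSum G x i = nbrSum G y i :=
  Finset.sum_congr rfl fun j hj => h j (by simpa using hj)

section Ring
variable {R : Type*} [CommRing R] {G : SimpleGraph V} {O : Set V}

theorem refl_of_mem (x : V → R) {i : V} (hi : i ∈ O) : refl G O x i = -x i + nbrSum G x i := by
  simp [refl, hi]

theorem refl_of_notMem (x : V → R) {i : V} (hi : i ∉ O) : refl G O x i = x i := by
  simp [refl, hi]

theorem refl_refl (hO : IsSide G O) (x : V → R) : refl G O (refl G O x) = x := by
  funext i
  by_cases hi : i ∈ O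
  · rw [refl_of_mem _ hi, refl_of_mem _ hi, nbrSum_congr (x := refl G O x) (y := x)]
    · ring
    · intro j hj
      exact refl_of_notMem _ fun h => (hO j i hj).1 h hi
  · rw [refl_of_notMem _ hi, refl_of_notMem _ hi]

theorem refl_add (x y : V → R) : refl G O (x + y) = refl G O x + refl G O y := by
  funext i
  by_cases hi : i ∈ O
  · simp only [Pi.add_apply, refl_of_mem _ hi, nbrSum, Finset.sum_add_distrib]; ring
  · simp [refl_of_notMem _ hi]

theorem refl_smul (c : R) (x : V → R) : refl G O (c • x) = c • refl G O x := by
  funext i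
  by_cases hi : i ∈ O
  · simp only [Pi.smul_apply, smul_eq_mul, refl_of_mem _ hi, nbrSum, ← Finset.mul_sum]; ring
  · simp [refl_of_notMem _ hi]

theorem alternate_add (t : ℕ) (x y : V → R) :
    alternate G t O (x + y) = alternate G t O x + alternate G t O y := by
  induction t generalizing O x y with
  | zero => rfl
  | succ t ih => simp only [alternate, refl_add, ih]

theorem alternate_of_harmonic (t : ℕ) {x : V → R} (hx : ∀ i, nbrSum G x i = 2 * x i) :
    alternate G t O x = x := by
  induction t generalizing O with
  | zero => rfl
  | succ t ih =>
    have : refl G O x = x := by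
      funext i
      by_cases hi : i ∈ O
      · rw [refl_of_mem _ hi, hx]; ring
      · rw [refl_of_notMem _ hi]
    rw [alternate, this, ih]

theorem alternate_two_mul (t : ℕ) (x : V → R) :
    alternate G (2 * t) O x = (refl G Oᶜ ∘ refl G O)^[t] x := by
  induction t generalizing x with
  | zero => rfl
  | succ t ih =>
    rw [Function.iterate_succ_apply, ← ih, show 2 * (t + 1) = 2 * t + 1 + 1 by ring, alternate,
      alternate, compl_compl]
    rfl

/-- Double counting of the edges of a bipartite graph. -/
theorem sum_mul_nbrSum (hO : IsSide G O) (w x : V → R) :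
    ∑ i with i ∈ O, w i * nbrSum G x i = ∑ j with j ∉ O, nbrSum G w j * x j := by
  simp only [nbrSum, Finset.mul_sum, Finset.sum_mul]
  simp only [Finset.sum_filter]
  have h1 : ∀ i, (if i ∈ O then ∑ j, (if G.Adj j i then w i * x j else 0) else 0) =
      ∑ j, if i ∈ O ∧ G.Adj j i then w i * x j else 0 := fun i => by
    by_cases hi : i ∈ O <;> simp [hi]
  have h2 : ∀ j, (if j ∉ O then ∑ i, (if G.Adj i j then w i * x j else 0) else 0) =
      ∑ i, if i ∈ O ∧ G.Adj j i then w i * x j else 0 := fun j => by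
    by_cases hj : j ∈ O
    · simp only [hj, not_true, if_false]
      refine (Finset.sum_eq_zero fun i _ => if_neg ?_).symm
      rintro ⟨h, h'⟩
      exact (hO i j h'.symm).1 h hj
    · simp only [hj, not_false_eq_true, if_true]
      refine Finset.sum_congr rfl fun i _ => if_congr ?_ rfl rfl
      constructor
      · intro h; exact ⟨(hO i j h).2 hj, h.symm⟩
      · intro h; exact h.2.symm
  rw [Finset.sum_congr rfl fun i _ => h1 i, Finset.sum_congr rfl fun i _ => h2 i, Finset.sum_comm]

/-- The Tits form of a bipartite graph. -/
noncomputable def form (G : SimpleGraph V) (O : Set V) (x : V → R) : R :=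
  ∑ i, x i ^ 2 - ∑ i with i ∈ O, x i * nbrSum G x i

theorem form_compl (hO : IsSide G O) (x : V → R) : form G Oᶜ x = form G O x := by
  simp only [form]
  rw [sum_mul_nbrSum hO x x]
  congr 1
  exact Finset.sum_congr (by simp) fun i _ => mul_comm _ _

theorem two_mul_form (hO : IsSide G O) (x : V → R) :
    2 * form G O x = ∑ i, x i * (2 * x i - nbrSum G x i) := by
  have h1 : 2 * form G O x = form G O x + form G Oᶜ x := by rw [form_compl hO]; ring
  have h2 := Finset.sum_filter_add_sum_filter_not univ (· ∈ O) (fun i => x i * nbrSum G x i)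
  rw [h1]
  simp only [form, mul_sub, Finset.sum_sub_distrib, Set.mem_compl_iff]
  rw [← h2]
  have : ∑ i, x i * (2 * x i) = 2 * ∑ i, x i ^ 2 := by
    rw [Finset.mul_sum]; exact Finset.sum_congr rfl fun i _ => by ring
  rw [this]; ring

theorem form_refl (hO : IsSide G O) (x : V → R) : form G O (refl G O x) = form G O x := by
  have h1 : ∀ y : V → R, form G O y =
      ∑ i with i ∉ O, y i ^ 2 + ∑ i with i ∈ O, y i * (y i - nbrSum G y i) := by
    intro y
    rw [form, ← Finset.sum_filter_add_sum_filter_not univ (· ∈ O) (fun i => y i ^ 2)]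
    simp only [mul_sub, Finset.sum_sub_distrib, pow_two]; ring
  rw [h1, h1]
  congr 1
  · refine Finset.sum_congr rfl fun i hi => ?_
    rw [refl_of_notMem _ (by simpa using hi)]
  · refine Finset.sum_congr rfl fun i hi => ?_
    have hi : i ∈ O := by simpa using hi
    rw [refl_of_mem _ hi, nbrSum_congr (x := refl G O x) (y := x)]
    · ring
    · intro j hj
      exact refl_of_notMem _ fun h => (hO j i hj).1 h hi

/-- The difference of the weighted sums of `x` over `Oᶜ` and over `O`. -/
noncomputable def defect (w : V → R) (O : Set V) (x : V → R) : R :=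
  ∑ i with i ∉ O, w i * x i - ∑ i with i ∈ O, w i * x i

theorem defect_compl (w : V → R) (x : V → R) : defect w Oᶜ x = -defect w O x := by
  simp [defect]

theorem sum_side_refl (hO : IsSide G O) (w x : V → R) :
    ∑ i with i ∈ O, w i * refl G O x i =
      ∑ i with i ∉ O, w i * x i + defect w O x -
        ∑ i with i ∉ O, (2 * w i - nbrSum G w i) * x i := by
  have : ∑ i with i ∈ O, w i * refl G O x i =
      -∑ i with i ∈ O, w i * x i + ∑ i with i ∈ O, w i * nbrSum G x i := by
    rw [← Finset.sum_neg_distrib, ← Finset.sum_add_distrib]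
    refine Finset.sum_congr rfl fun i hi => ?_
    rw [refl_of_mem _ (by simpa using hi)]; ring
  rw [this, sum_mul_nbrSum hO, defect]
  simp only [sub_mul, Finset.sum_sub_distrib, mul_assoc, ← Finset.mul_sum]
  ring

theorem sum_side_compl_refl (w x : V → R) :
    ∑ i with i ∉ O, w i * refl G O x i = ∑ i with i ∉ O, w i * x i :=
  Finset.sum_congr rfl fun i hi => by rw [refl_of_notMem _ (by simpa using hi)]

/-- The defect is the invariant of the alternating reflections: harmonic weights preserve it,
superharmonic ones make it decrease on nonnegative vectors. The side is swapped along with the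
vector, so that no sign appears. -/
theorem defect_refl (hO : IsSide G O) (w x : V → R) :
    defect w Oᶜ (refl G O x) =
      defect w O x - ∑ i with i ∉ O, (2 * w i - nbrSum G w i) * x i := by
  have h := sum_side_refl hO w x
  rw [defect]
  simp only [Set.mem_compl_iff, not_not]
  rw [h, sum_side_compl_refl]; ring

end Ring

section Ordered
variable {R : Type*} [CommRing R] [LinearOrder R] [IsStrictOrderedRing R]
  {G : SimpleGraph V} {O : Set V}

/-- Each reflection adds the current defect to the weighted sum of one side and subtracts a
nonnegative loss, so the sum grows at most linearly with slope the initial defect. A negative slope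
would eventually make a nonnegative sum negative. -/
theorem side_add_mul_defect_nonneg (hO : IsSide G O) {w : V → R} (hw : 0 ≤ w)
    (hs : ∀ i, nbrSum G w i ≤ 2 * w i) (t : ℕ) {x : V → R} (hx : ∀ s, 0 ≤ alternate G s O x) :
    0 ≤ ∑ i with i ∉ O, w i * x i + t * defect w O x := by
  induction t generalizing O x with
  | zero =>
    simp only [Nat.cast_zero, zero_mul, add_zero]
    exact Finset.sum_nonneg fun i _ => mul_nonneg (hw i) (hx 0 i)
  | succ t ih =>
    have h := ih (O := Oᶜ) hO.compl (x := refl G O x) fun s => hx (s + 1)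
    simp only [Set.mem_compl_iff, not_not] at h
    rw [sum_side_refl hO, defect_refl hO] at h
    have hpos : 0 ≤ ∑ i with i ∉ O, (2 * w i - nbrSum G w i) * x i :=
      Finset.sum_nonneg fun i _ => mul_nonneg (sub_nonneg.2 (hs i)) (hx 0 i)
    have ht : (0 : R) ≤ t := Nat.cast_nonneg t
    push_cast
    nlinarith [mul_nonneg ht hpos]

theorem defect_nonneg [Archimedean R] (hO : IsSide G O) {w : V → R} (hw : 0 ≤ w)
    (hs : ∀ i, nbrSum G w i ≤ 2 * w i) {x : V → R} (hx : ∀ s, 0 ≤ alternate G s O x) :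
    0 ≤ defect w O x := by
  by_contra! h
  obtain ⟨t, ht⟩ := Archimedean.arch (∑ i with i ∉ O, w i * x i + 1) (neg_pos.2 h)
  have := side_add_mul_defect_nonneg hO hw hs t hx
  rw [nsmul_eq_mul] at ht
  linarith

/-- For harmonic weights, the weighted sums over both sides agree if no image of `x` under
alternating reflections, in either order, has a negative coordinate. -/
theorem defect_eq_zero [Archimedean R] (hO : IsSide G O) {w : V → R} (hw : 0 ≤ w)
    (hs : ∀ i, nbrSum G w i = 2 * w i) {x : V → R} (hx : ∀ s, 0 ≤ alternate G s O x)
    (hx' : ∀ s, 0 ≤ alternate G s Oᶜ x) : defect w O x = 0 := by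
  have h1 := defect_nonneg hO hw (fun i => (hs i).le) hx
  have h2 := defect_nonneg hO.compl hw (fun i => (hs i).le) hx'
  rw [defect_compl] at h2
  linarith

theorem refl_nonneg_of_refl_refl_nonneg {x : V → R} (hx : 0 ≤ x)
    (hx' : 0 ≤ refl G Oᶜ (refl G O x)) : 0 ≤ refl G O x := by
  intro i
  by_cases hi : i ∈ O
  · have := hx' i
    rwa [refl_of_notMem _ (by simpa using hi)] at this
  · rw [refl_of_notMem _ hi]; exact hx i

/-- Powers of the Coxeter transformation see only the even steps. An odd step has each of its
coordinates in common with one of the two adjacent even steps. -/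
theorem alternate_nonneg_of_even {x : V → R} (hx : ∀ t, 0 ≤ alternate G (2 * t) O x) (t : ℕ) :
    0 ≤ alternate G t O x := by
  induction t using Nat.strong_induction_on generalizing x with
  | _ t ih =>
    match t with
    | 0 => exact hx 0
    | 1 =>
      refine refl_nonneg_of_refl_refl_nonneg (hx 0) ?_
      simpa [alternate] using hx 1
    | t + 2 =>
      have h := ih t (by omega) (x := refl G Oᶜ (refl G O x)) fun s => by
        have := hx (s + 1)
        rw [show 2 * (s + 1) = 2 * s + 1 + 1 by ring, alternate, alternate, compl_compl] at this
        exact this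
      rw [alternate, alternate, compl_compl]
      exact h

end Ordered

/-- Vectors with a zero coordinate have positive Tits form. -/
def IsPosProper (G : SimpleGraph V) (O : Set V) : Prop :=
  ∀ x : V → ℤ, x ≠ 0 → 0 ≤ x → (∃ i, x i = 0) → 0 < form G O x

/-! ### Real roots under alternating reflections. -/

section Integer
variable {G : SimpleGraph V} {O : Set V}

theorem nbrSum_nonneg {x : V → ℤ} (hx : 0 ≤ x) (i : V) : 0 ≤ nbrSum G x i :=
  Finset.sum_nonneg fun j _ => hx j

/-- The edges between the two supports contribute with a favourable sign. Applied to positive and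
negative parts, it shows that a vector of mixed sign has form at least 2. -/
theorem form_sub_of_disjoint {x y : V → ℤ} (hx : 0 ≤ x) (hy : 0 ≤ y) (h : ∀ i, x i * y i = 0) :
    form G O x + form G O y ≤ form G O (x - y) := by
  have h1 : ∀ i, nbrSum G (x - y) i = nbrSum G x i - nbrSum G y i := fun i => by
    simp [nbrSum]
  have h2 : ∑ i, (x - y) i ^ 2 = ∑ i, x i ^ 2 + ∑ i, y i ^ 2 := by
    rw [← Finset.sum_add_distrib]
    exact Finset.sum_congr rfl fun i _ => by
      rw [Pi.sub_apply]; linear_combination (-2) * h i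
  have h3 : ∑ i with i ∈ O, (x - y) i * nbrSum G (x - y) i ≤
      ∑ i with i ∈ O, x i * nbrSum G x i + ∑ i with i ∈ O, y i * nbrSum G y i := by
    rw [← Finset.sum_add_distrib]
    refine Finset.sum_le_sum fun i _ => ?_
    rw [h1, Pi.sub_apply]
    nlinarith [mul_nonneg (hx i) (nbrSum_nonneg (G := G) hy i),
      mul_nonneg (hy i) (nbrSum_nonneg (G := G) hx i)]
  simp only [form, h2]
  linarith

/-- Real roots are positive or negative. -/
theorem nonneg_or_nonpos (hG : IsPosProper G O) {x : V → ℤ} (hx : form G O x = 1) :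
    0 ≤ x ∨ x ≤ 0 := by
  by_contra! h
  obtain ⟨h1, h2⟩ := h
  simp only [Pi.le_def, Pi.zero_apply, not_forall, not_le] at h1 h2
  obtain ⟨i, hi⟩ := h1
  obtain ⟨j, hj⟩ := h2
  have hdis : ∀ k, x⁺ k * x⁻ k = 0 := fun k => by
    rcases le_total 0 (x k) with hk | hk
    · rw [Pi.negPart_apply, negPart_of_nonneg hk, mul_zero]
    · rw [Pi.posPart_apply, posPart_of_nonpos hk, zero_mul]
  have h := form_sub_of_disjoint (G := G) (O := O) (posPart_nonneg x) (negPart_nonneg x) hdis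
  rw [posPart_sub_negPart, hx] at h
  have hp : 0 < x⁺ j := by rw [Pi.posPart_apply, posPart_of_nonneg hj.le]; exact hj
  have hn : 0 < x⁻ i := by rw [Pi.negPart_apply, negPart_of_nonpos hi.le]; omega
  -- Each part vanishes where the other does not, so positivity on vectors with a zero coordinate
  -- suffices.
  have hp' : 0 < form G O x⁺ := hG _ (fun h0 => by rw [h0] at hp; exact lt_irrefl _ hp) (posPart_nonneg x)
    ⟨i, by rw [Pi.posPart_apply, posPart_of_nonpos hi.le]⟩
  have hn' : 0 < form G O x⁻ := hG _ (fun h0 => by rw [h0] at hn; exact lt_irrefl _ hn) (negPart_nonneg x)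
    ⟨j, by rw [Pi.negPart_apply, negPart_of_nonneg hj.le]⟩
  omega

theorem form_zero : form G O (0 : V → ℤ) = 0 := by simp [form]

/-- A nonnegative real root with balanced weighted sums stays nonnegative under a reflection. -/
theorem refl_nonneg_of_defect (hO : IsSide G O) (hG : IsPosProper G O) {w : V → ℤ}
    (hw : ∀ i, 0 < w i) {x : V → ℤ} (hx0 : 0 ≤ x) (hx : form G O x = 1)
    (hd : defect w O x = 0) : 0 ≤ refl G O x := by
  rcases nonneg_or_nonpos hG (x := refl G O x) (by rw [form_refl hO, hx]) with h | h
  · exact h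
  exfalso
  -- The reflection fixes the coordinates off `O`, so a nonpositive image means that `x` lives on
  -- `O`; a zero defect then kills it there too.
  have h1 : ∀ i, i ∉ O → x i = 0 := fun i hi => by
    have := h i
    rw [refl_of_notMem _ hi] at this
    exact le_antisymm this (hx0 i)
  have h2 : ∑ i with i ∈ O, w i * x i = 0 := by
    have : ∑ i with i ∉ O, w i * x i = 0 :=
      Finset.sum_eq_zero fun i hi => by rw [h1 i (by simpa using hi), mul_zero]
    rw [defect, this] at hd
    omega
  have h3 : x = 0 := by
    funext i
    by_cases hi : i ∈ O
    · have := (Finset.sum_eq_zero_iff_of_nonneg fun i _ => mul_nonneg (hw i).le (hx0 i)).1 h2 i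
        (by simpa using hi)
      simpa [(hw i).ne'] using this
    · exact h1 i hi
  rw [h3, form_zero] at hx
  omega

theorem IsPosProper.compl (hO : IsSide G O) (hG : IsPosProper G O) : IsPosProper G Oᶜ :=
  fun x h1 h2 h3 => by rw [form_compl hO]; exact hG x h1 h2 h3

theorem alternate_nonneg_of_defect (hO : IsSide G O) (hG : IsPosProper G O) {w : V → ℤ}
    (hw : ∀ i, 0 < w i) (hs : ∀ i, nbrSum G w i = 2 * w i) (t : ℕ) {x : V → ℤ} (hx0 : 0 ≤ x)
    (hx : form G O x = 1) (hd : defect w O x = 0) : 0 ≤ alternate G t O x := by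
  induction t generalizing O x with
  | zero => exact hx0
  | succ t ih =>
    refine ih hO.compl (hG.compl hO) (refl_nonneg_of_defect hO hG hw hx0 hx hd) ?_ ?_
    · rw [form_compl hO, form_refl hO, hx]
    · rw [defect_refl hO, hd]
      simp [hs]

/-- If the weights are superharmonic, and strictly so at some vertex where all images of `x` under
alternating reflections are positive, then these images cannot all be nonnegative. -/
theorem exists_alternate_neg (hO : IsSide G O) {w : V → ℤ} (hw : 0 ≤ w)
    (hs : ∀ i, nbrSum G w i ≤ 2 * w i) {v : V} (hv : nbrSum G w v < 2 * w v) {x : V → ℤ}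
    (hx : ∀ t, 0 ≤ alternate G t O x) (hxv : ∀ t, 0 < alternate G t O x v) : False := by
  -- Among two consecutive reflections exactly one has `v` outside its side, and there the integer
  -- defect drops by at least 1. As it never becomes negative, it exceeds every `k` at the start.
  have key : ∀ (k : ℕ) (O : Set V) (x : V → ℤ), IsSide G O → (∀ t, 0 ≤ alternate G t O x) →
      (∀ t, 0 < alternate G t O x v) → (k : ℤ) ≤ defect w O x := by
    intro k
    induction k with
    | zero => intro O x hO hx _; exact_mod_cast defect_nonneg hO hw hs hx
    | succ k ih =>
      intro O x hO hx hxv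
      have h := ih O (refl G Oᶜ (refl G O x)) hO
        (fun t => by have := hx (t + 2); rwa [alternate, alternate, compl_compl] at this)
        (fun t => by have := hxv (t + 2); rwa [alternate, alternate, compl_compl] at this)
      have h1 := defect_refl hO.compl w (refl G O x)
      rw [compl_compl, defect_refl hO] at h1
      have nn : ∀ (P : Set V) (y : V → ℤ), 0 ≤ y →
          0 ≤ ∑ i with i ∉ P, (2 * w i - nbrSum G w i) * y i := fun P y hy =>
        Finset.sum_nonneg fun i _ => mul_nonneg (sub_nonneg.2 (hs i)) (hy i)
      have pos : ∀ (P : Set V) (y : V → ℤ), 0 ≤ y → 0 < y v → v ∉ P →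
          0 < ∑ i with i ∉ P, (2 * w i - nbrSum G w i) * y i := fun P y hy hyv hP =>
        Finset.sum_pos' (fun i _ => mul_nonneg (sub_nonneg.2 (hs i)) (hy i))
          ⟨v, by simpa using hP, mul_pos (sub_pos.2 hv) hyv⟩
      have n1 := nn O x (hx 0)
      have n2 := nn Oᶜ (refl G O x) (hx 1)
      push_cast
      by_cases hvO : v ∈ O
      · have := pos Oᶜ (refl G O x) (hx 1) (hxv 1) (by simpa using hvO)
        omega
      · have := pos O x (hx 0) (hxv 0) hvO
        omega
  have := key ((defect w O x).toNat + 1) O x hO hx hxv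
  push_cast at this
  omega

/-- A family of nonnegative vectors closed under alternating reflections that vanishes at one vertex
of a connected graph vanishes eventually. -/
theorem alternate_eventually_zero (hG : G.Connected) (hO : IsSide G O) {x : V → ℤ}
    (hx : ∀ t, 0 ≤ alternate G t O x) {v : V} (hv : ∀ t, alternate G t O x v = 0) :
    ∃ t, alternate G t O x = 0 := by
  have step : ∀ (t : ℕ) (O : Set V) (x : V → ℤ), alternate G (t + 1) O x =
      refl G (if Even t then O else Oᶜ) (alternate G t O x) := by
    intro t
    induction t with
    | zero => intro O x; simp [alternate]
    | succ t ih =>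
      intro O x
      rw [alternate, ih, alternate]
      congr 1
      by_cases h : Even t <;> simp [h, Nat.even_add_one]
  -- When a vertex with value 0 is reflected and stays 0, its neighbours sum to 0, so each of them
  -- is 0. Zeros thus spread from `v` by one edge per step.
  have nbr : ∀ (T : ℕ) (i j : V), G.Adj j i → (∀ t, T ≤ t → alternate G t O x i = 0) →
      ∀ t, T + 1 ≤ t → alternate G t O x j = 0 := by
    intro T i j hij hi t ht
    have main : ∀ s, T ≤ s → i ∈ (if Even s then O else Oᶜ) →
        alternate G s O x j = 0 ∧ alternate G (s + 1) O x j = 0 := by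
      intro s hs his
      have h1 := hi (s + 1) (by omega)
      rw [step, refl_of_mem _ his, hi s hs, neg_zero, zero_add, nbrSum,
        Finset.sum_eq_zero_iff_of_nonneg fun k _ => hx s k] at h1
      have h2 := h1 j (by simpa using hij)
      refine ⟨h2, ?_⟩
      rw [step, refl_of_notMem, h2]
      have := hO j i hij
      split_ifs at his ⊢
      · exact fun h => this.1 h his
      · simp only [Set.mem_compl_iff, not_not] at his ⊢; exact this.2 his
    obtain ⟨s, rfl⟩ : ∃ s, t = s + 1 := ⟨t - 1, by omega⟩
    by_cases h : i ∈ (if Even s then O else Oᶜ)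
    · exact (main s (by omega) h).2
    · refine (main (s + 1) (by omega) ?_).1
      by_cases hs : Even s <;> simp_all [Nat.even_add_one]
  have all : ∀ i, ∃ T, ∀ t, T ≤ t → alternate G t O x i = 0 := by
    intro i
    obtain ⟨p⟩ := hG.preconnected i v
    induction p with
    | nil => exact ⟨0, fun t _ => hv t⟩
    | cons h _ ih =>
      obtain ⟨T, hT⟩ := ih hv
      exact ⟨T + 1, nbr T _ _ h hT⟩
  choose T hT using all
  exact ⟨∑ i, T i, funext fun i =>
    hT i _ (Finset.single_le_sum (f := T) (fun _ _ => Nat.zero_le _) (mem_univ i))⟩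

end Integer

/-! ### Superharmonic weights and positivity of the Tits form. -/

section Superharmonic
variable {G : SimpleGraph V} {O : Set V}

/-- The Tits form as a sum of squares, for a vector written as `w • z`. -/
theorem two_mul_form_mul {R : Type*} [CommRing R] (hO : IsSide G O) (w z : V → R) :
    4 * form G O (w * z) = 2 * ∑ i, w i * (2 * w i - nbrSum G w i) * z i ^ 2 +
      ∑ i, ∑ j with G.Adj j i, w i * w j * (z i - z j) ^ 2 := by
  have h0 : (4 : R) * form G O (w * z) = 2 * (2 * form G O (w * z)) := by ring
  have h1 : ∑ i, ∑ j with G.Adj j i, w i * w j * z j ^ 2 =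
      ∑ i, ∑ j with G.Adj j i, w i * w j * z i ^ 2 := by
    simp only [Finset.sum_filter]
    rw [Finset.sum_comm]
    refine Finset.sum_congr rfl fun i _ => Finset.sum_congr rfl fun j _ => ?_
    rw [G.adj_comm, mul_comm (w i)]
  have h2 : ∀ i, ∑ j with G.Adj j i, w i * w j * (z i - z j) ^ 2 =
      ∑ j with G.Adj j i, w i * w j * z i ^ 2 + ∑ j with G.Adj j i, w i * w j * z j ^ 2 -
        2 * ∑ j with G.Adj j i, w i * w j * (z i * z j) := fun i => by
    rw [Finset.mul_sum, ← Finset.sum_add_distrib, ← Finset.sum_sub_distrib]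
    exact Finset.sum_congr rfl fun j _ => by ring
  rw [h0, two_mul_form hO, Finset.sum_congr rfl fun i _ => h2 i, Finset.sum_sub_distrib,
    Finset.sum_add_distrib, h1]
  simp only [Finset.mul_sum, ← Finset.sum_add_distrib, ← Finset.sum_sub_distrib]
  refine Finset.sum_congr rfl fun i _ => ?_
  have h3 : ∑ j with G.Adj j i, w i * w j * z i ^ 2 = w i * nbrSum G w i * z i ^ 2 := by
    rw [nbrSum, Finset.mul_sum, Finset.sum_mul]
  have h4 : ∑ j with G.Adj j i, 2 * (w i * w j * (z i * z j)) =
      2 * (w i * z i * nbrSum G (w * z) i) := by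
    rw [nbrSum, Finset.mul_sum, Finset.mul_sum]
    exact Finset.sum_congr rfl fun j _ => by rw [Pi.mul_apply]; ring
  rw [Finset.sum_sub_distrib, Finset.sum_add_distrib, h3, h4, Pi.mul_apply]
  ring

/-- Positive weights with the sum of the weights of the neighbours of `i` at most twice the weight
of `i`. -/
def IsSuperharmonic (G : SimpleGraph V) (w : V → ℤ) : Prop :=
  (∀ i, 0 < w i) ∧ ∀ i, nbrSum G w i ≤ 2 * w i

theorem form_cast (x : V → ℤ) : ((form G O x : ℤ) : ℚ) = form G O (fun i => (x i : ℚ)) := by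
  simp [form, nbrSum]

theorem four_mul_form_eq (hO : IsSide G O) {w : V → ℤ} (hw : IsSuperharmonic G w) (x : V → ℤ) :
    4 * ((form G O x : ℤ) : ℚ) =
      2 * ∑ i, (w i : ℚ) * (2 * w i - nbrSum G w i : ℤ) * (x i / w i : ℚ) ^ 2 +
      ∑ i, ∑ j with G.Adj j i, (w i : ℚ) * w j * (x i / w i - x j / w j : ℚ) ^ 2 := by
  have h := two_mul_form_mul (R := ℚ) hO (fun i => (w i : ℚ)) (fun i => (x i / w i : ℚ))
  have h1 : (fun i => (w i : ℚ)) * (fun i => (x i / w i : ℚ)) = fun i => (x i : ℚ) := by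
    funext i
    have : (w i : ℚ) ≠ 0 := by exact_mod_cast (hw.1 i).ne'
    simp only [Pi.mul_apply]; field_simp
  rw [h1, ← form_cast] at h
  rw [h]
  simp [nbrSum]

theorem IsSuperharmonic.term_nonneg {w : V → ℤ} (hw : IsSuperharmonic G w) (x : V → ℤ) (i : V) :
    0 ≤ (w i : ℚ) * (2 * w i - nbrSum G w i : ℤ) * (x i / w i : ℚ) ^ 2 := by
  have h1 : (0 : ℚ) ≤ w i := by exact_mod_cast (hw.1 i).le
  have h2 : (0 : ℚ) ≤ (2 * w i - nbrSum G w i : ℤ) := by exact_mod_cast sub_nonneg.2 (hw.2 i)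
  positivity

theorem IsSuperharmonic.edge_nonneg {w : V → ℤ} (hw : IsSuperharmonic G w) (x : V → ℤ) (i j : V) :
    0 ≤ (w i : ℚ) * w j * (x i / w i - x j / w j : ℚ) ^ 2 := by
  have h1 : (0 : ℚ) ≤ w i := by exact_mod_cast (hw.1 i).le
  have h2 : (0 : ℚ) ≤ w j := by exact_mod_cast (hw.1 j).le
  positivity

theorem form_nonneg (hO : IsSide G O) {w : V → ℤ} (hw : IsSuperharmonic G w) (x : V → ℤ) :
    0 ≤ form G O x := by
  have h := four_mul_form_eq hO hw x
  have h1 := Finset.sum_nonneg fun i (_ : i ∈ univ) => hw.term_nonneg x i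
  have h2 := Finset.sum_nonneg fun i (_ : i ∈ univ) =>
    Finset.sum_nonneg fun j (_ : j ∈ univ.filter fun j => G.Adj j i) => hw.edge_nonneg x i j
  have : (0 : ℚ) ≤ (form G O x : ℤ) := by linarith
  exact_mod_cast this

/-- A vector with vanishing Tits form is proportional to the superharmonic weights, which are
harmonic where the vector does not vanish. -/
theorem eq_of_form_eq_zero (hG : G.Connected) (hO : IsSide G O) {w : V → ℤ}
    (hw : IsSuperharmonic G w) {x : V → ℤ} (hx : form G O x = 0) :
    (∀ i j, x i * w j = x j * w i) ∧ ∀ i, x i ≠ 0 → nbrSum G w i = 2 * w i := by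
  have h := four_mul_form_eq hO hw x
  have n1 := fun i (_ : i ∈ univ) => hw.term_nonneg x i
  have n2 := fun i (_ : i ∈ univ) =>
    Finset.sum_nonneg fun j (_ : j ∈ univ.filter fun j => G.Adj j i) => hw.edge_nonneg x i j
  have h1 := Finset.sum_nonneg n1
  have h2 := Finset.sum_nonneg n2
  rw [hx, Int.cast_zero, mul_zero] at h
  have e1 := (Finset.sum_eq_zero_iff_of_nonneg n1).1 (by linarith)
  have e2 := (Finset.sum_eq_zero_iff_of_nonneg n2).1 (by linarith)
  have w0 : ∀ i, (w i : ℚ) ≠ 0 := fun i => by exact_mod_cast (hw.1 i).ne'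
  constructor
  -- All squares vanish, so the ratio `x / w` is constant along edges, and by connectedness
  -- everywhere.
  · have edge : ∀ i j, G.Adj i j → (x i / w i : ℚ) = x j / w j := fun i j hij => by
      have e3 := (Finset.sum_eq_zero_iff_of_nonneg fun j _ => hw.edge_nonneg x i j).1
        (e2 i (mem_univ i)) j (by simpa using hij.symm)
      simp only [mul_eq_zero, w0, false_or, pow_eq_zero_iff, ne_eq, OfNat.ofNat_ne_zero,
        not_false_eq_true] at e3
      linarith
    intro i j
    have hc : (x i / w i : ℚ) = x j / w j := by
      obtain ⟨p⟩ := hG.preconnected i j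
      induction p with
      | nil => rfl
      | cons h _ ih => exact (edge _ _ h).trans ih
    rw [div_eq_div_iff (w0 i) (w0 j)] at hc
    exact_mod_cast hc
  · intro i hi
    have e3 := e1 i (mem_univ i)
    have hi' : (x i : ℚ) ≠ 0 := by exact_mod_cast hi
    simp only [mul_eq_zero, w0, false_or, pow_eq_zero_iff, ne_eq, OfNat.ofNat_ne_zero,
      not_false_eq_true, div_eq_zero_iff, hi', or_false] at e3
    have : (2 * w i - nbrSum G w i : ℤ) = 0 := by exact_mod_cast e3
    omega

theorem isPosProper_of_superharmonic (hG : G.Connected) (hO : IsSide G O) {w : V → ℤ}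
    (hw : IsSuperharmonic G w) : IsPosProper G O := by
  intro x hx _ ⟨i, hi⟩
  refine lt_of_le_of_ne (form_nonneg hO hw x) fun h => hx ?_
  funext j
  have := (eq_of_form_eq_zero hG hO hw h.symm).1 j i
  rw [hi, zero_mul] at this
  simpa [(hw.1 i).ne'] using this

/-- The Tits form is positive definite. -/
def IsPosDef (G : SimpleGraph V) (O : Set V) : Prop := ∀ x : V → ℤ, x ≠ 0 → 0 < form G O x

theorem IsPosDef.isPosProper (h : IsPosDef G O) : IsPosProper G O := fun x hx _ _ => h x hx

theorem isPosDef_of_superharmonic (hG : G.Connected) (hO : IsSide G O) {w : V → ℤ}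
    (hw : IsSuperharmonic G w) {v : V} (hv : nbrSum G w v < 2 * w v) : IsPosDef G O := by
  intro x hx
  refine lt_of_le_of_ne (form_nonneg hO hw x) fun h => hx ?_
  obtain ⟨h1, h2⟩ := eq_of_form_eq_zero hG hO hw h.symm
  have hxv : x v = 0 := by
    by_contra hne
    exact hv.ne (h2 v hne)
  funext j
  have := h1 j v
  rw [hxv, zero_mul] at this
  simpa [(hw.1 v).ne'] using this

/-- The edges of `G` with both ends in `S`. -/
def restrictTo (G : SimpleGraph V) (S : Set V) : SimpleGraph V where
  Adj i j := G.Adj i j ∧ i ∈ S ∧ j ∈ S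
  symm := ⟨fun _ _ h => ⟨h.1.symm, h.2.2, h.2.1⟩⟩
  loopless := ⟨fun _ h => G.loopless.irrefl _ h.1⟩

theorem IsSide.restrictTo (hO : IsSide G O) (S : Set V) : IsSide (restrictTo G S) O :=
  fun i j h => hO i j h.1

/-- Removing edges only lowers the neighbour sums. Keeping the vertex type and making the vertices
outside `S` isolated lets the same `w` serve throughout the induction on supports. -/
theorem IsSuperharmonic.restrictTo {w : V → ℤ} (hw : IsSuperharmonic G w) (S : Set V) :
    IsSuperharmonic (restrictTo G S) w :=
  ⟨hw.1, fun i => (Finset.sum_le_sum_of_subset_of_nonneg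
    (fun j hj => by simp only [mem_filter, mem_univ, true_and] at hj ⊢; exact hj.1)
    fun j _ _ => (hw.1 j).le).trans (hw.2 i)⟩

theorem nbrSum_restrictTo {R : Type*} [AddCommMonoid R] {S : Set V} {x : V → R} 
    (hx : ∀ i, i ∉ S → x i = 0) {i : V} (hi : i ∈ S) :
    nbrSum (restrictTo G S) x i = nbrSum G x i := by
  simp only [nbrSum, Finset.sum_filter]
  refine Finset.sum_congr rfl fun j _ => ?_
  by_cases hj : j ∈ S
  · simp [Orthoscalar.restrictTo, hi, hj]
  · simp [hx j hj]

theorem form_restrictTo {S : Set V} {x : V → ℤ} (hx : ∀ i, i ∉ S → x i = 0) :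
    form (restrictTo G S) O x = form G O x := by
  simp only [form]
  congr 1
  refine Finset.sum_congr rfl fun i _ => ?_
  by_cases hi : i ∈ S
  · rw [nbrSum_restrictTo hx hi]
  · simp [hx i hi]

theorem IsPosDef.restrictTo (h : IsPosDef G O) (S : Set V) : IsPosDef (restrictTo G S) O := by
  intro x hx
  refine (h |x| (by simpa using hx)).trans_le ?_
  simp only [form]
  refine sub_le_sub (by simp) (Finset.sum_le_sum fun i _ => ?_)
  calc x i * nbrSum (Orthoscalar.restrictTo G S) x i
      ≤ |x| i * nbrSum (Orthoscalar.restrictTo G S) |x| i := by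
        rw [nbrSum, nbrSum, Finset.mul_sum, Finset.mul_sum]
        refine Finset.sum_le_sum fun j _ => ?_
        rw [Pi.abs_apply, Pi.abs_apply, ← abs_mul]
        exact le_abs_self _
    _ ≤ |x| i * nbrSum G |x| i := by
        refine mul_le_mul_of_nonneg_left (Finset.sum_le_sum_of_subset_of_nonneg (fun j hj => ?_)
          fun j _ _ => abs_nonneg _) (abs_nonneg _)
        simp only [mem_filter, mem_univ, true_and] at hj ⊢; exact hj.1

/-- If the Tits form takes nonzero values at nonzero vectors with a zero coordinate, then it is
positive definite on every proper set of vertices. -/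
theorem IsPosProper.isPosDef_restrictTo (h : IsPosProper G O) {S : Set V} (hS : S ≠ Set.univ) :
    IsPosDef (Orthoscalar.restrictTo G S) O := by
  obtain ⟨v, hv⟩ := (Set.ne_univ_iff_exists_notMem S).1 hS
  intro x hx
  -- Absolute values only lower the form, and the isolated vertices outside `S` contribute pure
  -- squares. The vector `y` vanishes at `v`, so the hypothesis applies to it.
  set y : V → ℤ := fun i => if i ∈ S then |x i| else 0 with hy
  have h1 : form G O y + ∑ i with i ∉ S, x i ^ 2 ≤ form (Orthoscalar.restrictTo G S) O x := by
    have e : ∑ i, x i ^ 2 = ∑ i, y i ^ 2 + ∑ i with i ∉ S, x i ^ 2 := by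
      rw [Finset.sum_filter, ← Finset.sum_add_distrib]
      refine Finset.sum_congr rfl fun i _ => ?_
      by_cases hi : i ∈ S <;> simp [hy, hi]
    have f : ∑ i with i ∈ O, x i * nbrSum (Orthoscalar.restrictTo G S) x i ≤
        ∑ i with i ∈ O, y i * nbrSum G y i := by
      refine Finset.sum_le_sum fun i _ => ?_
      rw [nbrSum, nbrSum, Finset.mul_sum, Finset.mul_sum, Finset.sum_filter, Finset.sum_filter]
      refine Finset.sum_le_sum fun j _ => ?_
      by_cases hi : i ∈ S <;> by_cases hj : j ∈ S <;>
        simp only [Orthoscalar.restrictTo, hy, hi, hj, and_true, and_false, if_true, if_false,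
          mul_zero, zero_mul, ite_self, le_refl]
      split_ifs
      · rw [← abs_mul]; exact le_abs_self _
      · exact le_rfl
    simp only [form, e]
    linarith
  by_cases hy0 : y = 0
  · have hxS : ∀ i ∈ S, x i = 0 := fun i hi => by
      have := congrFun hy0 i
      simpa [hy, hi] using this
    obtain ⟨i, hi⟩ : ∃ i, x i ≠ 0 := by
      by_contra! hall
      exact hx (funext hall)
    rw [hy0, form_zero] at h1
    have : 0 < ∑ i with i ∉ S, x i ^ 2 :=
      Finset.sum_pos' (fun i _ => sq_nonneg _)
        ⟨i, by simpa using fun hs => hi (hxS i hs), by positivity⟩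
    omega
  · have h2 := h y hy0 (fun i => by simp only [hy]; split_ifs <;> simp) ⟨v, by simp [hy, hv]⟩
    have : 0 ≤ ∑ i with i ∉ S, x i ^ 2 := Finset.sum_nonneg fun i _ => sq_nonneg _
    omega

end Superharmonic

end Combinatorics
end Orthoscalar

namespace Orthoscalar

/-! ### Representations of graphs by matrices and the reflection functor. -/

section GraphRep

open Finset Matrix
open scoped Classical ComplexOrder
set_option linter.unusedSectionVars false

variable {V : Type u} [Fintype V]

/-- A representation of a graph by matrices. -/
structure IsGraphRep (G : SimpleGraph V) {n : V → ℕ}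
    (A : ∀ i j, Matrix (Fin (n i)) (Fin (n j)) ℂ) : Prop where
  zero : ∀ i j, ¬ G.Adj i j → A i j = 0
  conj : ∀ i j, (A i j)ᴴ = A j i

/-- The matrices of `A` at each vertex satisfy the orthoscalarity condition with character `χ`. -/
def HasScalar {n : V → ℕ} (A : ∀ i j, Matrix (Fin (n i)) (Fin (n j)) ℂ) (χ : V → ℝ) : Prop :=
  ∀ i, ∑ j, A i j * A j i = (χ i : ℂ) • 1

/-- `A` is not zero, and its commutant consists of scalars. -/
def IsIrred {n : V → ℕ} (A : ∀ i j, Matrix (Fin (n i)) (Fin (n j)) ℂ) : Prop :=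
  (∃ i, n i ≠ 0) ∧ ∀ f : ∀ i, Matrix (Fin (n i)) (Fin (n i)) ℂ,
    (∀ i j, f i * A i j = A i j * f j) → ∃ c : ℂ, ∀ i, f i = c • 1

/-- There is an irreducible orthoscalar representation of dimension `n` with character `χ`. -/
def Realizes (G : SimpleGraph V) (n : V → ℕ) (χ : V → ℝ) : Prop :=
  ∃ A : ∀ i j, Matrix (Fin (n i)) (Fin (n j)) ℂ, IsGraphRep G A ∧ HasScalar A χ ∧ IsIrred A

variable {G : SimpleGraph V} {O : Set V} {n : V → ℕ}

/-- On a zero space every number satisfies the scalar condition, so the character is free off the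
support. This freedom becomes the new parameters in `HasCone.of_refl`. -/
theorem Realizes.congr {χ ψ : V → ℝ} (h : Realizes G n χ) (hχ : ∀ i, n i ≠ 0 → χ i = ψ i) :
    Realizes G n ψ := by
  obtain ⟨A, h1, h2, h3⟩ := h
  refine ⟨A, h1, fun i => ?_, h3⟩
  by_cases hi : n i = 0
  · have : IsEmpty (Fin (n i)) := by rw [hi]; infer_instance
    exact Subsingleton.elim _ _
  · rw [h2, hχ i hi]

theorem Realizes.congr_graph {G' : SimpleGraph V} {χ : V → ℝ} (h : Realizes G n χ)
    (hG : ∀ i j, n i ≠ 0 → n j ≠ 0 → G.Adj i j → G'.Adj i j) : Realizes G' n χ := by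
  obtain ⟨A, h1, h2, h3⟩ := h
  refine ⟨A, ⟨fun i j hij => ?_, h1.conj⟩, h2, h3⟩
  by_cases hi : n i = 0
  · have : IsEmpty (Fin (n i)) := by rw [hi]; infer_instance
    exact Subsingleton.elim _ _
  by_cases hj : n j = 0
  · have : IsEmpty (Fin (n j)) := by rw [hj]; infer_instance
    exact Subsingleton.elim _ _
  exact h1.zero i j fun h => hij (hG i j hi hj h)

section Positivity
variable {A : ∀ i j, Matrix (Fin (n i)) (Fin (n j)) ℂ} {χ : V → ℝ}

theorem scalar_eq_sum (hA : IsGraphRep G A) (hχ : HasScalar A χ) (i : V) (a : Fin (n i)) :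
    χ i = ∑ j, ∑ b, Complex.normSq (A i j a b) := by
  have h := congrFun (congrFun (hχ i) a) a
  rw [Matrix.sum_apply, Matrix.smul_apply, Matrix.one_apply_eq, smul_eq_mul, mul_one] at h
  have h' : (χ i : ℂ) = ((∑ j, ∑ b, Complex.normSq (A i j a b) : ℝ) : ℂ) := by
    rw [← h]
    push_cast
    refine Finset.sum_congr rfl fun j _ => ?_
    rw [Matrix.mul_apply]
    refine Finset.sum_congr rfl fun b _ => ?_
    rw [← hA.conj i j, Matrix.conjTranspose_apply, Complex.star_def, Complex.mul_conj]
  exact_mod_cast h'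

theorem scalar_nonneg (hA : IsGraphRep G A) (hχ : HasScalar A χ) {i : V} (hi : n i ≠ 0) :
    0 ≤ χ i := by
  rw [scalar_eq_sum hA hχ i ⟨0, by omega⟩]
  exact Finset.sum_nonneg fun j _ => Finset.sum_nonneg fun b _ => Complex.normSq_nonneg _

/-- If `χ i = 0`, all matrices at `i` vanish, and the projection onto the space at `i` is a
commuting family that is not scalar because of the space at `k`. -/
theorem scalar_pos (hA : IsGraphRep G A) (hχ : HasScalar A χ) (hirr : IsIrred A) {i k : V}
    (hi : n i ≠ 0) (hki : k ≠ i) (hk : n k ≠ 0) : 0 < χ i := by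
  refine lt_of_le_of_ne (scalar_nonneg hA hχ hi) fun h0 => ?_
  have hz : ∀ j, A i j = 0 := fun j => by
    ext a b
    have h1 := scalar_eq_sum hA hχ i a
    rw [← h0] at h1
    have h2 := (Finset.sum_eq_zero_iff_of_nonneg fun j _ =>
      Finset.sum_nonneg fun b _ => Complex.normSq_nonneg (A i j a b)).1 h1.symm j (mem_univ j)
    have h3 := (Finset.sum_eq_zero_iff_of_nonneg fun b _ =>
      Complex.normSq_nonneg (A i j a b)).1 h2 b (mem_univ b)
    simpa using Complex.normSq_eq_zero.1 h3
  have hz' : ∀ j, A j i = 0 := fun j => by rw [← hA.conj, hz, Matrix.conjTranspose_zero]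
  obtain ⟨c, hc⟩ := hirr.2 (fun l => if l = i then 1 else 0) fun l j => by
    by_cases hl : l = i
    · subst hl; simp [hz]
    · by_cases hj : j = i
      · subst hj; simp [hz']
      · simp [hl, hj]
  have h1 := congrFun (congrFun (hc i) ⟨0, by omega⟩) ⟨0, by omega⟩
  have h2 := congrFun (congrFun (hc k) ⟨0, by omega⟩) ⟨0, by omega⟩
  simp [hki] at h1 h2
  rw [← h1] at h2
  exact one_ne_zero h2.symm

end Positivity

/-- A block row with `M Mᴴ = c` is completed by another one to a multiple of a unitary matrix. -/
theorem exists_complement {ι : Type*} [Fintype ι] [DecidableEq ι] {a b : ℕ}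
    (M : Matrix (Fin a) ι ℂ) {c : ℝ} (hab : a + b = Fintype.card ι) (hc : a + b ≠ 0 → 0 < c)
    (h : M * Mᴴ = (c : ℂ) • 1) :
    ∃ C : Matrix (Fin b) ι ℂ, C * Cᴴ = (c : ℂ) • 1 ∧ Mᴴ * M + Cᴴ * C = (c : ℂ) • 1 := by
  by_cases h0 : a + b = 0
  · have : IsEmpty ι := Fintype.card_eq_zero_iff.1 (by omega)
    obtain ⟨rfl, rfl⟩ : a = 0 ∧ b = 0 := by omega
    exact ⟨0, Subsingleton.elim _ _, Subsingleton.elim _ _⟩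
  have hc := hc h0
  set s : ℝ := Real.sqrt c with hs
  have hs0 : s ≠ 0 := (Real.sqrt_pos.2 hc).ne'
  have hss : (s : ℂ) * s = c := by rw [← Complex.ofReal_mul, Real.mul_self_sqrt hc.le]
  have hsC : (s : ℂ) ≠ 0 := by exact_mod_cast hs0
  -- The rows divided by `√c` are orthonormal; they are extended to an orthonormal basis. The values
  -- on the second summand are placeholders.
  let v : Fin a ⊕ Fin b → EuclideanSpace ℂ ι :=
    Sum.elim (fun x => WithLp.toLp 2 fun y => (s : ℂ)⁻¹ * M x y) fun _ => 0
  have hM : ∀ x y, ∑ p, M x p * star (M y p) = if x = y then (c : ℂ) else 0 := fun x y => by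
    have := congrFun (congrFun h x) y
    simpa [Matrix.mul_apply, Matrix.one_apply] using this
  have hv : Orthonormal ℂ ((Set.range Sum.inl).domRestrict v) := by
    rw [orthonormal_iff_ite]
    rintro ⟨_, hx⟩ ⟨_, hy⟩
    obtain ⟨x, rfl⟩ := hx
    obtain ⟨y, rfl⟩ := hy
    have e : inner ℂ (v (Sum.inl x)) (v (Sum.inl y)) = (c : ℂ)⁻¹ * ∑ p, M y p * star (M x p) := by
      simp only [v, Sum.elim_inl, PiLp.inner_apply, RCLike.inner_apply, Finset.mul_sum]
      refine Finset.sum_congr rfl fun p _ => ?_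
      rw [← hss]
      simp only [map_mul, map_inv₀, Complex.conj_ofReal, Complex.star_def, mul_inv]
      ring
    change inner ℂ (v (Sum.inl x)) (v (Sum.inl y)) = _
    rw [e, hM]
    by_cases hxy : x = y
    · subst hxy
      have : (c : ℂ) ≠ 0 := by exact_mod_cast hc.ne'
      simp [this]
    · rw [if_neg (Ne.symm hxy), mul_zero, if_neg]
      exact fun h => hxy (Sum.inl_injective (congrArg Subtype.val h))
  obtain ⟨B, hB⟩ := hv.exists_orthonormalBasis_extension_of_card_eq
    (by simp [← hab])
  let C : Matrix (Fin b) ι ℂ := Matrix.of fun x y => s * B (Sum.inr x) y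
  have hBM : ∀ x y, (s : ℂ) * B (Sum.inl x) y = M x y := fun x y => by
    rw [hB _ ⟨x, rfl⟩]
    simp [v, hsC]
  let U : Matrix (Fin a ⊕ Fin b) ι ℂ := Matrix.fromRows M C
  have hU : ∀ x y, U x y = s * B x y := by
    rintro (x | x) y
    · simp [U, hBM]
    · simp [U, C]
  have hUU : U * Uᴴ = (c : ℂ) • 1 := by
    ext x y
    have := orthonormal_iff_ite.1 B.orthonormal y x
    rw [PiLp.inner_apply] at this
    simp only [Matrix.mul_apply, hU, Matrix.conjTranspose_apply, Matrix.smul_apply,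
      Matrix.one_apply, smul_eq_mul]
    have e : ∀ p, (s : ℂ) * B x p * star ((s : ℂ) * B y p) = c * inner ℂ (B y p) (B x p) := by
      intro p
      rw [← hss]
      simp only [RCLike.inner_apply, star_mul', Complex.star_def, Complex.conj_ofReal]
      ring
    rw [Finset.sum_congr rfl fun p _ => e p, ← Finset.mul_sum, this]
    simp [eq_comm]
  have hcC : (c : ℂ) ≠ 0 := by exact_mod_cast hc.ne'
  have hUU' : Uᴴ * U = (c : ℂ) • 1 := by
    have h1 : U * ((c : ℂ)⁻¹ • Uᴴ) = 1 := by
      rw [Matrix.mul_smul, hUU, smul_smul, inv_mul_cancel₀ hcC, one_smul]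
    have h2 : ((c : ℂ)⁻¹ • Uᴴ) * U = 1 :=
      (Matrix.mul_eq_one_comm_of_card_eq _ _ _ (by
      rw [Fintype.card_sum, Fintype.card_fin, Fintype.card_fin, hab])).1 h1
    rw [Matrix.smul_mul] at h2
    rw [← h2, smul_smul, mul_inv_cancel₀ hcC, one_smul]
  refine ⟨C, ?_, ?_⟩
  · ext x y
    have := congrFun (congrFun hUU (Sum.inr x)) (Sum.inr y)
    simpa [Matrix.mul_apply, U, Matrix.one_apply] using this
  · ext x y
    have := congrFun (congrFun hUU' x) y
    simpa [Matrix.mul_apply, U] using this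

theorem exists_complement_blocks {J : Type*} [Fintype J] {a b : ℕ} {r : J → ℕ}
    (M : ∀ j, Matrix (Fin a) (Fin (r j)) ℂ) {c : ℝ} (hab : a + b = ∑ j, r j)
    (hc : a + b ≠ 0 → 0 < c) (h : ∑ j, M j * (M j)ᴴ = (c : ℂ) • 1) :
    ∃ C : ∀ j, Matrix (Fin b) (Fin (r j)) ℂ, ∑ j, C j * (C j)ᴴ = (c : ℂ) • 1 ∧
      (∀ j, (M j)ᴴ * M j + (C j)ᴴ * C j = (c : ℂ) • 1) ∧
      ∀ j k, j ≠ k → (M j)ᴴ * M k + (C j)ᴴ * C k = 0 := by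
  obtain ⟨C, h1, h2⟩ := exists_complement (ι := Σ j, Fin (r j)) (b := b)
    (Matrix.of fun x p => M p.1 x p.2) (c := c) (by simp [hab]) hc (by
      rw [← h]
      ext x y
      simp [Matrix.mul_apply, Matrix.sum_apply, Fintype.sum_sigma])
  refine ⟨fun j => Matrix.of fun x y => C x ⟨j, y⟩, ?_, fun j => ?_, fun j k hjk => ?_⟩
  · rw [← h1]
    ext x y
    simp [Matrix.mul_apply, Matrix.sum_apply, Fintype.sum_sigma]
  · ext x y
    have := congrFun (congrFun h2 ⟨j, x⟩) ⟨j, y⟩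
    simpa [Matrix.mul_apply, Matrix.one_apply] using this
  · ext x y
    have := congrFun (congrFun h2 ⟨j, x⟩) ⟨k, y⟩
    simpa [Matrix.mul_apply, Matrix.one_apply, hjk] using this

/-- Off `O` the old and new dimensions are equal numbers but not the same term; a unitary between
them replaces type casts. -/
theorem exists_cast_matrix {a b : ℕ} (h : a = b) :
    ∃ E : Matrix (Fin a) (Fin b) ℂ, E * Eᴴ = 1 ∧ Eᴴ * E = 1 := by
  subst h
  exact ⟨1, by simp, by simp⟩

theorem matrix_eq_of_eq_zero {a b : ℕ} (h : a = 0 ∨ b = 0) (M N : Matrix (Fin a) (Fin b) ℂ) :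
    M = N := by
  rcases h with rfl | rfl <;> exact Subsingleton.elim _ _

/-- The reflection functor: the spaces at the vertices of `O` are replaced by the orthogonal
complements of their images in the sums of the neighbouring spaces. -/
theorem Realizes.refl (hO : IsSide G O) {n n' : V → ℕ} {χ : V → ℝ} (h : Realizes G n χ)
    (hn : ∀ i ∈ O, n i + n' i = nbrSum G n i) (hn' : ∀ i, i ∉ O → n' i = n i)
    (hpos : ∀ i ∈ O, n i + n' i ≠ 0 → 0 < χ i) : Realizes G n' (Orthoscalar.refl G Oᶜ χ) := by
  obtain ⟨A, hA, hχ, hne, hirr⟩ := h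
  -- The complementary rows. Their Gram blocks are `χ i` minus those of `A` on the diagonal and the
  -- negatives of those of `A` off it; this is all that the rest uses.
  have hC : ∀ i, ∃ C : ∀ j, Matrix (Fin (n' i)) (Fin (n j)) ℂ, i ∈ O →
      (∀ j, ¬ G.Adj i j → C j = 0) ∧ ∑ j, C j * (C j)ᴴ = (χ i : ℂ) • 1 ∧
      (∀ j, G.Adj i j → A j i * A i j + (C j)ᴴ * C j = (χ i : ℂ) • 1) ∧
      ∀ j k, j ≠ k → A j i * A i k + (C j)ᴴ * C k = 0 := by
    intro i
    by_cases hi : i ∈ O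
    swap
    · exact ⟨0, fun h => absurd h hi⟩
    have hsub : ∀ {M : Type} [AddCommMonoid M] (F : V → M), (∀ j, ¬ G.Adj i j → F j = 0) →
        ∑ j : {j // G.Adj i j}, F j = ∑ j, F j := fun F hF => by
      rw [← Finset.sum_filter_add_sum_filter_not univ (G.Adj i) F,
        Finset.sum_eq_zero (s := univ.filter fun j => ¬ G.Adj i j)
          fun j hj => hF j (by simpa using hj), add_zero]
      exact (Finset.sum_subtype _ (by simp) _).symm
    obtain ⟨C, h1, h2, h3⟩ := exists_complement_blocks (J := {j // G.Adj i j}) (b := n' i)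
      (r := fun j => n j) (fun j => A i j) (c := χ i) (by
        rw [hn i hi, nbrSum]
        exact Finset.sum_subtype _ (by simp [G.adj_comm]) _) (hpos i hi) (by
        rw [← hχ i, hsub (fun j => A i j * (A i j)ᴴ) fun j hj => by simp [hA.zero i j hj]]
        simp only [hA.conj])
    have ext : ∀ j (hj : G.Adj i j), (if h : G.Adj i j then C ⟨j, h⟩ else 0) = C ⟨j, hj⟩ :=
      fun j hj => dif_pos hj
    refine ⟨fun j => if h : G.Adj i j then C ⟨j, h⟩ else 0, fun _ => ⟨?_, ?_, ?_, ?_⟩⟩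
    · exact fun j hj => dif_neg hj
    · rw [← h1, ← hsub _ fun j hj => by simp [hj]]
      refine Finset.sum_congr rfl fun j _ => ?_
      simp only [ext j.1 j.2]
    · intro j hj
      simp only [ext j hj]
      rw [← h2 ⟨j, hj⟩, hA.conj]
    · intro j k hjk
      by_cases hj : G.Adj i j
      · by_cases hk : G.Adj i k
        · simp only [ext j hj, ext k hk]
          rw [← h3 ⟨j, hj⟩ ⟨k, hk⟩ (by simpa using hjk), hA.conj]
        · simp [hk, hA.zero i k hk]
      · simp [hj, hA.zero j i (fun h => hj h.symm)]
  choose C hC using hC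
  have hE : ∀ j, ∃ E : Matrix (Fin (n' j)) (Fin (n j)) ℂ, j ∉ O → E * Eᴴ = 1 ∧ Eᴴ * E = 1 := by
    intro j
    by_cases hj : j ∈ O
    · exact ⟨0, fun h => absurd hj h⟩
    · obtain ⟨E, hE⟩ := exists_cast_matrix (hn' j hj)
      exact ⟨E, fun _ => hE⟩
  choose E hE using hE
  have side : ∀ {i j}, G.Adj i j → i ∈ O → j ∉ O := fun hij hi => (hO _ _ hij).1 hi
  have side' : ∀ {i j}, G.Adj i j → i ∉ O → j ∈ O := fun hij hi => by
    by_contra hj; exact hi ((hO _ _ hij).2 hj)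
  let B : ∀ i j, Matrix (Fin (n' i)) (Fin (n' j)) ℂ := fun i j =>
    if G.Adj i j then if i ∈ O then C i j * (E j)ᴴ else E i * (C j i)ᴴ else 0
  have B1 : ∀ i j, i ∈ O → B i j = C i j * (E j)ᴴ := fun i j hi => by
    by_cases hij : G.Adj i j
    · simp [B, hij, hi]
    · rw [(hC i hi).1 j hij, Matrix.zero_mul]
      exact if_neg hij
  have B2 : ∀ i j, i ∈ O → B j i = E j * (C i j)ᴴ := fun i j hi => by
    by_cases hij : G.Adj i j
    · simp [B, hij.symm, side hij hi]
    · have hji : ¬ G.Adj j i := fun h => hij h.symm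
      simp [B, hji, (hC i hi).1 j hij]
  refine ⟨B, ⟨fun i j hij => by simp [B, hij], fun i j => ?_⟩, fun i => ?_, ?_, ?_⟩
  · by_cases hij : G.Adj i j
    · by_cases hi : i ∈ O
      · rw [B1 i j hi, B2 i j hi]; simp
      · rw [B2 j i (side' hij hi), B1 j i (side' hij hi)]; simp
    · have hji : ¬ G.Adj j i := fun h => hij h.symm
      simp [B, hij, hji]
  · by_cases hi : i ∈ O
    · rw [refl_of_notMem _ (by simpa using hi), ← (hC i hi).2.1]
      refine Finset.sum_congr rfl fun j _ => ?_
      by_cases hij : G.Adj i j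
      · rw [B1 i j hi, B2 i j hi, Matrix.mul_assoc, ← Matrix.mul_assoc _ (E j),
          (hE j (side hij hi)).2, Matrix.one_mul]
      · simp [B, hij, (hC i hi).1 j hij]
    · rw [refl_of_mem _ (by simpa using hi)]
      -- A neighbour `j` now contributes `χ j - A i j * A j i`. The sum over the neighbours is their
      -- total character minus `χ i`, the reflected value.
      have e1 : ∀ j, B i j * B j i =
          E i * ((if G.Adj j i then (χ j : ℂ) • 1 else 0) - A i j * A j i) * (E i)ᴴ := fun j => by
        by_cases hij : G.Adj j i
        · have hj := side' hij.symm hi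
          rw [B1 j i hj, B2 j i hj, if_pos hij, ← (hC j hj).2.2.1 i hij, add_sub_cancel_left]
          simp only [Matrix.mul_assoc]
        · simp [B, hij, hA.zero j i hij]
      rw [Finset.sum_congr rfl fun j _ => e1 j, ← Matrix.sum_mul, ← Matrix.mul_sum,
        Finset.sum_sub_distrib, hχ i, ← Finset.sum_filter, ← Finset.sum_smul, ← sub_smul,
        Matrix.mul_smul, Matrix.mul_one, Matrix.smul_mul, (hE i hi).1]
      congr 1
      rw [nbrSum]
      push_cast
      ring
  · obtain ⟨i, hi⟩ := hne
    by_cases hiO : i ∈ O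
    · have h1 : nbrSum G n i ≠ 0 := by rw [← hn i hiO]; omega
      obtain ⟨j, hj, hj0⟩ := Finset.exists_ne_zero_of_sum_ne_zero h1
      have hj : G.Adj j i := by simpa using hj
      exact ⟨j, by rwa [hn' j (side hj.symm hiO)]⟩
    · exact ⟨i, by rwa [hn' i hiO]⟩
  · intro g hg
    -- The new commutant is carried back to the old one: `p` is `g` off `O` in the old coordinates.
    -- It commutes with the Gram blocks of `C`, hence with those of `A`.
    let p : ∀ j, Matrix (Fin (n j)) (Fin (n j)) ℂ := fun j => (E j)ᴴ * g j * E j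
    have g1 : ∀ i j, i ∈ O → g i * C i j = C i j * p j := fun i j hi => by
      by_cases hij : G.Adj i j
      · have h := congrArg (· * E j) (hg i j)
        simp only [B1 i j hi, Matrix.mul_assoc, (hE j (side hij hi)).2, Matrix.mul_one] at h
        simpa only [p, Matrix.mul_assoc] using h
      · simp [(hC i hi).1 j hij]
    have g2 : ∀ i j, i ∈ O → p j * (C i j)ᴴ = (C i j)ᴴ * g i := fun i j hi => by
      by_cases hij : G.Adj i j
      · have h := congrArg ((E j)ᴴ * ·) (hg j i)
        simp only [B2 i j hi] at h
        rw [← Matrix.mul_assoc (E j)ᴴ (E j * (C i j)ᴴ), ← Matrix.mul_assoc (E j)ᴴ (E j),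
          (hE j (side hij hi)).2, Matrix.one_mul] at h
        simpa only [p, Matrix.mul_assoc] using h
      · simp [(hC i hi).1 j hij]
    have g3 : ∀ i j k, i ∈ O → A j i * A i k * p k = p j * (A j i * A i k) := fun i j k hi => by
      have h : (C i j)ᴴ * C i k * p k = p j * ((C i j)ᴴ * C i k) := by
        rw [Matrix.mul_assoc, ← g1 i k hi, ← Matrix.mul_assoc, ← g2 i j hi, Matrix.mul_assoc]
      by_cases hjk : j = k
      · subst hjk
        by_cases hij : G.Adj i j
        · have := (hC i hi).2.2.1 j hij
          rw [← eq_sub_iff_add_eq] at this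
          rw [this, Matrix.sub_mul, Matrix.mul_sub, h]
          simp
        · simp [hA.zero i j hij]
      · have := (hC i hi).2.2.2 j k hjk
        rw [← eq_neg_iff_add_eq_zero] at this
        rw [this, Matrix.neg_mul, Matrix.mul_neg, h]
    -- On `O` the extension is forced: `f i * A i j = A i j * p j`, multiplied by `A j i` and summed
    -- over `j`, gives `χ i • f i`.
    let f : ∀ i, Matrix (Fin (n i)) (Fin (n i)) ℂ := fun i =>
      if i ∈ O then (χ i : ℂ)⁻¹ • ∑ j, A i j * p j * A j i else p i
    have f1 : ∀ i ∈ O, f i = (χ i : ℂ)⁻¹ • ∑ j, A i j * p j * A j i := fun i hi => if_pos hi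
    have f2 : ∀ i, i ∉ O → f i = p i := fun i hi => if_neg hi
    have χ0 : ∀ i ∈ O, n i + n' i ≠ 0 → (χ i : ℂ) ≠ 0 := fun i hi h => by
      exact_mod_cast (hpos i hi h).ne'
    have f3 : ∀ i k, i ∈ O → f i * A i k = A i k * p k := fun i k hi => by
      by_cases h0 : n i = 0
      · exact matrix_eq_of_eq_zero (.inl h0) _ _
      have h : (∑ j, A i j * p j * A j i) * A i k = (χ i : ℂ) • (A i k * p k) := by
        rw [Matrix.sum_mul, ← Matrix.one_mul (A i k * p k), ← Matrix.smul_mul,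
          ← hχ i, Matrix.sum_mul]
        refine Finset.sum_congr rfl fun j _ => ?_
        rw [Matrix.mul_assoc, Matrix.mul_assoc, ← g3 i j k hi]
        simp only [Matrix.mul_assoc]
      rw [f1 i hi, Matrix.smul_mul, h, smul_smul, inv_mul_cancel₀ (χ0 i hi (by omega)), one_smul]
    have f4 : ∀ i k, i ∈ O → A k i * f i = p k * A k i := fun i k hi => by
      by_cases h0 : n i = 0
      · exact matrix_eq_of_eq_zero (.inr h0) _ _
      have h : A k i * (∑ j, A i j * p j * A j i) = (χ i : ℂ) • (p k * A k i) := by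
        rw [Matrix.mul_sum, ← Matrix.mul_one (p k * A k i), ← Matrix.mul_smul,
          ← hχ i, Matrix.mul_sum]
        refine Finset.sum_congr rfl fun j _ => ?_
        rw [← Matrix.mul_assoc, ← Matrix.mul_assoc, g3 i k j hi]
        simp only [Matrix.mul_assoc]
      rw [f1 i hi, Matrix.mul_smul, h, smul_smul, inv_mul_cancel₀ (χ0 i hi (by omega)), one_smul]
    obtain ⟨c, hc⟩ := hirr f fun i j => by
      by_cases hij : G.Adj i j
      · by_cases hi : i ∈ O
        · rw [f2 j (side hij hi), f3 i j hi]
        · rw [f2 i hi, f4 j i (side' hij hi)]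
      · simp [hA.zero i j hij]
    have pc : ∀ j, j ∉ O → p j = c • 1 := fun j hj => by rw [← f2 j hj, hc]
    refine ⟨c, fun i => ?_⟩
    by_cases hi : i ∈ O
    · by_cases h0 : n' i = 0
      · exact matrix_eq_of_eq_zero (.inl h0) _ _
      have h : (χ i : ℂ) • g i = (χ i : ℂ) • (c • 1) := by
        calc (χ i : ℂ) • g i = g i * ∑ j, C i j * (C i j)ᴴ := by
              rw [(hC i hi).2.1, Matrix.mul_smul, Matrix.mul_one]
          _ = ∑ j, c • (C i j * (C i j)ᴴ) := by
              rw [Finset.mul_sum]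
              refine Finset.sum_congr rfl fun j _ => ?_
              by_cases hij : G.Adj i j
              · rw [← Matrix.mul_assoc, g1 i j hi, pc j (side hij hi)]
                simp
              · simp [(hC i hi).1 j hij]
          _ = (χ i : ℂ) • (c • 1) := by
              rw [← Finset.smul_sum, (hC i hi).2.1, smul_comm]
      exact smul_right_injective _ (χ0 i hi (by omega)) h
    · have h := pc i hi
      calc g i = E i * p i * (E i)ᴴ := by
            simp only [p]
            rw [Matrix.mul_assoc, Matrix.mul_assoc ((E i)ᴴ * g i), (hE i hi).1, Matrix.mul_one,
              ← Matrix.mul_assoc, (hE i hi).1, Matrix.one_mul]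
        _ = c • 1 := by rw [h]; simp [(hE i hi).1]

/-! ### The character determines the representation. -/

section Uniqueness
variable {A B : ∀ i j, Matrix (Fin (n i)) (Fin (n j)) ℂ} {χ : V → ℝ}

/-- Intertwining along edges in one direction only is a linear system with `∑ n i ^ 2` unknowns and
one equation per entry of each edge block; the Tits form is the difference of these numbers. -/
theorem exists_intertwiner (hA : IsGraphRep G A) (hB : IsGraphRep G B)
    (hq : 0 < form G O (fun i => (n i : ℤ))) :
    ∃ f : ∀ i, Matrix (Fin (n i)) (Fin (n i)) ℂ, f ≠ 0 ∧
      ∀ i j, i ∈ O → f i * A i j = B i j * f j := by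
  let I := Σ i : {i // i ∈ O}, {j // G.Adj j i}
  let Φ : (∀ i, Matrix (Fin (n i)) (Fin (n i)) ℂ) →ₗ[ℂ]
      ∀ e : I, Matrix (Fin (n e.1)) (Fin (n e.2)) ℂ :=
    { toFun := fun f e => f e.1 * A e.1 e.2 - B e.1 e.2 * f e.2
      map_add' := fun f g => by
        funext e
        simp only [Pi.add_apply, Matrix.add_mul, Matrix.mul_add]; abel
      map_smul' := fun c f => by
        funext e
        simp [smul_sub] }
  have hlt : Module.finrank ℂ (∀ e : I, Matrix (Fin (n e.1)) (Fin (n e.2)) ℂ) <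
      Module.finrank ℂ (∀ i, Matrix (Fin (n i)) (Fin (n i)) ℂ) := by
    rw [Module.finrank_pi_fintype, Module.finrank_pi_fintype]
    simp only [Module.finrank_matrix, Fintype.card_fin, Module.finrank_self, mul_one]
    zify
    have e1 : ∑ e : I, (n e.1 : ℤ) * n e.2 =
        ∑ i with i ∈ O, (n i : ℤ) * nbrSum G (fun i => (n i : ℤ)) i := by
      rw [Fintype.sum_sigma, Finset.sum_subtype (p := fun i => i ∈ O) (univ.filter fun i => i ∈ O)
        (fun i => by simp)]
      refine Finset.sum_congr rfl fun i _ => ?_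
      rw [nbrSum, Finset.mul_sum]
      exact (Finset.sum_subtype (p := fun j => G.Adj j i) (univ.filter fun j => G.Adj j i)
        (fun j => by simp) fun j => (n i : ℤ) * n j).symm
    rw [e1]
    rw [form] at hq
    have e2 : ∑ i, (n i : ℤ) * n i = ∑ i, (n i : ℤ) ^ 2 :=
      Finset.sum_congr rfl fun i _ => (pow_two _).symm
    rw [e2]
    linarith
  obtain ⟨f, hf, hf0⟩ := Submodule.exists_mem_ne_zero_of_ne_bot
    (LinearMap.ker_ne_bot_of_finrank_lt (f := Φ) hlt)
  refine ⟨f, hf0, fun i j hi => ?_⟩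
  by_cases hij : G.Adj j i
  · exact sub_eq_zero.1 (congrFun (LinearMap.mem_ker.1 hf) ⟨⟨i, hi⟩, ⟨j, hij⟩⟩)
  · have hij' : ¬ G.Adj i j := fun h => hij h.symm
    simp [hA.zero i j hij', hB.zero i j hij']

theorem sum_side_comm {R : Type*} [AddCommMonoid R] (hO : IsSide G O) {T : V → V → R}
    (hT : ∀ i j, ¬ G.Adj i j → T i j = 0) :
    ∑ i with i ∈ O, ∑ j, T i j = ∑ j with j ∉ O, ∑ i, T i j := by
  rw [Finset.sum_filter, Finset.sum_filter]
  have h1 : ∀ i, (if i ∈ O then ∑ j, T i j else 0) = ∑ j, if i ∈ O then T i j else 0 := fun i => by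
    split_ifs <;> simp
  have h2 : ∀ j, (if j ∉ O then ∑ i, T i j else 0) = ∑ i, if j ∉ O then T i j else 0 := fun j => by
    split_ifs <;> simp
  rw [Finset.sum_congr rfl fun i _ => h1 i, Finset.sum_congr rfl fun i _ => h2 i, Finset.sum_comm]
  refine Finset.sum_congr rfl fun j _ => Finset.sum_congr rfl fun i _ => ?_
  by_cases hij : G.Adj i j
  · simp only [hO i j hij]
  · simp [hT i j hij]

theorem sum_trace_mul (hχ : HasScalar A χ) (X : ∀ i, Matrix (Fin (n i)) (Fin (n i)) ℂ) (i : V) :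
    ∑ j, (X i * (A i j * A j i)).trace = χ i * (X i).trace := by
  rw [← Matrix.trace_sum, ← Finset.mul_sum, hχ i, Matrix.mul_smul, Matrix.mul_one,
    Matrix.trace_smul, smul_eq_mul]

/-- The adjoint of an intertwiner between orthoscalar representations with the same character is
an intertwiner. -/
theorem intertwiner_symm (hO : IsSide G O) (hA : IsGraphRep G A) (hB : IsGraphRep G B)
    (hAχ : HasScalar A χ) (hBχ : HasScalar B χ) {f : ∀ i, Matrix (Fin (n i)) (Fin (n i)) ℂ}
    (hf : ∀ i j, i ∈ O → f i * A i j = B i j * f j) (i j : V) : f i * A i j = B i j * f j := by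
  have hf' : ∀ i j, i ∈ O → A j i * (f i)ᴴ = (f j)ᴴ * B j i := fun i j hi => by
    rw [← hA.conj i j, ← hB.conj i j, ← Matrix.conjTranspose_mul, hf i j hi,
      Matrix.conjTranspose_mul]
  -- The failure of the missing intertwining relations. The squared norms of `D` over all edges sum
  -- to 0, because equal characters let each sum of traces be evaluated at either end of the edges.
  let D : ∀ i j, Matrix (Fin (n j)) (Fin (n i)) ℂ := fun i j => B j i * f i - f j * A j i
  have hD : ∀ i j, i ∈ O → ((D i j)ᴴ * D i j).trace =
      ((f i * (f i)ᴴ) * (B i j * B j i)).trace - ((f i)ᴴ * f i * (A i j * A j i)).trace -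
        ((f i)ᴴ * f i * (A i j * A j i)).trace + ((f j)ᴴ * f j * (A j i * A i j)).trace := by
    intro i j hi
    simp only [D, Matrix.conjTranspose_sub, Matrix.conjTranspose_mul, hA.conj, hB.conj,
      Matrix.sub_mul, Matrix.mul_sub, Matrix.trace_sub]
    have e1 : ((f i)ᴴ * B i j * (B j i * f i)).trace =
        ((f i * (f i)ᴴ) * (B i j * B j i)).trace := by
      rw [← Matrix.mul_assoc, Matrix.trace_mul_comm]
      simp only [Matrix.mul_assoc]
    have e2 : ((f i)ᴴ * B i j * (f j * A j i)).trace =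
        ((f i)ᴴ * f i * (A i j * A j i)).trace := by
      rw [Matrix.mul_assoc, ← Matrix.mul_assoc (B i j), ← hf i j hi]
      simp only [Matrix.mul_assoc]
    have e3 : (A i j * (f j)ᴴ * (B j i * f i)).trace =
        ((f i)ᴴ * f i * (A i j * A j i)).trace := by
      rw [Matrix.mul_assoc, ← Matrix.mul_assoc (f j)ᴴ, ← hf' i j hi,
        Matrix.trace_mul_comm ((f i)ᴴ * f i)]
      simp only [Matrix.mul_assoc]
    have e4 : (A i j * (f j)ᴴ * (f j * A j i)).trace =
        ((f j)ᴴ * f j * (A j i * A i j)).trace := by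
      rw [Matrix.mul_assoc, Matrix.trace_mul_comm]
      simp only [Matrix.mul_assoc]
    rw [e1, e2, e3, e4]
    ring
  have hBf : ∀ i j, i ∈ O → ((f j * (f j)ᴴ) * (B j i * B i j)).trace =
      ((f i)ᴴ * f i * (A i j * A j i)).trace := fun i j hi => by
    rw [Matrix.mul_assoc, ← Matrix.mul_assoc (f j)ᴴ, ← hf' i j hi, Matrix.trace_mul_comm,
      Matrix.mul_assoc, ← hf i j hi, Matrix.trace_mul_comm ((f i)ᴴ * f i), Matrix.mul_assoc,
      ← Matrix.mul_assoc (f i)ᴴ, Matrix.trace_mul_comm]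
    rw [Matrix.mul_assoc, Matrix.trace_mul_comm]
  have hsum : ∑ i with i ∈ O, ∑ j, ((D i j)ᴴ * D i j).trace = 0 := by
    have e1 : ∀ i ∈ univ.filter (· ∈ O), ∑ j, ((D i j)ᴴ * D i j).trace =
        -(∑ j, ((f i)ᴴ * f i * (A i j * A j i)).trace) +
          ∑ j, ((f j)ᴴ * f j * (A j i * A i j)).trace := fun i hi => by
      have hi : i ∈ O := by simpa using hi
      rw [Finset.sum_congr rfl fun j _ => hD i j hi]
      simp only [Finset.sum_add_distrib, Finset.sum_sub_distrib]
      rw [sum_trace_mul hBχ (fun i => f i * (f i)ᴴ) i,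
        sum_trace_mul hAχ (fun i => (f i)ᴴ * f i) i, Matrix.trace_mul_comm (f i)]
      ring
    have e2 : ∑ i with i ∈ O, ∑ j, ((f j)ᴴ * f j * (A j i * A i j)).trace =
        ∑ i with i ∈ O, ∑ j, ((f i)ᴴ * f i * (A i j * A j i)).trace := by
      calc ∑ i with i ∈ O, ∑ j, ((f j)ᴴ * f j * (A j i * A i j)).trace
          = ∑ j with j ∉ O, ∑ i, ((f j)ᴴ * f j * (A j i * A i j)).trace :=
            sum_side_comm hO fun i j hij => by simp [hA.zero i j hij]
        _ = ∑ j with j ∉ O, ∑ i, ((f j * (f j)ᴴ) * (B j i * B i j)).trace := by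
            refine Finset.sum_congr rfl fun j _ => ?_
            rw [sum_trace_mul hBχ (fun i => f i * (f i)ᴴ) j,
              sum_trace_mul hAχ (fun i => (f i)ᴴ * f i) j, Matrix.trace_mul_comm (f j)]
        _ = ∑ i with i ∈ O, ∑ j, ((f j * (f j)ᴴ) * (B j i * B i j)).trace :=
            (sum_side_comm hO fun i j hij => by simp [hB.zero i j hij]).symm
        _ = _ := Finset.sum_congr rfl fun i hi => Finset.sum_congr rfl fun j _ =>
            hBf i j (by simpa using hi)
    rw [Finset.sum_congr rfl e1, Finset.sum_add_distrib, e2, Finset.sum_neg_distrib]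
    ring
  have hnn : ∀ i j, 0 ≤ ((D i j)ᴴ * D i j).trace := fun i j =>
    (Matrix.posSemidef_conjTranspose_mul_self (D i j)).trace_nonneg
  have hD0 : ∀ i j, i ∈ O → D i j = 0 := fun i j hi => by
    have h1 := (Finset.sum_eq_zero_iff_of_nonneg fun i _ =>
      Finset.sum_nonneg fun j _ => hnn i j).1 hsum i (by simpa using hi)
    have h2 := (Finset.sum_eq_zero_iff_of_nonneg fun j _ => hnn i j).1 h1 j (mem_univ j)
    exact Matrix.trace_conjTranspose_mul_self_eq_zero_iff.1 h2
  by_cases hij : G.Adj i j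
  · by_cases hi : i ∈ O
    · exact hf i j hi
    · have hj : j ∈ O := by
        by_contra hj; exact hi ((hO _ _ hij).2 hj)
      exact (sub_eq_zero.1 (hD0 j i hj)).symm
  · simp [hA.zero i j hij, hB.zero i j hij]

/-- Irreducible orthoscalar representations whose dimension has positive Tits form are determined
up to unitary equivalence by the character. -/
theorem exists_unitary (hO : IsSide G O) (hA : IsGraphRep G A) (hB : IsGraphRep G B)
    (hAχ : HasScalar A χ) (hBχ : HasScalar B χ) (hirr : IsIrred A)
    (hq : 0 < form G O (fun i => (n i : ℤ))) :
    ∃ U : ∀ i, Matrix (Fin (n i)) (Fin (n i)) ℂ,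
      (∀ i, (U i)ᴴ * U i = 1) ∧ ∀ i j, U i * A i j = B i j * U j := by
  obtain ⟨f, hf0, hf⟩ := exists_intertwiner hA hB hq
  have hf := intertwiner_symm hO hA hB hAχ hBχ hf
  -- By self-adjointness the adjoint of `f` intertwines `B` with `A`, so this product lies in the
  -- commutant of `A`. It is one positive scalar at all vertices, and rescaling `f` gives unitaries.
  obtain ⟨c, hc⟩ := hirr.2 (fun i => (f i)ᴴ * f i) fun i j => by
    have h : (f i)ᴴ * B i j = A i j * (f j)ᴴ := by
      rw [← hB.conj j i, ← Matrix.conjTranspose_mul, ← hf j i, Matrix.conjTranspose_mul, hA.conj]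
    rw [Matrix.mul_assoc, hf i j, ← Matrix.mul_assoc, h, Matrix.mul_assoc]
  obtain ⟨i, hi⟩ : ∃ i, f i ≠ 0 := by
    by_contra! h; exact hf0 (funext h)
  have hci := hc i
  have h0 : n i ≠ 0 := fun h0 => hi (matrix_eq_of_eq_zero (.inl h0) _ _)
  have hc0 : c ≠ 0 := fun h => hi (Matrix.conjTranspose_mul_self_eq_zero.1 (by rw [hci, h, zero_smul]))
  have hcn : 0 ≤ c := by
    have h1 := (Matrix.posSemidef_conjTranspose_mul_self (f i)).diag_nonneg (i := ⟨0, by omega⟩)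
    rw [hci] at h1
    simpa using h1
  obtain ⟨r, rfl⟩ : ∃ r : ℝ, (r : ℂ) = c := ⟨c.re, by
    apply Complex.ext <;> simp [← (Complex.nonneg_iff.1 hcn).2]⟩
  have hr : 0 < r := lt_of_le_of_ne (by exact_mod_cast hcn) fun h => hc0 (by rw [← h]; simp)
  refine ⟨fun i => ((Real.sqrt r)⁻¹ : ℂ) • f i, fun i => ?_, fun i j => ?_⟩
  · have hs : ((Real.sqrt r : ℂ)) * (Real.sqrt r : ℂ) = r := by
      rw [← Complex.ofReal_mul, Real.mul_self_sqrt hr.le]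
    rw [Matrix.conjTranspose_smul, Matrix.smul_mul, Matrix.mul_smul, hc i, smul_smul, smul_smul]
    simp only [star_inv₀, Complex.star_def, Complex.conj_ofReal]
    rw [← hs]
    have : (Real.sqrt r : ℂ) ≠ 0 := by exact_mod_cast (Real.sqrt_pos.2 hr).ne'
    field_simp
    simp
  · rw [Matrix.smul_mul, hf i j, Matrix.mul_smul]

end Uniqueness

end GraphRep
end Orthoscalar

namespace Orthoscalar

/-! ### Cones of characters and descent along reflections. -/

section Cone

open Finset
open scoped Classical
set_option linter.unusedSectionVars false

variable {V : Type u} [Fintype V] {G : SimpleGraph V} {O : Set V}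

/-- The characters of the irreducible orthoscalar representations of dimension `n` form an open
simplicial cone, with one generator less than there are vertices in the support of `n`. -/
def HasCone (G : SimpleGraph V) (n : V → ℕ) : Prop :=
  ∃ (ι : Type u) (_ : Fintype ι) (L : (ι → ℝ) →ₗ[ℝ] (V → ℝ)), Function.Injective L ∧
    Fintype.card ι + 1 = #{i | n i ≠ 0} ∧ (∀ p i, n i = 0 → L p i = 0) ∧
    ∀ χ : V → ℝ, (∀ i, n i = 0 → χ i = 0) →
      (Realizes G n χ ↔ ∃ p : ι → ℝ, (∀ s, 0 < p s) ∧ L p = χ)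

theorem HasCone.congr_graph {G G' : SimpleGraph V} {n : V → ℕ} (h : HasCone G n)
    (hG : ∀ i j, n i ≠ 0 → n j ≠ 0 → (G.Adj i j ↔ G'.Adj i j)) : HasCone G' n := by
  obtain ⟨ι, hι, L, h1, h2, h3, h4⟩ := h
  refine ⟨ι, hι, L, h1, h2, h3, fun χ hχ => ?_⟩
  rw [← h4 χ hχ]
  exact ⟨fun h => h.congr_graph fun i j hi hj => (hG i j hi hj).2,
    fun h => h.congr_graph fun i j hi hj => (hG i j hi hj).1⟩

/-- The reflection at the vertices of `O`, as a linear map. -/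
noncomputable def reflLinear (G : SimpleGraph V) (O : Set V) : (V → ℝ) →ₗ[ℝ] (V → ℝ) where
  toFun := refl G O
  map_add' := refl_add
  map_smul' := refl_smul

theorem exists_adj_of_refl (hO : IsSide G O) {n n' : V → ℕ}
    (hn : ∀ i ∈ O, n i + n' i = nbrSum G n i) {i : V} (hi : i ∈ O) (h0 : n i + n' i ≠ 0) :
    ∃ k, k ≠ i ∧ k ∉ O ∧ n k ≠ 0 := by
  rw [hn i hi] at h0
  obtain ⟨k, hk, hk0⟩ := Finset.exists_ne_zero_of_sum_ne_zero h0
  have hk : G.Adj k i := by simpa using hk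
  exact ⟨k, hk.ne, (hO i k hk.symm).1 hi, hk0⟩

/-- The functor is invertible, so the characters of `n` are the reflections of those of `n'`, except
that at a vertex of the support lost in `n'` any positive value may be prescribed. By `hedge` no
edge leaves the support, so the reflection cannot enlarge it. -/
theorem HasCone.of_refl (hO : IsSide G O) {n n' : V → ℕ}
    (hn : ∀ i ∈ O, n i + n' i = nbrSum G n i) (hn' : ∀ i, i ∉ O → n' i = n i)
    (hsub : ∀ i, n i = 0 → n' i = 0) (hedge : ∀ i j, G.Adj i j → n i ≠ 0) (h : HasCone G n') :
    HasCone G n := by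
  obtain ⟨ι, hι, L, h1, h2, h3, h4⟩ := h
  have hnn : ∀ i ∈ O, n' i + n i = nbrSum G n' i := fun i hi => by
    rw [add_comm, hn i hi]
    exact nbrSum_congr fun j hj => (hn' j ((hO i j hj.symm).1 hi)).symm
  have hrefl0 : ∀ χ : V → ℝ, (∀ i, n i = 0 → χ i = 0) → ∀ i, n i = 0 → refl G Oᶜ χ i = 0 := by
    intro χ hχ i hi
    by_cases hiO : i ∈ Oᶜ
    · rw [refl_of_mem _ hiO, hχ i hi, nbrSum, Finset.sum_eq_zero, neg_zero, add_zero]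
      intro j hj
      exact absurd hi (hedge i j (by simpa using (Finset.mem_filter.1 hj).2.symm))
    · rw [refl_of_notMem _ hiO, hχ i hi]
  -- The lost vertices, each contributing one new generator. They all lie in `O`, where the
  -- reflection at `Oᶜ` leaves the character unchanged.
  let K := {i // n i ≠ 0 ∧ n' i = 0}
  let E : (K → ℝ) →ₗ[ℝ] (V → ℝ) :=
    { toFun := fun q i => if h : n i ≠ 0 ∧ n' i = 0 then q ⟨i, h⟩ else 0
      map_add' := fun p q => by
        funext i
        simp only [Pi.add_apply]
        split_ifs <;> simp
      map_smul' := fun c q => by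
        funext i
        simp only [Pi.smul_apply, RingHom.id_apply]
        split_ifs <;> simp }
  have E1 : ∀ q (k : K), E q k = q k := fun q k => dif_pos k.2
  have E2 : ∀ q i, ¬ (n i ≠ 0 ∧ n' i = 0) → E q i = 0 := fun q i hi => dif_neg hi
  let M : (ι ⊕ K → ℝ) →ₗ[ℝ] (V → ℝ) :=
    L ∘ₗ LinearMap.funLeft ℝ ℝ Sum.inl + E ∘ₗ LinearMap.funLeft ℝ ℝ Sum.inr
  have M1 : ∀ p i, M p i = L (p ∘ Sum.inl) i + E (p ∘ Sum.inr) i := fun p i => rfl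
  have MK : ∀ p (k : K), M p k = p (Sum.inr k) := fun p k => by
    rw [M1, h3 _ _ k.2.2, E1, zero_add]; rfl
  have M0 : ∀ p i, n' i ≠ 0 → M p i = L (p ∘ Sum.inl) i := fun p i hi => by
    rw [M1, E2 _ _ (fun h => hi h.2), add_zero]
  have M00 : ∀ p i, n i = 0 → M p i = 0 := fun p i hi => by
    rw [M1, h3 _ _ (hsub i hi), E2 _ _ (fun h => h.1 hi), add_zero]
  have hMinj : Function.Injective M := by
    intro p p' hpp
    have e1 : p ∘ Sum.inr = p' ∘ Sum.inr := funext fun k => by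
      have := congrFun hpp k
      rwa [MK, MK] at this
    have e2 : p ∘ Sum.inl = p' ∘ Sum.inl := h1 <| funext fun i => by
      have := congrFun hpp i
      rw [M1, M1, e1] at this
      exact add_right_cancel this
    funext x
    rcases x with x | x
    · exact congrFun e2 x
    · exact congrFun e1 x
  refine ⟨ι ⊕ K, inferInstance, reflLinear G Oᶜ ∘ₗ M, ?_, ?_, ?_, ?_⟩
  · rw [LinearMap.coe_comp]
    refine Function.Injective.comp (Function.LeftInverse.injective (g := refl G Oᶜ) ?_) hMinj
    exact fun χ => refl_refl hO.compl χ
  · rw [Fintype.card_sum, add_right_comm, h2, Fintype.card_subtype,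
      ← Finset.card_union_of_disjoint]
    · congr 1
      ext i
      have := hsub i
      simp only [mem_union, mem_filter, mem_univ, true_and]
      tauto
    · rw [Finset.disjoint_filter]
      exact fun i _ h h' => h h'.2
  · exact fun p i hi => hrefl0 _ (M00 p) i hi
  · intro χ hχ
    constructor
    · intro hR
      have hpos : ∀ i ∈ O, n i + n' i ≠ 0 → 0 < χ i := fun i hi h0 => by
        obtain ⟨k, hk, -, hk0⟩ := exists_adj_of_refl hO hn hi h0
        obtain ⟨A, a1, a2, a3⟩ := hR
        exact scalar_pos a1 a2 a3 (fun h => h0 (by rw [h, hsub i h])) hk hk0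
      have hR' := hR.refl hO hn hn' hpos
      -- The reflected character is cut off outside the support of `n'`, the normalization that
      -- `HasCone` requires; the discarded values become the parameters over `K`.
      obtain ⟨p, hp, hLp⟩ := (h4 (fun i => if n' i = 0 then 0 else refl G Oᶜ χ i)
        (fun i hi => if_pos hi)).1 (hR'.congr fun i hi => by simp [hi])
      refine ⟨Sum.elim p fun k => χ k, ?_, ?_⟩
      · rintro (s | k)
        · exact hp s
        · have hkO : k.1 ∈ O := by
            by_contra hk
            exact k.2.1 (by rw [← hn' _ hk, k.2.2])
          exact hpos k hkO (by have := k.2.1; omega)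
      · change refl G Oᶜ (M _) = χ
        refine Eq.trans (congrArg _ ?_) (refl_refl hO.compl χ)
        funext i
        by_cases hi' : n' i = 0
        · by_cases hi : n i = 0
          · rw [M00 _ _ hi, hrefl0 χ hχ i hi]
          · have hiO : i ∈ O := by
              by_contra hk
              exact hi (by rw [← hn' _ hk, hi'])
            rw [refl_of_notMem _ (by simpa using hiO)]
            exact MK _ ⟨i, hi, hi'⟩
        · rw [M0 _ _ hi', Sum.elim_comp_inl, hLp]
          simp [hi']
    · rintro ⟨p, hp, rfl⟩
      have hR : Realizes G n' (L (p ∘ Sum.inl)) :=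
        (h4 _ fun i hi => h3 _ i hi).2 ⟨p ∘ Sum.inl, fun s => hp _, rfl⟩
      have hR' : Realizes G n' (M p) := hR.congr fun i hi => (M0 p i hi).symm
      refine hR'.refl hO hnn (fun i hi => (hn' i hi).symm) fun i hi h0 => ?_
      have hi0 : n i ≠ 0 := fun h => h0 (by rw [h, hsub i h])
      by_cases hi' : n' i = 0
      · rw [MK p ⟨i, hi0, hi'⟩]
        exact hp _
      · obtain ⟨k, hk, hkO, hk0⟩ := exists_adj_of_refl hO hn hi (by omega)
        obtain ⟨A, a1, a2, a3⟩ := hR'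
        exact scalar_pos a1 a2 a3 hi' hk (by rwa [hn' k hkO])

theorem HasCone.single {n : V → ℕ} {v : V} (hv : n v = 1) (hn : ∀ i, i ≠ v → n i = 0) :
    HasCone G n := by
  refine ⟨PEmpty, inferInstance, 0, fun p q _ => Subsingleton.elim _ _, ?_, fun _ _ _ => rfl,
    fun χ hχ => ⟨?_, ?_⟩⟩
  · have : ({i | n i ≠ 0} : Finset V) = {v} := by
      ext i
      simp only [mem_filter, mem_univ, true_and, mem_singleton]
      exact ⟨fun h => by_contra fun h' => h (hn i h'), fun h => by rw [h, hv]; simp⟩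
    rw [this]; simp
  · rintro ⟨A, h1, h2, -⟩
    refine ⟨0, fun s => s.elim, ?_⟩
    funext i
    by_cases hi : i = v
    · subst hi
      rw [scalar_eq_sum h1 h2 i ⟨0, by omega⟩]
      refine (Finset.sum_eq_zero fun j _ => Finset.sum_eq_zero fun b _ => ?_).symm
      by_cases hj : j = i
      · subst hj
        rw [h1.zero j j (G.loopless.irrefl j)]; simp
      · have := b.2
        have := hn j hj
        omega
    · rw [hχ i (hn i hi)]; rfl
  · rintro ⟨p, -, rfl⟩
    refine ⟨fun i j => 0, ⟨fun _ _ _ => rfl, fun _ _ => by simp⟩, fun i => by simp,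
      ⟨v, by omega⟩, fun f _ => ⟨f v ⟨0, by omega⟩ ⟨0, by omega⟩, fun i => ?_⟩⟩
    by_cases hi : i = v
    · subst hi
      ext a b
      have ha : a = ⟨0, by omega⟩ := Fin.ext (by have := a.2; simp only; omega)
      have hb : b = ⟨0, by omega⟩ := Fin.ext (by have := b.2; simp only; omega)
      rw [ha, hb]; simp
    · exact matrix_eq_of_eq_zero (.inl (hn i hi)) _ _

theorem exists_single_of_sum_sq {n : V → ℕ} (h : ∑ i, (n i : ℤ) ^ 2 = 1) :
    ∃ v, n v = 1 ∧ ∀ i, i ≠ v → n i = 0 := by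
  have h' : ∑ i, n i ^ 2 = 1 := by exact_mod_cast h
  obtain ⟨v, -, hv⟩ := Finset.exists_ne_zero_of_sum_ne_zero (by rw [h']; simp : ∑ i, n i ^ 2 ≠ 0)
  rw [← Finset.add_sum_erase _ _ (mem_univ v)] at h'
  have h1 : 1 ≤ n v ^ 2 := Nat.one_le_iff_ne_zero.2 hv
  have h2 : n v ^ 2 = 1 := by omega
  refine ⟨v, by simpa using h2, fun i hi => ?_⟩
  have h3 : ∑ i ∈ univ.erase v, n i ^ 2 = 0 := by omega
  have := (Finset.sum_eq_zero_iff.1 h3) i (by simp [hi])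
  simpa using this

theorem nbrSum_natCast (n : V → ℕ) (i : V) :
    nbrSum G (fun i => (n i : ℤ)) i = (nbrSum G n i : ℕ) := by
  simp [nbrSum]

/-- If alternating reflections make the dimension lose a vertex of its support, then the
characters form a simplicial cone, provided that they do for smaller supports. -/
theorem HasCone.of_alternate (hO : IsSide G O) (hG : IsPosProper G O) (t : ℕ) {n : V → ℕ}
    (hq : form G O (fun i => (n i : ℤ)) = 1) (hedge : ∀ i j, G.Adj i j → n i ≠ 0)
    (hsmall : ∀ n' : V → ℕ, form G O (fun i => (n' i : ℤ)) = 1 →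
      #{i | n' i ≠ 0} < #{i | n i ≠ 0} → HasCone G n')
    (ht : ∃ i, n i ≠ 0 ∧ alternate G t O (fun i => (n i : ℤ)) i ≤ 0) : HasCone G n := by
  induction t generalizing O n with
  | zero =>
    obtain ⟨i, hi, hi'⟩ := ht
    simp only [alternate] at hi'
    omega
  | succ t ih =>
    have hq' : form G O (refl G O fun i => (n i : ℤ)) = 1 := by rw [form_refl hO, hq]
    rcases nonneg_or_nonpos hG hq' with h | h
    · obtain ⟨n', hn'⟩ : ∃ n' : V → ℕ, (fun i => (n' i : ℤ)) = refl G O fun i => (n i : ℤ) :=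
        ⟨fun i => (refl G O (fun i => (n i : ℤ)) i).toNat, funext fun i => Int.toNat_of_nonneg (h i)⟩
      have e1 : ∀ i ∈ O, n i + n' i = nbrSum G n i := fun i hi => by
        have := congrFun hn' i
        rw [refl_of_mem _ hi, nbrSum_natCast] at this
        omega
      have e2 : ∀ i, i ∉ O → n' i = n i := fun i hi => by
        have := congrFun hn' i
        rw [refl_of_notMem _ hi] at this
        omega
      have hsub : ∀ i, n i = 0 → n' i = 0 := fun i hi => by
        by_cases hiO : i ∈ O
        · have := e1 i hiO
          rw [nbrSum, Finset.sum_eq_zero] at this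
          · omega
          · intro j hj
            exact absurd hi (hedge i j (Finset.mem_filter.1 hj).2.symm)
        · rw [e2 i hiO, hi]
      refine HasCone.of_refl hO e1 e2 hsub hedge ?_
      -- Either the support is unchanged and one step of the path to the nonpositive coordinate has
      -- been used, or the support has shrunk and `hsmall` applies.
      by_cases hall : ∀ i, n i ≠ 0 → n' i ≠ 0
      · have hiff : ∀ i, n' i ≠ 0 ↔ n i ≠ 0 := fun i => ⟨fun h h' => h (hsub i h'), hall i⟩
        refine ih hO.compl (hG.compl hO) (n := n') ?_ ?_ ?_ ?_
        · rw [form_compl hO, hn', hq']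
        · exact fun i j hij => hall i (hedge i j hij)
        · intro n'' h1 h2
          rw [form_compl hO] at h1
          simp only [hiff] at h2
          exact hsmall n'' h1 h2
        · obtain ⟨i, hi, hi'⟩ := ht
          refine ⟨i, hall i hi, ?_⟩
          rw [hn']
          exact hi'
      · push Not at hall
        obtain ⟨i, hi, hi'⟩ := hall
        refine hsmall n' (by rw [hn', hq']) (Finset.card_lt_card ?_)
        refine (Finset.ssubset_iff_of_subset fun j hj => ?_).2 ⟨i, by simpa using hi, by simpa using hi'⟩
        simp only [mem_filter, mem_univ, true_and] at hj ⊢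
        exact fun h => hj (hsub j h)
    -- A nonpositive image means that `n` is supported on `O`. Then the graph has no edges, and form
    -- 1 leaves a single vertex of dimension 1.
    · have h0 : ∀ i, i ∉ O → n i = 0 := fun i hi => by
        have := h i
        rw [refl_of_notMem _ hi] at this
        simp only [Pi.zero_apply] at this
        omega
      have hno : ∀ i j, ¬ G.Adj i j := fun i j hij => by
        by_cases hi : i ∈ O
        · exact hedge j i hij.symm (h0 j ((hO i j hij).1 hi))
        · exact hedge i j hij (h0 i hi)
      have hsum : ∑ i, (n i : ℤ) ^ 2 = 1 := by
        rw [← hq, form]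
        simp [nbrSum, hno]
      obtain ⟨v, hv, hv'⟩ := exists_single_of_sum_sq hsum
      exact HasCone.single hv hv'

theorem alternate_eq_zero {S : Set V} (hS : ∀ i j, G.Adj i j → i ∈ S) (t : ℕ) {x : V → ℤ}
    (hx : ∀ i, i ∉ S → x i = 0) : ∀ i, i ∉ S → alternate G t O x i = 0 := by
  induction t generalizing O x with
  | zero => exact hx
  | succ t ih =>
    refine ih fun i hi => ?_
    by_cases hiO : i ∈ O
    · rw [refl_of_mem _ hiO, hx i hi, nbrSum, Finset.sum_eq_zero, neg_zero, add_zero]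
      intro j hj
      exact absurd (hS i j (Finset.mem_filter.1 hj).2.symm) hi
    · rw [refl_of_notMem _ hiO, hx i hi]

/-- Real roots of graphs with positive definite Tits form. -/
theorem HasCone.of_isPosDef {w : V → ℤ} (hw : IsSuperharmonic G w) (hO : IsSide G O)
    (hG : IsPosDef G O) {n : V → ℕ} (hq : form G O (fun i => (n i : ℤ)) = 1) : HasCone G n := by
  induction hN : #{i | n i ≠ 0} using Nat.strong_induction_on generalizing G n with
  | _ N ih =>
    subst hN
    set S : Set V := {i | n i ≠ 0} with hS
    have hn0 : ∀ i, i ∉ S → n i = 0 := fun i hi => by simpa [hS] using hi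
    have hw' := hw.restrictTo S
    have hO' := hO.restrictTo S
    have hG' := hG.restrictTo S
    refine HasCone.congr_graph (G := restrictTo G S) ?_
      fun i j hi hj => ⟨fun h => h.1, fun h => ⟨h, hi, hj⟩⟩
    set H := restrictTo G S with hH
    have hqH : form H O (fun i => (n i : ℤ)) = 1 := by
      rw [hH, form_restrictTo (fun i hi => by simp [hn0 i hi]), hq]
    have hsmall : ∀ n' : V → ℕ, form H O (fun i => (n' i : ℤ)) = 1 →
        #{i | n' i ≠ 0} < #{i | n i ≠ 0} → HasCone H n' :=
      fun n' h1 h2 => ih _ h2 hw' hO' hG' h1 rfl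
    -- If `w` were harmonic at every vertex of the support, its restriction to the support would be
    -- a nonzero vector of form 0.
    obtain ⟨v, hvS, hv⟩ : ∃ v ∈ S, nbrSum H w v < 2 * w v := by
      by_contra! hall
      set x : V → ℤ := fun i => if i ∈ S then w i else 0 with hx
      have hx0 : x ≠ 0 := fun h => by
        have : (fun i => (n i : ℤ)) = 0 := funext fun i => by
          by_cases hi : i ∈ S
          · have := congrFun h i
            simp only [hx, hi, if_true, Pi.zero_apply] at this
            exact absurd this (hw.1 i).ne'
          · simp [hn0 i hi]
        rw [this, form_zero] at hqH
        omega
      have hpos := hG' x hx0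
      have h2 := two_mul_form hO' x
      rw [Finset.sum_eq_zero] at h2
      · omega
      · intro i _
        by_cases hi : i ∈ S
        · have e : nbrSum H x i = nbrSum H w i := nbrSum_congr fun j hj => by
            simp only [hx]
            exact if_pos hj.2.1
          have := hall i hi
          have := hw'.2 i
          rw [e]
          simp only [hx, hi, if_true]
          rw [show 2 * w i - nbrSum H w i = 0 by omega, mul_zero]
        · simp [hx, hi]
    have hreach : ∃ t, ∃ i, n i ≠ 0 ∧ alternate H t O (fun i => (n i : ℤ)) i ≤ 0 := by
      by_contra! hall
      refine exists_alternate_neg hO' (fun i => (hw.1 i).le) hw'.2 hv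
        (x := fun i => (n i : ℤ)) (fun t i => ?_) (fun t => hall t v hvS)
      by_cases hi : i ∈ S
      · exact (hall t i hi).le
      · rw [alternate_eq_zero (G := H) (S := S) (fun i j hij => hij.2.1) t
          (x := fun i => (n i : ℤ)) (fun i hi => by simp [hn0 i hi]) i hi]
        rfl
    obtain ⟨t, ht⟩ := hreach
    exact HasCone.of_alternate hO' hG'.isPosProper t hqH (fun i j hij => hij.2.1) hsmall ht

/-- Real roots that some alternating reflections move to a vector with a nonpositive coordinate. -/
theorem HasCone.of_alternate_nonpos {w : V → ℤ} (hw : IsSuperharmonic G w) (hconn : G.Connected)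
    (hO : IsSide G O) {n : V → ℕ} (hq : form G O (fun i => (n i : ℤ)) = 1) (hn : ∀ i, n i ≠ 0)
    {t : ℕ} {i : V} (ht : alternate G t O (fun i => (n i : ℤ)) i ≤ 0) : HasCone G n := by
  have hG := isPosProper_of_superharmonic hconn hO hw
  refine HasCone.of_alternate hO hG t hq (fun i j _ => hn i) (fun n' h1 h2 => ?_) ⟨i, hn i, ht⟩
  set S : Set V := {i | n' i ≠ 0} with hS
  have hn0 : ∀ i, i ∉ S → n' i = 0 := fun i hi => by simpa [hS] using hi
  -- After the first loss the support is proper, and there the form is positive definite even when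
  -- it is only semidefinite on the whole graph.
  have hSne : S ≠ Set.univ := fun h => by
    have : ∀ i, n' i ≠ 0 := fun i => by
      have : i ∈ S := by rw [h]; trivial
      exact this
    simp only [this, hn, ne_eq, not_false_eq_true, lt_irrefl] at h2
  refine HasCone.congr_graph (G := restrictTo G S)
    (HasCone.of_isPosDef (hw.restrictTo S) (hO.restrictTo S) (hG.isPosDef_restrictTo hSne) ?_)
    fun i j hi hj => ⟨fun h => h.1, fun h => ⟨h, hi, hj⟩⟩
  rw [form_restrictTo (fun i hi => by simp [hn0 i hi]), h1]

/-- Harmonic weights lie in the radical of the symmetric bilinear form. -/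
theorem form_sub_harmonic (hO : IsSide G O) {w : V → ℤ} (hw : ∀ i, nbrSum G w i = 2 * w i)
    (x : V → ℤ) : form G O (x - w) = form G O x := by
  have h1 := two_mul_form hO (x - w)
  have h2 := two_mul_form hO x
  have e : ∀ i, nbrSum G (x - w) i = nbrSum G x i - 2 * w i := fun i => by
    rw [← hw i]; simp [nbrSum]
  have h3 : ∑ i, w i * (2 * x i - nbrSum G x i) = 0 := by
    simp only [mul_sub, Finset.sum_sub_distrib]
    have s1 := Finset.sum_filter_add_sum_filter_not univ (· ∈ O) (fun i => w i * nbrSum G x i)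
    have s2 := Finset.sum_filter_add_sum_filter_not univ (· ∈ O) (fun i => nbrSum G w i * x i)
    have s3 := sum_mul_nbrSum hO w x
    have s4 := sum_mul_nbrSum hO.compl w x
    simp only [Set.mem_compl_iff, not_not] at s4
    have s5 : ∑ i, w i * (2 * x i) = ∑ i, nbrSum G w i * x i :=
      Finset.sum_congr rfl fun i _ => by rw [hw i]; ring
    linarith
  have h4 : ∑ i, (x - w) i * (2 * (x - w) i - nbrSum G (x - w) i) =
      ∑ i, x i * (2 * x i - nbrSum G x i) - ∑ i, w i * (2 * x i - nbrSum G x i) := by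
    rw [← Finset.sum_sub_distrib]
    refine Finset.sum_congr rfl fun i _ => ?_
    rw [e, Pi.sub_apply]; ring
  rw [h4, h3] at h1
  omega

theorem form_neg (x : V → ℤ) : form G O (-x) = form G O x := by
  simp [form, nbrSum]

/-- A real root smaller than the harmonic weights becomes nonpositive at some vertex. -/
theorem exists_alternate_nonpos_of_lt {w : V → ℤ} (hw0 : ∀ i, 0 < w i)
    (hw : ∀ i, nbrSum G w i = 2 * w i) (hconn : G.Connected) (hO : IsSide G O) {v : V}
    (hv : w v = 1) {x : V → ℤ} (hq : form G O x = 1) (hxw : x < w) :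
    ∃ t i, alternate G t O x i ≤ 0 ∨ alternate G t Oᶜ x i ≤ 0 := by
  by_contra! hall
  have hG := isPosProper_of_superharmonic hconn hO ⟨hw0, fun i => (hw i).le⟩
  have hd : defect w O x = 0 := defect_eq_zero hO (fun i => (hw0 i).le) hw
    (fun t i => (hall t i).1.le) (fun t i => (hall t i).2.le)
  have hy0 : 0 ≤ w - x := sub_nonneg.2 hxw.le
  have hyq : form G O (w - x) = 1 := by
    rw [← neg_sub, form_neg, form_sub_harmonic hO hw, hq]
  have hyd : defect w O (w - x) = 0 := by
    have h1 : defect w O w = 0 := defect_eq_zero hO (fun i => (hw0 i).le) hw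
      (fun t => by rw [alternate_of_harmonic t hw]; exact fun i => (hw0 i).le)
      (fun t => by rw [alternate_of_harmonic t hw]; exact fun i => (hw0 i).le)
    have h2 : defect w O (w - x) = defect w O w - defect w O x := by
      simp only [defect, Pi.sub_apply, mul_sub, Finset.sum_sub_distrib]; ring
    rw [h2, h1, hd, sub_zero]
  have hnn := fun t => alternate_nonneg_of_defect hO hG hw0 hw t hy0 hyq hyd
  have hsum : ∀ t, alternate G t O (w - x) = w - alternate G t O x := fun t => by
    have := alternate_add (G := G) (O := O) t (w - x) x
    rw [sub_add_cancel, alternate_of_harmonic t hw] at this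
    rw [eq_sub_iff_add_eq, ← this]
  -- Here `w v = 1` is decisive: a positive integer subtracted from 1 leaves at most 0. The zeros
  -- then spread to all vertices, although reflections preserve the form 1 of `w - x`.
  have hzero : ∀ t, alternate G t O (w - x) v = 0 := fun t => by
    refine le_antisymm ?_ (hnn t v)
    rw [hsum, Pi.sub_apply, hv]
    have := (hall t v).1
    omega
  obtain ⟨t, ht⟩ := alternate_eventually_zero hconn hO hnn hzero
  have hform : ∀ (t : ℕ) (P : Set V) (y : V → ℤ), IsSide G P → 
      form G P (alternate G t P y) = form G P y := by
    intro t
    induction t with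
    | zero => exact fun _ _ _ => rfl
    | succ t ih =>
      intro P y hP
      rw [alternate, ← form_compl hP, ih _ _ hP.compl, form_compl hP, form_refl hP]
  have := hform t O (w - x) hO
  rw [ht, form_zero, hyq] at this
  omega

/-- A regular real root that is not smaller than the harmonic weights stays positive. -/
theorem alternate_pos_of_regular {w : V → ℤ} (hw0 : ∀ i, 0 < w i)
    (hw : ∀ i, nbrSum G w i = 2 * w i) (hconn : G.Connected) (hO : IsSide G O)
    {x : V → ℤ} (hq : form G O x = 1) (hxw : ¬ x < w) (h1 : ∀ t, 0 ≤ alternate G t O x)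
    (h2 : ∀ t, 0 ≤ alternate G t Oᶜ x) (t : ℕ) (i : V) : 0 < alternate G t O x i := by
  have hG := isPosProper_of_superharmonic hconn hO ⟨hw0, fun i => (hw i).le⟩
  have hd : defect w O x = 0 := defect_eq_zero hO (fun i => (hw0 i).le) hw h1 h2
  have hyq : form G O (x - w) = 1 := by rw [form_sub_harmonic hO hw, hq]
  -- The vector `x - w` is again a real root, so it has a sign, and the negative sign is excluded.
  -- It has defect 0 and stays nonnegative, so every image of `x` is at least `w`.
  have hy0 : 0 ≤ x - w := by
    rcases nonneg_or_nonpos hG hyq with h | h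
    · exact h
    · refine absurd (lt_of_le_of_ne (sub_nonpos.1 h) fun h' => ?_) hxw
      rw [h', sub_self, form_zero] at hyq
      omega
  have hyd : defect w O (x - w) = 0 := by
    have h1 : defect w O w = 0 := defect_eq_zero hO (fun i => (hw0 i).le) hw
      (fun t => by rw [alternate_of_harmonic t hw]; exact fun i => (hw0 i).le)
      (fun t => by rw [alternate_of_harmonic t hw]; exact fun i => (hw0 i).le)
    have h2 : defect w O (x - w) = defect w O x - defect w O w := by
      simp only [defect, Pi.sub_apply, mul_sub, Finset.sum_sub_distrib]; ring
    rw [h2, h1, hd, sub_zero]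
  have hnn := alternate_nonneg_of_defect hO hG hw0 hw t hy0 hyq hyd
  have hsum := alternate_add (G := G) (O := O) t (x - w) w
  rw [sub_add_cancel, alternate_of_harmonic t hw] at hsum
  rw [hsum]
  have := hnn i
  have := hw0 i
  simp only [Pi.add_apply, Pi.zero_apply] at *
  omega

/-- As long as the dimensions stay positive the functor can be applied, and a character is
nonnegative wherever the dimension is not 0. The character runs through the reflections one side out
of phase with the dimension. -/
theorem alternate_character_nonneg (hO : IsSide G O) (t : ℕ) {n : V → ℕ} {χ : V → ℝ}
    (hn : ∀ t i, 0 < alternate G t O (fun i => (n i : ℤ)) i) (h : Realizes G n χ) :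
    0 ≤ alternate G t Oᶜ χ := by
  induction t generalizing O n χ with
  | zero =>
    obtain ⟨A, a1, a2, -⟩ := h
    intro i
    have := hn 0 i
    simp only [alternate] at this
    exact scalar_nonneg a1 a2 (i := i) (by omega)
  | succ t ih =>
    obtain ⟨n', hn'⟩ : ∃ n' : V → ℕ, (fun i => (n' i : ℤ)) = refl G O fun i => (n i : ℤ) :=
      ⟨fun i => (refl G O (fun i => (n i : ℤ)) i).toNat,
        funext fun i => Int.toNat_of_nonneg (hn 1 i).le⟩
    have e1 : ∀ i ∈ O, n i + n' i = nbrSum G n i := fun i hi => by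
      have := congrFun hn' i
      rw [refl_of_mem _ hi, nbrSum_natCast] at this
      omega
    have e2 : ∀ i, i ∉ O → n' i = n i := fun i hi => by
      have := congrFun hn' i
      rw [refl_of_notMem _ hi] at this
      omega
    refine ih hO.compl (n := n') (fun t i => by rw [hn']; exact hn (t + 1) i)
      (h.refl hO e1 e2 fun i hi h0 => ?_)
    obtain ⟨k, hk, -, hk0⟩ := exists_adj_of_refl hO e1 hi h0
    obtain ⟨A, a1, a2, a3⟩ := h
    have := hn 0 i
    simp only [alternate] at this
    exact scalar_pos a1 a2 a3 (by omega) hk hk0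

/-- If the dimension stays positive under alternating reflections in both directions, then the
weighted sums of the character over both sides agree. -/
theorem defect_character_eq_zero (hO : IsSide G O) {w : V → ℤ} (hw0 : ∀ i, 0 < w i)
    (hw : ∀ i, nbrSum G w i = 2 * w i) {n : V → ℕ} {χ : V → ℝ}
    (hn : ∀ t i, 0 < alternate G t O (fun i => (n i : ℤ)) i)
    (hn' : ∀ t i, 0 < alternate G t Oᶜ (fun i => (n i : ℤ)) i) (h : Realizes G n χ) :
    defect (fun i => (w i : ℝ)) O χ = 0 := by
  refine defect_eq_zero hO (fun i => Int.cast_nonneg (hw0 i).le) (fun i => ?_) (fun t => ?_)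
    fun t => alternate_character_nonneg hO t hn h
  · have := hw i
    simp only [nbrSum] at this ⊢
    exact_mod_cast this
  · have := alternate_character_nonneg hO.compl t hn' h
    rwa [compl_compl] at this

end Cone
end Orthoscalar

namespace Orthoscalar

/-! ### Deforming characters by the moment map, and nonexistence. -/

section Deformation

open Finset Matrix Filter Topology
open scoped Classical ComplexOrder
set_option linter.unusedSectionVars false

attribute [local instance] Matrix.normedAddCommGroup Matrix.normedSpace

variable {V : Type u} [Fintype V] {G : SimpleGraph V} {O : Set V} {n : V → ℕ}

/-- The representation of `G` given by the matrices `X i j` with `i ∈ O`. -/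
noncomputable def symmetrize (G : SimpleGraph V) (O : Set V) (n : V → ℕ) :
    (∀ i j, Matrix (Fin (n i)) (Fin (n j)) ℂ) →ₗ[ℝ] ∀ i j, Matrix (Fin (n i)) (Fin (n j)) ℂ where
  toFun X i j := if G.Adj i j then if i ∈ O then X i j else (X j i)ᴴ else 0
  map_add' X Y := by
    funext i j
    simp only [Pi.add_apply]
    split_ifs <;> simp
  map_smul' c X := by
    funext i j
    simp only [Pi.smul_apply, RingHom.id_apply]
    split_ifs <;> simp

theorem symmetrize_apply (X : ∀ i j, Matrix (Fin (n i)) (Fin (n j)) ℂ) (i j : V) :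
    symmetrize G O n X i j = if G.Adj i j then if i ∈ O then X i j else (X j i)ᴴ else 0 := rfl

theorem isGraphRep_symmetrize (hO : IsSide G O) (X : ∀ i j, Matrix (Fin (n i)) (Fin (n j)) ℂ) :
    IsGraphRep G (symmetrize G O n X) := by
  refine ⟨fun i j hij => by simp [symmetrize_apply, hij], fun i j => ?_⟩
  rw [symmetrize_apply, symmetrize_apply]
  by_cases hij : G.Adj i j
  · by_cases hi : i ∈ O
    · simp [hij, hij.symm, hi, (hO i j hij).1 hi]
    · have hj : j ∈ O := by
        by_contra hj; exact hi ((hO _ _ hij).2 hj)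
      simp [hij, hij.symm, hi, hj]
  · have hji : ¬ G.Adj j i := fun h => hij h.symm
    simp [hij, hji]

theorem symmetrize_eq {X : ∀ i j, Matrix (Fin (n i)) (Fin (n j)) ℂ} (hX : IsGraphRep G X) :
    symmetrize G O n X = X := by
  funext i j
  rw [symmetrize_apply]
  split_ifs with h1 h2
  · rfl
  · rw [hX.conj]
  · rw [hX.zero i j h1]

/-- Near an irreducible representation all representations are irreducible. -/
theorem eventually_isIrred {A : ∀ i j, Matrix (Fin (n i)) (Fin (n j)) ℂ} (hA : IsGraphRep G A)
    (hirr : IsIrred A) : ∀ᶠ X in 𝓝 A, IsIrred (symmetrize G O n X) := by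
  have hN : (∑ i, (n i : ℂ)) ≠ 0 := by
    obtain ⟨i, hi⟩ := hirr.1
    have : ∑ i, n i ≠ 0 := fun h => hi (Finset.sum_eq_zero_iff.1 h i (mem_univ i))
    exact_mod_cast this
  have hS : Continuous (symmetrize G O n) := LinearMap.continuous_of_finiteDimensional _
  -- Irreducibility means that no commuting family of total trace 0 has norm 1: subtracting a scalar
  -- and normalizing reduces to this case. The condition is open, and the unit sphere is compact.
  let P : (∀ i j, Matrix (Fin (n i)) (Fin (n j)) ℂ) → (∀ i, Matrix (Fin (n i)) (Fin (n i)) ℂ) →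
      Prop := fun X f => ¬ ((∀ i j, f i * symmetrize G O n X i j = symmetrize G O n X i j * f j) ∧
        ∑ i, (f i).trace = 0)
  have htr : ∀ c : ℂ, ∑ i, (c • (1 : Matrix (Fin (n i)) (Fin (n i)) ℂ)).trace =
      c * ∑ i, (n i : ℂ) := fun c => by simp [Finset.mul_sum]
  have hev : ∀ᶠ X in 𝓝 A, ∀ f ∈ Metric.sphere (0 : ∀ i, Matrix (Fin (n i)) (Fin (n i)) ℂ) 1,
      P X f := by
    refine (isCompact_sphere _ _).eventually_forall_of_forall_eventually fun f hf => ?_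
    have hopen : IsOpen {z : (∀ i j, Matrix (Fin (n i)) (Fin (n j)) ℂ) ×
        (∀ i, Matrix (Fin (n i)) (Fin (n i)) ℂ) | P z.1 z.2} := by
      rw [← isClosed_compl_iff]
      have : {z : (∀ i j, Matrix (Fin (n i)) (Fin (n j)) ℂ) ×
          (∀ i, Matrix (Fin (n i)) (Fin (n i)) ℂ) | P z.1 z.2}ᶜ =
          (⋂ i, ⋂ j, {z | z.2 i * symmetrize G O n z.1 i j = symmetrize G O n z.1 i j * z.2 j}) ∩
            {z | ∑ i, (z.2 i).trace = 0} := by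
        ext z
        simp [P]
      rw [this]
      refine IsClosed.inter (isClosed_iInter fun i => isClosed_iInter fun j => ?_) ?_
      · have h1 : Continuous fun z : (∀ i j, Matrix (Fin (n i)) (Fin (n j)) ℂ) ×
            (∀ i, Matrix (Fin (n i)) (Fin (n i)) ℂ) => symmetrize G O n z.1 i j :=
          (continuous_apply j).comp ((continuous_apply i).comp (hS.comp continuous_fst))
        have h2 : ∀ i, Continuous fun z : (∀ i j, Matrix (Fin (n i)) (Fin (n j)) ℂ) ×
            (∀ i, Matrix (Fin (n i)) (Fin (n i)) ℂ) => z.2 i :=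
          fun i => (continuous_apply i).comp continuous_snd
        exact isClosed_eq ((h2 i).matrix_mul h1) (h1.matrix_mul (h2 j))
      · refine isClosed_eq (continuous_finsetSum _ fun i _ => ?_) continuous_const
        exact Continuous.matrix_trace ((continuous_apply i).comp continuous_snd)
    refine hopen.mem_nhds ?_
    rintro ⟨h1, h2⟩
    simp only at h1 h2
    rw [symmetrize_eq hA] at h1
    obtain ⟨c, hc⟩ := hirr.2 f h1
    simp only [hc, htr, mul_eq_zero, or_iff_left hN] at h2
    have : f = 0 := funext fun i => by rw [hc, h2, zero_smul]; rfl
    rw [this] at hf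
    simp at hf
  filter_upwards [hev] with X hX
  refine ⟨hirr.1, fun g hg => ?_⟩
  set c := (∑ i, (g i).trace) / ∑ i, (n i : ℂ) with hc
  set f : ∀ i, Matrix (Fin (n i)) (Fin (n i)) ℂ := fun i => g i - c • 1 with hf
  have hf1 : ∀ i j, f i * symmetrize G O n X i j = symmetrize G O n X i j * f j := fun i j => by
    simp only [hf, Matrix.sub_mul, Matrix.mul_sub, hg i j]
    simp
  have hf2 : ∑ i, (f i).trace = 0 := by
    simp only [hf, Matrix.trace_sub, Finset.sum_sub_distrib, htr]
    rw [hc, div_mul_cancel₀ _ hN, sub_self]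
  by_cases hf0 : f = 0
  · exact ⟨c, fun i => sub_eq_zero.1 (congrFun hf0 i)⟩
  · exfalso
    refine hX (((‖f‖⁻¹ : ℝ) : ℂ) • f) ?_ ⟨fun i j => ?_, ?_⟩
    · rw [mem_sphere_zero_iff_norm, norm_smul]
      simp [norm_ne_zero_iff.2 hf0]
    · simp [hf1]
    · simp only [Pi.smul_apply, Matrix.trace_smul, ← Finset.smul_sum, hf2, smul_zero]

instance finiteDimensional_deformations : FiniteDimensional ℝ
    ((∀ i j, Matrix (Fin (n i)) (Fin (n j)) ℂ) × ℝ × (∀ i, Matrix (Fin (n i)) (Fin (n i)) ℂ)) :=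
  have : FiniteDimensional ℝ (∀ i j, Matrix (Fin (n i)) (Fin (n j)) ℂ) := inferInstance
  have : FiniteDimensional ℝ (∀ i, Matrix (Fin (n i)) (Fin (n i)) ℂ) := inferInstance
  Module.Finite.prod

/-- Real functionals on families of matrices are given by traces. -/
theorem exists_trace_eq (f : (∀ i, Matrix (Fin (n i)) (Fin (n i)) ℂ) →ₗ[ℝ] ℝ) :
    ∃ h : ∀ i, Matrix (Fin (n i)) (Fin (n i)) ℂ, ∀ Z, f Z = (∑ i, (h i * Z i).trace).re := by
  let T : (∀ i, Matrix (Fin (n i)) (Fin (n i)) ℂ) →ₗ[ℝ]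
      Module.Dual ℝ (∀ i, Matrix (Fin (n i)) (Fin (n i)) ℂ) :=
    LinearMap.mk₂ ℝ (fun h Z => (∑ i, (h i * Z i).trace).re)
      (fun h h' Z => by simp [Matrix.add_mul, Finset.sum_add_distrib])
      (fun c h Z => by simp [Finset.mul_sum])
      (fun h Z Z' => by simp [Matrix.mul_add, Finset.sum_add_distrib])
      (fun c h Z => by simp [Finset.mul_sum])
  have hT : Function.Injective T := by
    rw [injective_iff_map_eq_zero]
    intro h h0
    have h1 : (∑ i, (h i * (h i)ᴴ).trace).re = 0 := congrArg (fun g => g fun i => (h i)ᴴ) h0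
    rw [Complex.re_sum] at h1
    have h2 : ∀ i, 0 ≤ (h i * (h i)ᴴ).trace := fun i =>
      (Matrix.posSemidef_self_mul_conjTranspose (h i)).trace_nonneg
    funext i
    have h3 := (Finset.sum_eq_zero_iff_of_nonneg fun i _ => (Complex.nonneg_iff.1 (h2 i)).1).1 h1 i
      (mem_univ i)
    refine Matrix.trace_mul_conjTranspose_self_eq_zero_iff.1 (Complex.ext h3 ?_)
    exact (Complex.nonneg_iff.1 (h2 i)).2.symm
  have hsurj := (LinearMap.injective_iff_surjective_of_finrank_eq_finrank
    (Subspace.dual_finrank_eq (K := ℝ)).symm).1 hT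
  obtain ⟨h, rfl⟩ := hsurj f
  exact ⟨h, fun Z => rfl⟩

theorem sum_trace_conjTranspose_mul_self_eq_zero {ι : Type*} {s : Finset ι} {a b : ι → ℕ}
    {M : ∀ i, Matrix (Fin (a i)) (Fin (b i)) ℂ} (h : (∑ i ∈ s, ((M i)ᴴ * M i).trace).re = 0) 
    {i : ι} (hi : i ∈ s) : M i = 0 := by
  have h2 : ∀ i, 0 ≤ ((M i)ᴴ * M i).trace := fun i =>
    (Matrix.posSemidef_conjTranspose_mul_self (M i)).trace_nonneg
  rw [Complex.re_sum] at h
  have h3 := (Finset.sum_eq_zero_iff_of_nonneg fun i _ => (Complex.nonneg_iff.1 (h2 i)).1).1 h i hi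
  exact Matrix.trace_conjTranspose_mul_self_eq_zero_iff.1
    (Complex.ext h3 (Complex.nonneg_iff.1 (h2 i)).2.symm)

/-- The sign of a vertex. -/
noncomputable def sideSign (O : Set V) (i : V) : ℝ := if i ∈ O then 1 else -1

theorem sideSign_mul_self (i : V) : sideSign O i * sideSign O i = 1 := by
  unfold sideSign; split_ifs <;> norm_num

theorem sideSign_of_adj (hO : IsSide G O) {i j : V} (h : G.Adj i j) :
    sideSign O j = -sideSign O i := by
  have := hO i j h
  unfold sideSign
  by_cases hi : i ∈ O
  · simp [hi, this.1 hi]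
  · have hj : j ∈ O := by
      by_contra hj; exact hi (this.2 hj)
    simp [hi, hj]

/-- The derivative at `A` of the moment map, extended by the directions that are not in the
image of the derivative for trivial reasons. -/
noncomputable def momentDeriv (G : SimpleGraph V) (O : Set V)
    (A : ∀ i j, Matrix (Fin (n i)) (Fin (n j)) ℂ) :
    ((∀ i j, Matrix (Fin (n i)) (Fin (n j)) ℂ) × ℝ × (∀ i, Matrix (Fin (n i)) (Fin (n i)) ℂ)) →ₗ[ℝ]
      ∀ i, Matrix (Fin (n i)) (Fin (n i)) ℂ where
  toFun x i := ∑ j, (symmetrize G O n x.1 i j * A j i + A i j * symmetrize G O n x.1 j i) +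
    ((x.2.1 * sideSign O i : ℝ) : ℂ) • 1 + (x.2.2 i - (x.2.2 i)ᴴ)
  map_add' x y := by
    funext i
    simp only [Prod.fst_add, Prod.snd_add, map_add, Pi.add_apply, Matrix.add_mul, Matrix.mul_add,
      Matrix.conjTranspose_add, Finset.sum_add_distrib, add_mul, Complex.ofReal_add, add_smul]
    abel
  map_smul' c x := by
    funext i
    simp only [Prod.smul_fst, Prod.smul_snd, map_smul, Pi.smul_apply, Matrix.smul_mul,
      Matrix.mul_smul, Matrix.conjTranspose_smul, star_trivial, ← smul_add, ← Finset.smul_sum,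
      RingHom.id_apply, ← smul_sub, smul_eq_mul, mul_assoc]
    rw [Complex.ofReal_mul c, mul_smul, Complex.coe_smul c]
    simp only [smul_add]

theorem momentDeriv_apply (A : ∀ i j, Matrix (Fin (n i)) (Fin (n j)) ℂ)
    (x : (∀ i j, Matrix (Fin (n i)) (Fin (n j)) ℂ) × ℝ × (∀ i, Matrix (Fin (n i)) (Fin (n i)) ℂ))
    (i : V) : momentDeriv G O A x i =
      ∑ j, (symmetrize G O n x.1 i j * A j i + A i j * symmetrize G O n x.1 j i) +
        ((x.2.1 * sideSign O i : ℝ) : ℂ) • 1 + (x.2.2 i - (x.2.2 i)ᴴ) := rfl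

/-- The proof tests a functional `h` annihilating the range. The skew-Hermitian directions make `h`
Hermitian, the directions of representations put its signed version into the commutant, and the
direction `sideSign` excludes the remaining scalars. -/
theorem momentDeriv_surjective (hO : IsSide G O) {A : ∀ i j, Matrix (Fin (n i)) (Fin (n j)) ℂ}
    (hA : IsGraphRep G A) (hirr : IsIrred A) :
    Function.Surjective (momentDeriv G O A) := by
  rw [← LinearMap.range_eq_top]
  by_contra hne
  obtain ⟨f, hf0, hf⟩ := Submodule.exists_le_ker_of_lt_top _ (lt_top_iff_ne_top.2 hne)
  obtain ⟨h, hh⟩ := exists_trace_eq f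
  have hD : ∀ x, (∑ i, (h i * momentDeriv G O A x i).trace).re = 0 := fun x => by
    rw [← hh]; exact hf ⟨x, rfl⟩
  have herm : ∀ i, (h i)ᴴ = h i := by
    have h1 := hD (0, 0, fun i => h i - (h i)ᴴ)
    have h2 : (∑ i, ((h i - (h i)ᴴ)ᴴ * (h i - (h i)ᴴ)).trace).re = 0 := by
      rw [Complex.re_sum] at h1 ⊢
      rw [← neg_eq_zero, ← Finset.sum_neg_distrib, ← h1]
      refine Finset.sum_congr rfl fun i _ => ?_
      rw [momentDeriv_apply]
      have e : (((h i)ᴴ * h i).trace).re = ((h i * (h i)ᴴ).trace).re := by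
        rw [Matrix.trace_mul_comm]
      have e' : (((h i)ᴴ * (h i)ᴴ).trace).re = ((h i * h i).trace).re := by
        rw [← Matrix.conjTranspose_mul, Matrix.trace_conjTranspose]
        simp
      simp only [map_zero, Pi.zero_apply, Matrix.zero_mul, Matrix.mul_zero, add_zero,
        Finset.sum_const_zero, zero_mul, Complex.ofReal_zero, zero_smul, zero_add,
        Matrix.conjTranspose_sub, Matrix.conjTranspose_conjTranspose, Matrix.sub_mul,
        Matrix.mul_sub, Matrix.trace_sub, Complex.sub_re, e, e']
      ring
    intro i
    exact (sub_eq_zero.1 (sum_trace_conjTranspose_mul_self_eq_zero h2 (mem_univ i))).symm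
  -- The gradient of the pairing with `h`: differentiating in the direction of `B` itself gives its
  -- squared norm.
  have hB : ∀ i j, A i j * h j + h i * A i j = 0 := by
    set B : ∀ i j, Matrix (Fin (n i)) (Fin (n j)) ℂ := fun i j => A i j * h j + h i * A i j with hB
    have hBrep : IsGraphRep G B := by
      refine ⟨fun i j hij => by simp [hB, hA.zero i j hij], fun i j => ?_⟩
      simp only [hB, Matrix.conjTranspose_add, Matrix.conjTranspose_mul, hA.conj, herm]
      rw [add_comm]
    have h1 := hD (B, 0, 0)
    have h2 : ∑ i, (h i * momentDeriv G O A (B, 0, 0) i).trace =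
        ∑ i, ∑ j, ((B j i)ᴴ * B j i).trace := by
      have e1 : ∀ i, (h i * momentDeriv G O A (B, 0, 0) i).trace =
          ∑ j, (h i * (B i j * A j i)).trace + ∑ j, (h i * (A i j * B j i)).trace := fun i => by
        rw [momentDeriv_apply]
        simp only [symmetrize_eq hBrep, zero_mul, Complex.ofReal_zero, zero_smul, add_zero,
          Pi.zero_apply, Matrix.conjTranspose_zero, sub_zero]
        rw [Matrix.mul_sum, Matrix.trace_sum, ← Finset.sum_add_distrib]
        exact Finset.sum_congr rfl fun j _ => by rw [Matrix.mul_add, Matrix.trace_add]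
      rw [Finset.sum_congr rfl fun i _ => e1 i, Finset.sum_add_distrib,
        Finset.sum_comm (f := fun i j => (h i * (B i j * A j i)).trace), ← Finset.sum_add_distrib]
      refine Finset.sum_congr rfl fun i _ => ?_
      rw [← Finset.sum_add_distrib]
      refine Finset.sum_congr rfl fun j _ => ?_
      rw [hBrep.conj]
      have e2 : (h j * (B j i * A i j)).trace = (A i j * h j * B j i).trace := by
        rw [← Matrix.mul_assoc, Matrix.trace_mul_comm, Matrix.mul_assoc]
      rw [e2, ← Matrix.mul_assoc, ← Matrix.trace_add, ← Matrix.add_mul]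
    rw [h2, ← Finset.sum_product'] at h1
    intro i j
    exact sum_trace_conjTranspose_mul_self_eq_zero (M := fun p : V × V => B p.2 p.1)
      (a := fun p => n p.2) (b := fun p => n p.1) h1 (i := (j, i)) (by simp)
  -- The sign changes along every edge and turns anticommutation with `A` into commutation.
  obtain ⟨c, hc⟩ := hirr.2 (fun i => (sideSign O i : ℂ) • h i) fun i j => by
    by_cases hij : G.Adj i j
    · rw [sideSign_of_adj hO hij, Matrix.smul_mul, Matrix.mul_smul,
        eq_neg_of_add_eq_zero_right (hB i j)]
      simp
    · simp [hA.zero i j hij]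
  have hc' : ∀ i, h i = (c * sideSign O i) • 1 := fun i => by
    rw [mul_comm, mul_smul, ← hc i, smul_smul, ← Complex.ofReal_mul, sideSign_mul_self,
      Complex.ofReal_one, one_smul]
  obtain ⟨i, hi⟩ := hirr.1
  have him : c.im = 0 := by
    have h1 := congrFun (congrFun (herm i) ⟨0, by omega⟩) ⟨0, by omega⟩
    rw [hc' i] at h1
    have hs : (sideSign O i : ℂ) ≠ 0 := fun h => by
      have := sideSign_mul_self (O := O) i
      rw [Complex.ofReal_eq_zero.1 h] at this
      simp at this
    simp [hs] at h1
    exact Complex.conj_eq_iff_im.1 h1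
  have hre : c.re = 0 := by
    have h1 := hD (0, 1, 0)
    have h2 : ∑ i, (h i * momentDeriv G O A (0, 1, 0) i).trace = c * (∑ i, n i : ℕ) := by
      push_cast
      rw [Finset.mul_sum]
      refine Finset.sum_congr rfl fun i _ => ?_
      rw [momentDeriv_apply, hc' i]
      have hs : (sideSign O i : ℂ) * sideSign O i = 1 := by
        rw [← Complex.ofReal_mul, sideSign_mul_self, Complex.ofReal_one]
      simp only [map_zero, Pi.zero_apply, Matrix.zero_mul, Matrix.mul_zero, add_zero,
        Finset.sum_const_zero, one_mul, zero_add, Matrix.conjTranspose_zero, sub_zero,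
        Matrix.smul_mul, Matrix.trace_smul, Matrix.trace_one, smul_eq_mul,
        Fintype.card_fin]
      linear_combination (c * (n i : ℂ)) * hs
    rw [h2] at h1
    have hN : (∑ i, n i) ≠ 0 := fun h => hi (Finset.sum_eq_zero_iff.1 h i (mem_univ i))
    simpa [him, hN, -Nat.cast_sum] using h1
  refine hf0 (LinearMap.ext fun Z => ?_)
  have hc0 : c = 0 := Complex.ext hre him
  rw [hh]
  simp [hc', hc0]

/-- The moment map, extended as in `momentDeriv`. -/
noncomputable def momentMap (G : SimpleGraph V) (O : Set V) (n : V → ℕ)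
    (x : (∀ i j, Matrix (Fin (n i)) (Fin (n j)) ℂ) × ℝ × (∀ i, Matrix (Fin (n i)) (Fin (n i)) ℂ))
    (i : V) : Matrix (Fin (n i)) (Fin (n i)) ℂ :=
  ∑ j, symmetrize G O n x.1 i j * symmetrize G O n x.1 j i +
    ((x.2.1 * sideSign O i : ℝ) : ℂ) • 1 + (x.2.2 i - (x.2.2 i)ᴴ)

theorem contDiff_momentMap : ContDiff ℝ 1 (momentMap G O n) := by
  have hlin : ContDiff ℝ 1 (fun x : (∀ i j, Matrix (Fin (n i)) (Fin (n j)) ℂ) × ℝ ×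
      (∀ i, Matrix (Fin (n i)) (Fin (n i)) ℂ) => momentDeriv G O (0 : ∀ i j, Matrix (Fin (n i)) (Fin (n j)) ℂ) x) :=
    (LinearMap.toContinuousLinearMap (momentDeriv G O 0)).contDiff
  have hs : ∀ i j a b, ContDiff ℝ 1 (fun x : (∀ i j, Matrix (Fin (n i)) (Fin (n j)) ℂ) × ℝ ×
      (∀ i, Matrix (Fin (n i)) (Fin (n i)) ℂ) => symmetrize G O n x.1 i j a b) := by
    intro i j a b
    let T : ((∀ i j, Matrix (Fin (n i)) (Fin (n j)) ℂ) × ℝ ×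
      (∀ i, Matrix (Fin (n i)) (Fin (n i)) ℂ)) →ₗ[ℝ] ℂ :=
      { toFun := fun x => symmetrize G O n x.1 i j a b
        map_add' := fun x y => by simp
        map_smul' := fun c x => by simp }
    exact (LinearMap.toContinuousLinearMap T).contDiff
  have hquad : ContDiff ℝ 1 (fun (x : (∀ i j, Matrix (Fin (n i)) (Fin (n j)) ℂ) × ℝ ×
      (∀ i, Matrix (Fin (n i)) (Fin (n i)) ℂ)) (i : V) =>
      ∑ j, symmetrize G O n x.1 i j * symmetrize G O n x.1 j i) := by
    refine contDiff_pi.2 fun i => contDiff_pi.2 fun a => contDiff_pi.2 fun b => ?_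
    have : (fun x : (∀ i j, Matrix (Fin (n i)) (Fin (n j)) ℂ) × ℝ ×
        (∀ i, Matrix (Fin (n i)) (Fin (n i)) ℂ) =>
        (∑ j, symmetrize G O n x.1 i j * symmetrize G O n x.1 j i) a b) =
        fun x => ∑ j, ∑ p, symmetrize G O n x.1 i j a p * symmetrize G O n x.1 j i p b := by
      funext x
      rw [Matrix.sum_apply]
      rfl
    rw [this]
    exact ContDiff.sum fun j _ => ContDiff.sum fun p _ => (hs i j a p).mul (hs j i p b)
  -- The linear terms of the moment map are exactly its derivative at the zero representation.
  have : momentMap G O n = fun x => (fun i => ∑ j, symmetrize G O n x.1 i j * symmetrize G O n x.1 j i) +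
      momentDeriv G O (0 : ∀ i j, Matrix (Fin (n i)) (Fin (n j)) ℂ) x := by
    funext x i
    simp [momentMap, momentDeriv_apply, add_assoc]
  rw [this]
  exact hquad.add hlin

theorem momentMap_line {A : ∀ i j, Matrix (Fin (n i)) (Fin (n j)) ℂ} (hA : IsGraphRep G A)
    (x : (∀ i j, Matrix (Fin (n i)) (Fin (n j)) ℂ) × ℝ × (∀ i, Matrix (Fin (n i)) (Fin (n i)) ℂ))
    (t : ℝ) : momentMap G O n ((A, 0, 0) + t • x) = momentMap G O n (A, 0, 0) +
      t • momentDeriv G O A x +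
      t ^ 2 • fun i => ∑ j, symmetrize G O n x.1 i j * symmetrize G O n x.1 j i := by
  funext i
  simp only [momentMap, momentDeriv_apply, Prod.fst_add, Prod.snd_add, Prod.smul_fst, 
    Prod.smul_snd, map_add, map_smul, symmetrize_eq hA, Pi.add_apply, Pi.smul_apply]
  have e : ∀ j, (A i j + t • symmetrize G O n x.1 i j) * (A j i + t • symmetrize G O n x.1 j i) =
      A i j * A j i + t • (symmetrize G O n x.1 i j * A j i + A i j * symmetrize G O n x.1 j i) +
        t ^ 2 • (symmetrize G O n x.1 i j * symmetrize G O n x.1 j i) := fun j => by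
    simp only [Matrix.add_mul, Matrix.mul_add, Matrix.smul_mul, Matrix.mul_smul, smul_add,
      smul_smul, pow_two]
    abel
  rw [Finset.sum_congr rfl fun j _ => e j]
  simp only [Finset.sum_add_distrib, ← Finset.smul_sum, zero_add, zero_mul, Complex.ofReal_zero,
    zero_smul, Pi.zero_apply, Matrix.conjTranspose_zero, sub_zero, add_zero,
    Matrix.conjTranspose_smul, star_trivial, smul_add, smul_sub, smul_eq_mul, mul_assoc]
  rw [Complex.ofReal_mul t, mul_smul, Complex.coe_smul t]
  abel

/-- For a continuously differentiable map the derivative is determined by its values along lines,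
where a quadratic map can be expanded by algebra. -/
theorem hasStrictFDerivAt_of_line {E F : Type*} [NormedAddCommGroup E] [NormedSpace ℝ E]
    [NormedAddCommGroup F] [NormedSpace ℝ F] {f Q : E → F} (hf : ContDiff ℝ 1 f) {a : E}
    {D : E →L[ℝ] F} (h : ∀ x (t : ℝ), f (a + t • x) = f a + t • D x + t ^ 2 • Q x) :
    HasStrictFDerivAt f D a := by
  have h0 := hf.contDiffAt.hasStrictFDerivAt (x := a) one_ne_zero
  suffices e : D = fderiv ℝ f a by rwa [e]
  refine ContinuousLinearMap.ext fun x => ?_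
  have h1 : HasDerivAt (fun t : ℝ => f (a + t • x)) (fderiv ℝ f a x) 0 := by
    have h2 : HasDerivAt (fun t : ℝ => a + t • x) x 0 := by
      simpa using ((hasDerivAt_id (0 : ℝ)).smul_const x).const_add a
    have h3 : HasFDerivAt f (fderiv ℝ f a) (a + (0 : ℝ) • x) := by simpa using h0.hasFDerivAt
    exact h3.comp_hasDerivAt (0 : ℝ) h2
  have h2 : HasDerivAt (fun t : ℝ => f (a + t • x)) (D x) 0 := by
    simp only [h]
    have h3 := (((hasDerivAt_id (0 : ℝ)).smul_const (D x)).const_add (f a)).add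
      ((hasDerivAt_pow 2 (0 : ℝ)).smul_const (Q x))
    simpa [Pi.add_def] using h3
  exact h2.unique h1

theorem hasStrictFDerivAt_momentMap {A : ∀ i j, Matrix (Fin (n i)) (Fin (n j)) ℂ}
    (hA : IsGraphRep G A) : HasStrictFDerivAt (momentMap G O n)
      (LinearMap.toContinuousLinearMap (momentDeriv G O A)) (A, 0, 0) := by
  refine hasStrictFDerivAt_of_line contDiff_momentMap fun x t => momentMap_line hA x t

/-- The characters near a given one are realized, up to a multiple of `sideSign`. -/
theorem Realizes.exists_near (hO : IsSide G O) {χ : V → ℝ} (h : Realizes G n χ) (η : V → ℝ) :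
    ∃ t > 0, ∃ s, Realizes G n fun i => χ i + t * η i - s * sideSign O i := by
  obtain ⟨A, hA, hχ, hirr⟩ := h
  have hsurj : (LinearMap.toContinuousLinearMap (momentDeriv G O A)).range = ⊤ :=
    LinearMap.range_eq_top.2 (momentDeriv_surjective hO hA hirr)
  have hmap := (hasStrictFDerivAt_momentMap (O := O) hA).map_nhds_eq_of_surj hsurj
  have hU : {x : (∀ i j, Matrix (Fin (n i)) (Fin (n j)) ℂ) × ℝ ×
      (∀ i, Matrix (Fin (n i)) (Fin (n i)) ℂ) | IsIrred (symmetrize G O n x.1)} ∈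
      𝓝 ((A, 0, 0) : (∀ i j, Matrix (Fin (n i)) (Fin (n j)) ℂ) × ℝ ×
      (∀ i, Matrix (Fin (n i)) (Fin (n i)) ℂ)) :=
    continuous_fst.continuousAt.eventually (eventually_isIrred (O := O) hA hirr)
  have hU' := hmap.ge (image_mem_map (m := momentMap G O n) hU)
  have hcont : Tendsto (fun (t : ℝ) (i : V) =>
      ((χ i + t * η i : ℝ) : ℂ) • (1 : Matrix (Fin (n i)) (Fin (n i)) ℂ)) (𝓝[>] 0)
      (𝓝 (momentMap G O n (A, 0, 0))) := by
    have h0 : momentMap G O n (A, 0, 0) = fun i =>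
        ((χ i + 0 * η i : ℝ) : ℂ) • (1 : Matrix (Fin (n i)) (Fin (n i)) ℂ) := by
      funext i
      simp [momentMap, symmetrize_eq hA, hχ i]
    rw [h0]
    refine Tendsto.mono_left (Continuous.tendsto ?_ 0) nhdsWithin_le_nhds
    refine continuous_pi fun i => continuous_matrix fun a b => ?_
    simp only [Matrix.smul_apply]
    fun_prop
  obtain ⟨t, ⟨x, hx, hxt⟩, ht⟩ := ((hcont.eventually hU').and self_mem_nhdsWithin).exists
  refine ⟨t, ht, x.2.1, symmetrize G O n x.1, isGraphRep_symmetrize hO _, fun i => ?_, hx⟩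
  have e1 := congrFun hxt i
  simp only [momentMap] at e1
  have hrep := isGraphRep_symmetrize (O := O) hO x.1
  have hself : (∑ j, symmetrize G O n x.1 i j * symmetrize G O n x.1 j i)ᴴ =
      ∑ j, symmetrize G O n x.1 i j * symmetrize G O n x.1 j i := by
    rw [Matrix.conjTranspose_sum]
    exact Finset.sum_congr rfl fun j _ => by rw [Matrix.conjTranspose_mul, hrep.conj, hrep.conj]
  have e2 := congrArg Matrix.conjTranspose e1
  simp only [Matrix.conjTranspose_add, hself, Matrix.conjTranspose_smul, Matrix.conjTranspose_one,
    Matrix.conjTranspose_sub, Matrix.conjTranspose_conjTranspose, Complex.star_def,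
    Complex.conj_ofReal] at e2
  rw [← e1] at e2
  -- All other terms are Hermitian, so the auxiliary skew-Hermitian term vanishes. Only the multiple
  -- of `sideSign` survives.
  have e3 : x.2.2 i - (x.2.2 i)ᴴ = 0 := by
    have h1 := add_left_cancel e2
    have h2 : (2 : ℂ) • (x.2.2 i - (x.2.2 i)ᴴ) = 0 := by
      rw [two_smul]
      nth_rewrite 1 [← h1]
      abel
    exact (smul_eq_zero.1 h2).resolve_left two_ne_zero
  rw [e3, add_zero] at e1
  rw [eq_sub_of_add_eq e1, ← sub_smul]
  push_cast
  rfl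

/-- The traces of the orthoscalarity conditions. -/
theorem Realizes.defect_eq_zero (hO : IsSide G O) {χ : V → ℝ} (h : Realizes G n χ) :
    defect (fun i => (n i : ℝ)) O χ = 0 := by
  obtain ⟨A, hA, hχ, -⟩ := h
  have e : ∀ i, ((n i * χ i : ℝ) : ℂ) = ∑ j, (A i j * A j i).trace := fun i => by
    have := sum_trace_mul hχ (fun i => 1) i
    simp only [Matrix.one_mul, Matrix.trace_one, Fintype.card_fin] at this
    rw [this]; push_cast; ring
  have h1 := sum_side_comm hO (T := fun i j => (A i j * A j i).trace)
    fun i j hij => by simp [hA.zero i j hij]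
  have h2 : ∑ i with i ∈ O, ((n i * χ i : ℝ) : ℂ) = ∑ i with i ∉ O, ((n i * χ i : ℝ) : ℂ) := by
    rw [Finset.sum_congr rfl fun i _ => e i, h1, Finset.sum_congr rfl fun i _ => e i]
    exact Finset.sum_congr rfl fun j _ => Finset.sum_congr rfl fun i _ => Matrix.trace_mul_comm _ _
  rw [defect, sub_eq_zero]
  exact_mod_cast h2.symm

/-- There are no irreducible orthoscalar representations if the dimension is regular and not
smaller than the harmonic weights. -/
theorem not_realizes_of_regular {w : V → ℤ} (hw0 : ∀ i, 0 < w i)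
    (hw : ∀ i, nbrSum G w i = 2 * w i) (hconn : G.Connected) (hO : IsSide G O)
    (hq : form G O (fun i => (n i : ℤ)) = 1) (hnw : ¬ (fun i => (n i : ℤ)) < w)
    (h1 : ∀ t, 0 ≤ alternate G t O (fun i => (n i : ℤ)))
    (h2 : ∀ t, 0 ≤ alternate G t Oᶜ (fun i => (n i : ℤ))) (χ : V → ℝ) : ¬ Realizes G n χ := by
  intro h
  have p1 := alternate_pos_of_regular hw0 hw hconn hO hq hnw h1 h2
  have p2 := alternate_pos_of_regular hw0 hw hconn hO.compl (by rw [form_compl hO, hq]) hnw h2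
    (by rwa [compl_compl])
  have hd : ∀ ψ, Realizes G n ψ → defect (fun i => (w i : ℝ)) O ψ = 0 :=
    fun ψ hψ => defect_character_eq_zero hO hw0 hw p1 p2 hψ
  have hlin : ∀ (u : V → ℝ) (η : V → ℝ) (t s : ℝ),
      defect u O (fun i => χ i + t * η i - s * sideSign O i) =
        defect u O χ + t * defect u O η + s * ∑ i, u i := by
    intro u η t s
    rw [← Finset.sum_filter_add_sum_filter_not univ (· ∈ O) u]
    simp only [defect, mul_sub, mul_add, Finset.sum_sub_distrib, Finset.sum_add_distrib,
      Finset.mul_sum]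
    have e1 : ∑ i with i ∈ O, u i * (s * sideSign O i) = ∑ i with i ∈ O, s * u i :=
      Finset.sum_congr rfl fun i hi => by
        simp only [sideSign, (Finset.mem_filter.1 hi).2, if_true]; ring
    have e2 : ∑ i with i ∉ O, u i * (s * sideSign O i) = -∑ i with i ∉ O, s * u i := by
      rw [← Finset.sum_neg_distrib]
      exact Finset.sum_congr rfl fun i hi => by
        simp only [sideSign, (Finset.mem_filter.1 hi).2, if_false]; ring
    have e3 : ∀ s : Finset V, ∑ i ∈ s, u i * (t * η i) = ∑ i ∈ s, t * (u i * η i) := fun s =>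
      Finset.sum_congr rfl fun i _ => by ring
    rw [e1, e2, e3, e3]
    ring
  -- Proportional vectors would make both forms vanish, but the form is 1 at `n` and 0 at `w`.
  obtain ⟨i, k, hik⟩ : ∃ i k, (n i : ℤ) * w k ≠ n k * w i := by
    by_contra! hall
    obtain ⟨k⟩ := hconn.nonempty
    have e : w k • (fun i => (n i : ℤ)) = (n k : ℤ) • w := funext fun i => by
      simp only [Pi.smul_apply, smul_eq_mul]
      rw [mul_comm, hall i k]
    have hs : ∀ (c : ℤ) (x : V → ℤ), form G O (c • x) = c ^ 2 * form G O x := fun c x => by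
      simp only [form, nbrSum, Pi.smul_apply, smul_eq_mul, mul_sub, Finset.mul_sum]
      congr 1
      · exact Finset.sum_congr rfl fun i _ => by ring
      · exact Finset.sum_congr rfl fun i _ => Finset.sum_congr rfl fun j _ => by ring
    have hw' : form G O w = 0 := by
      have := two_mul_form hO w
      simp only [hw, sub_self, mul_zero, Finset.sum_const_zero] at this
      omega
    have := congrArg (form G O) e
    rw [hs, hs, hq, hw', mul_zero, mul_one] at this
    exact (pow_pos (hw0 k) 2).ne' this
  have hne : i ≠ k := fun h => hik (by rw [h])
  -- A direction of zero defect for the weights `n` and nonzero defect for the weights `w`. The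
  -- trace condition forces `s = 0`, and the condition for `w` is then violated.
  set η : V → ℝ := Pi.single i (sideSign O i * n k) - Pi.single k (sideSign O k * n i) with hη
  have hdη : ∀ u : V → ℝ, defect u O η = u k * n i - u i * n k := by
    intro u
    have e0 : ∀ x : V → ℝ, defect u O x = -∑ i, sideSign O i * (u i * x i) := fun x => by
      rw [← Finset.sum_filter_add_sum_filter_not univ (· ∈ O), defect]
      have e1 : ∑ i with i ∈ O, sideSign O i * (u i * x i) = ∑ i with i ∈ O, u i * x i :=
        Finset.sum_congr rfl fun i hi => by simp [sideSign, (Finset.mem_filter.1 hi).2]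
      have e2 : ∑ i with i ∉ O, sideSign O i * (u i * x i) = -∑ i with i ∉ O, u i * x i := by
        rw [← Finset.sum_neg_distrib]
        exact Finset.sum_congr rfl fun i hi => by simp [sideSign, (Finset.mem_filter.1 hi).2]
      rw [e1, e2]; ring
    rw [e0]
    simp only [hη, Pi.sub_apply, mul_sub, Finset.sum_sub_distrib, Pi.single_apply, mul_ite,
      mul_zero, Finset.sum_ite_eq', mem_univ, if_true]
    have si := sideSign_mul_self (O := O) i
    have sk := sideSign_mul_self (O := O) k
    linear_combination (u k * n i) * sk - (u i * n k) * si
  obtain ⟨t, ht, s, hR⟩ := h.exists_near hO η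
  have a1 := hR.defect_eq_zero hO
  have a2 := hd _ hR
  rw [hlin, h.defect_eq_zero hO, hdη] at a1
  rw [hlin, hd χ h, hdη] at a2
  have hN : 0 < ∑ i, (n i : ℝ) := by
    refine Finset.sum_pos (fun i _ => ?_) ⟨i, mem_univ i⟩
    have := p1 0 i
    simp only [alternate] at this
    exact_mod_cast this
  have hs : s = 0 := by
    have : s * ∑ i, (n i : ℝ) = 0 := by linear_combination a1
    exact (mul_eq_zero.1 this).resolve_right hN.ne'
  rw [hs, zero_mul, add_zero, zero_add] at a2
  have := (mul_eq_zero.1 a2).resolve_left ht.ne'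
  apply hik
  have h3 : ((n i * w k : ℤ) : ℝ) = ((n k * w i : ℤ) : ℝ) := by push_cast; linarith
  exact_mod_cast h3

end Deformation
end Orthoscalar

namespace Orthoscalar

/-! ### Superharmonic weights on Dynkin and extended Dynkin graphs. -/

section DynkinGraphs

open Finset
open scoped Classical
set_option linter.unusedSectionVars false

/-- Only an upper bound is needed, so the list may contain repetitions, non-neighbours or numbers
out of range, such as `i - 1` at `i = 0`. -/
theorem nbrSum_le_of_mem_list {n : ℕ} {H : SimpleGraph (Fin n)} {W : ℕ → ℤ} (hW : ∀ a, 0 ≤ W a)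
    {i : Fin n} (l : List ℕ) (hl : ∀ j, H.Adj j i → j.val ∈ l) :
    nbrSum H (fun j => W j.val) i ≤ (l.map W).sum := by
  have key : ∀ (l : List ℕ) (P : Fin n → Prop), (∀ j, P j → j.val ∈ l) →
      ∑ j with P j, W j.val ≤ (l.map W).sum := by
    intro l
    induction l with
    | nil =>
      intro P hP
      rw [Finset.sum_eq_zero]
      · simp
      · intro j hj
        exact absurd (hP j (by simpa using hj)) (by simp)
    | cons a l ih =>
      intro P hP
      have h1 : ∑ j : Fin n with j.val = a, W j.val ≤ W a := by
        by_cases ha : a < n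
        · have : (univ.filter fun j : Fin n => j.val = a) = {⟨a, ha⟩} := by
            ext j; simp [Fin.ext_iff]
          rw [this]; simp
        · rw [Finset.sum_eq_zero]
          · exact hW a
          · intro j hj
            have := (Finset.mem_filter.1 hj).2
            omega
      have h2 := ih (fun j => P j ∧ j.val ∈ l) fun j hj => hj.2
      have h3 : ∑ j with P j, W j.val ≤
          ∑ j : Fin n with j.val = a, W j.val + ∑ j with P j ∧ j.val ∈ l, W j.val := by
        simp only [Finset.sum_filter]
        rw [← Finset.sum_add_distrib]
        refine Finset.sum_le_sum fun j _ => ?_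
        have := hW j.val
        by_cases hj : P j
        · rcases List.mem_cons.1 (hP j hj) with h | h
          · simp only [hj, h, if_true]
            split_ifs <;> simp [hW]
          · simp only [hj, h, and_self, if_true]
            split_ifs <;> simp [hW]
        · simp only [hj, if_false, false_and]
          split_ifs <;> simp [hW]
      rw [List.map_cons, List.sum_cons]
      refine h3.trans (add_le_add h1 ((le_of_eq ?_).trans h2))
      congr 1
      ext; simp
  exact key l _ hl

theorem connected_of_exists_adj_lt {n : ℕ} (hn : 0 < n) {H : SimpleGraph (Fin n)}
    (h : ∀ i : Fin n, i.val ≠ 0 → ∃ j, j < i ∧ H.Adj j i) : H.Connected := by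
  have key : ∀ i : Fin n, H.Reachable ⟨0, hn⟩ i := by
    intro i
    induction i using WellFoundedLT.induction with
    | _ i ih =>
      by_cases hi : i.val = 0
      · have : i = ⟨0, hn⟩ := Fin.ext hi
        rw [this]
      · obtain ⟨j, hj, hij⟩ := h i hi
        exact (ih j hj).trans hij.reachable
  have : Nonempty (Fin n) := ⟨⟨0, hn⟩⟩
  exact ⟨fun i j => (key i).symm.trans (key j)⟩

theorem graphBranch_adj {n k : ℕ} {a b : Fin n} : (graphBranch n k).Adj a b ↔
    a ≠ b ∧ ((a.val + 1 = b.val ∧ b.val + 1 < n ∨ a.val = k ∧ b.val + 1 = n) ∨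
      (b.val + 1 = a.val ∧ a.val + 1 < n ∨ b.val = k ∧ a.val + 1 = n)) := Iff.rfl

theorem graphD_adj {n : ℕ} {a b : Fin n} : (graphD n).Adj a b ↔
    a ≠ b ∧ ((a.val + 1 = b.val ∧ b.val + 1 < n ∨ a.val + 3 = n ∧ b.val + 1 = n) ∨
      (b.val + 1 = a.val ∧ a.val + 1 < n ∨ b.val + 3 = n ∧ a.val + 1 = n)) := Iff.rfl

theorem graphExtD_adj {n : ℕ} {a b : Fin (n + 1)} : (graphExtD n).Adj a b ↔
    a ≠ b ∧ ((a.val + 1 = b.val ∧ b.val + 2 ≤ n ∨ a.val = 1 ∧ b.val + 1 = n ∨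
        a.val + 3 = n ∧ b.val = n) ∨
      (b.val + 1 = a.val ∧ a.val + 2 ≤ n ∨ b.val = 1 ∧ a.val + 1 = n ∨
        b.val + 3 = n ∧ a.val = n)) := Iff.rfl

theorem graphExtE6_adj {a b : Fin 7} : graphExtE6.Adj a b ↔
    a ≠ b ∧ ((a.val + 1 = b.val ∧ b.val ≤ 4 ∨ a.val = 2 ∧ b.val = 5 ∨ a.val = 5 ∧ b.val = 6) ∨
      (b.val + 1 = a.val ∧ a.val ≤ 4 ∨ b.val = 2 ∧ a.val = 5 ∨ b.val = 5 ∧ a.val = 6)) := Iff.rfl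

theorem graphBranch_connected {n k : ℕ} (hk : k + 1 < n) : (graphBranch n k).Connected := by
  refine connected_of_exists_adj_lt (by omega) fun i hi => ?_
  have := i.2
  by_cases h : i.val + 1 < n
  · refine ⟨⟨i.val - 1, by omega⟩, Fin.lt_def.2 (by simp only; omega), ?_⟩
    rw [graphBranch_adj, ne_eq, Fin.ext_iff]
    simp only
    omega
  · refine ⟨⟨k, by omega⟩, Fin.lt_def.2 (by simp only; omega), ?_⟩
    rw [graphBranch_adj, ne_eq, Fin.ext_iff]
    simp only [true_and]
    omega

theorem graphD_connected {n : ℕ} (hn : 4 ≤ n) : (graphD n).Connected := by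
  refine connected_of_exists_adj_lt (by omega) fun i hi => ?_
  have := i.2
  by_cases h : i.val + 1 < n
  · refine ⟨⟨i.val - 1, by omega⟩, Fin.lt_def.2 (by simp only; omega), ?_⟩
    rw [graphD_adj, ne_eq, Fin.ext_iff]
    simp only
    omega
  · refine ⟨⟨n - 3, by omega⟩, Fin.lt_def.2 (by simp only; omega), ?_⟩
    rw [graphD_adj, ne_eq, Fin.ext_iff]
    simp only
    omega

theorem graphExtD_connected {n : ℕ} (hn : 4 ≤ n) : (graphExtD n).Connected := by
  refine connected_of_exists_adj_lt (by omega) fun i hi => ?_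
  have := i.2
  by_cases h : i.val + 2 ≤ n
  · refine ⟨⟨i.val - 1, by omega⟩, Fin.lt_def.2 (by simp only; omega), ?_⟩
    rw [graphExtD_adj, ne_eq, Fin.ext_iff]
    simp only
    omega
  · by_cases h' : i.val = n
    · refine ⟨⟨n - 3, by omega⟩, Fin.lt_def.2 (by simp only; omega), ?_⟩
      rw [graphExtD_adj, ne_eq, Fin.ext_iff]
      simp only
      omega
    · refine ⟨⟨1, by omega⟩, Fin.lt_def.2 (by simp only; omega), ?_⟩
      rw [graphExtD_adj, ne_eq, Fin.ext_iff]
      simp only [true_and]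
      omega

theorem graphExtE6_connected : graphExtE6.Connected := by
  refine connected_of_exists_adj_lt (by omega) fun i hi => ?_
  have := i.2
  by_cases h : i.val = 5
  · refine ⟨⟨2, by omega⟩, Fin.lt_def.2 (by simp only; omega), ?_⟩
    rw [graphExtE6_adj, ne_eq, Fin.ext_iff]
    simp only [true_and]
    omega
  · refine ⟨⟨i.val - 1, by omega⟩, Fin.lt_def.2 (by simp only; omega), ?_⟩
    rw [graphExtE6_adj, ne_eq, Fin.ext_iff]
    simp only
    omega

theorem superharmonic_graphD {n : ℕ} (hn : 4 ≤ n) :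
    IsSuperharmonic (graphD n) (fun j => if j.val + 3 ≤ n then 2 else 1) ∧
      nbrSum (graphD n) (fun j => if j.val + 3 ≤ n then 2 else 1) ⟨0, by omega⟩ <
        2 * (if 0 + 3 ≤ n then (2 : ℤ) else 1) := by
  set W : ℕ → ℤ := fun a => if a + 3 ≤ n then 2 else 1 with hWdef
  have hW : ∀ a, 0 ≤ W a := fun a => by simp only [hWdef]; split_ifs <;> norm_num
  have le2 : ∀ a, W a ≤ 2 := fun a => by simp only [hWdef]; split_ifs <;> norm_num
  refine ⟨⟨fun i => by dsimp only; split_ifs <;> norm_num, fun i => ?_⟩, ?_⟩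
  · have := i.2
    by_cases h1 : i.val + 3 < n
    · refine (nbrSum_le_of_mem_list hW [i.val - 1, i.val + 1] fun j hj => ?_).trans ?_
      · rw [graphD_adj] at hj
        simp only [List.mem_cons, List.not_mem_nil, or_false]
        omega
      · have a1 := le2 (i.val - 1)
        have a2 := le2 (i.val + 1)
        simp only [List.map_cons, List.map_nil, List.sum_cons, List.sum_nil]
        rw [if_pos (by omega)]
        omega
    by_cases h2 : i.val + 3 = n
    · refine (nbrSum_le_of_mem_list hW [n - 4, n - 2, n - 1] fun j hj => ?_).trans ?_
      · rw [graphD_adj] at hj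
        simp only [List.mem_cons, List.not_mem_nil, or_false]
        omega
      · have a1 := le2 (n - 4)
        simp only [List.map_cons, List.map_nil, List.sum_cons, List.sum_nil]
        have a2 : W (n - 2) = 1 := if_neg (by omega)
        have a3 : W (n - 1) = 1 := if_neg (by omega)
        rw [if_pos (by omega), a2, a3]
        omega
    · refine (nbrSum_le_of_mem_list hW [n - 3] fun j hj => ?_).trans ?_
      · rw [graphD_adj] at hj
        simp only [List.mem_cons, List.not_mem_nil, or_false]
        omega
      · have a1 := le2 (n - 3)
        simp only [List.map_cons, List.map_nil, List.sum_cons, List.sum_nil]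
        rw [if_neg (by omega)]
        omega
  · refine (nbrSum_le_of_mem_list hW [1] fun j hj => ?_).trans_lt ?_
    · rw [graphD_adj] at hj
      simp only [List.mem_cons, List.not_mem_nil, or_false] at hj ⊢
      have := j.2
      omega
    · have a1 := le2 1
      simp only [List.map_cons, List.map_nil, List.sum_cons, List.sum_nil]
      rw [if_pos (by omega)]
      omega

theorem superharmonic_graphExtD {n : ℕ} (hn : 4 ≤ n) :
    IsSuperharmonic (graphExtD n) (fun j => if 0 < j.val ∧ j.val + 3 ≤ n then 2 else 1) := by
  set W : ℕ → ℤ := fun a => if 0 < a ∧ a + 3 ≤ n then 2 else 1 with hWdef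
  have hW : ∀ a, 0 ≤ W a := fun a => by simp only [hWdef]; split_ifs <;> norm_num
  have le2 : ∀ a, W a ≤ 2 := fun a => by simp only [hWdef]; split_ifs <;> norm_num
  have e0 : W 0 = 1 := if_neg (by omega)
  have e1 : W (n - 2) = 1 := if_neg (by omega)
  have e2 : W (n - 1) = 1 := if_neg (by omega)
  have e3 : W n = 1 := if_neg (by omega)
  refine ⟨fun i => by dsimp only; split_ifs <;> norm_num, fun i => ?_⟩
  have := i.2
  by_cases h0 : 0 < i.val ∧ i.val + 3 ≤ n
  · by_cases h4 : n = 4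
    · subst h4
      refine (nbrSum_le_of_mem_list hW [0, 2, 3, 4] fun j hj => ?_).trans ?_
      · rw [graphExtD_adj] at hj
        simp only [List.mem_cons, List.not_mem_nil, or_false]
        omega
      · simp only [List.map_cons, List.map_nil, List.sum_cons, List.sum_nil]
        norm_num at e1 e2
        rw [if_pos h0, e0, e1, e2, e3]
        norm_num
    by_cases h1 : i.val = 1
    · refine (nbrSum_le_of_mem_list hW [0, 2, n - 1] fun j hj => ?_).trans ?_
      · rw [graphExtD_adj] at hj
        simp only [List.mem_cons, List.not_mem_nil, or_false]
        omega
      · simp only [List.map_cons, List.map_nil, List.sum_cons, List.sum_nil]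
        have a1 := le2 2
        rw [if_pos h0, e0, e2]
        omega
    by_cases h2 : i.val + 3 = n
    · refine (nbrSum_le_of_mem_list hW [n - 4, n - 2, n] fun j hj => ?_).trans ?_
      · rw [graphExtD_adj] at hj
        simp only [List.mem_cons, List.not_mem_nil, or_false]
        omega
      · simp only [List.map_cons, List.map_nil, List.sum_cons, List.sum_nil]
        have a1 := le2 (n - 4)
        rw [if_pos h0, e1, e3]
        omega
    · refine (nbrSum_le_of_mem_list hW [i.val - 1, i.val + 1] fun j hj => ?_).trans ?_
      · rw [graphExtD_adj] at hj
        simp only [List.mem_cons, List.not_mem_nil, or_false]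
        omega
      · simp only [List.map_cons, List.map_nil, List.sum_cons, List.sum_nil]
        have a1 := le2 (i.val - 1)
        have a2 := le2 (i.val + 1)
        rw [if_pos h0]
        omega
  · refine (nbrSum_le_of_mem_list hW [if i.val = 0 ∨ i.val + 1 = n then 1 else n - 3]
      fun j hj => ?_).trans ?_
    · rw [graphExtD_adj] at hj
      simp only [List.mem_cons, List.not_mem_nil, or_false]
      split_ifs <;> omega
    · simp only [List.map_cons, List.map_nil, List.sum_cons, List.sum_nil]
      have a1 := le2 (if i.val = 0 ∨ i.val + 1 = n then 1 else n - 3)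
      rw [if_neg h0]
      omega

theorem superharmonic_pathGraph {n : ℕ} (hn : 1 ≤ n) :
    IsSuperharmonic (SimpleGraph.pathGraph n) (fun _ => 1) ∧
      nbrSum (SimpleGraph.pathGraph n) (fun _ => (1 : ℤ)) ⟨0, by omega⟩ < 2 * 1 := by
  refine ⟨⟨fun _ => one_pos, fun i => ?_⟩, ?_⟩
  · refine (nbrSum_le_of_mem_list (W := fun _ => 1) (fun _ => zero_le_one)
      [i.val - 1, i.val + 1] fun j hj => ?_).trans (by simp)
    rw [SimpleGraph.pathGraph_adj] at hj
    simp only [List.mem_cons, List.not_mem_nil, or_false]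
    omega
  · refine (nbrSum_le_of_mem_list (W := fun _ => 1) (fun _ => zero_le_one)
      [1] fun j hj => ?_).trans_lt (by simp)
    rw [SimpleGraph.pathGraph_adj] at hj
    simp only [List.mem_cons, List.not_mem_nil, or_false] at hj ⊢
    omega

theorem superharmonic_cycleGraph {n : ℕ} (hn : 3 ≤ n) :
    IsSuperharmonic (SimpleGraph.cycleGraph n) (fun _ => 1) := by
  refine ⟨fun _ => one_pos, fun i => ?_⟩
  obtain ⟨m, rfl⟩ : ∃ m, n = m + 3 := ⟨n - 3, by omega⟩
  have h := SimpleGraph.cycleGraph_degree_three_le (n := m) (v := i)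
  rw [← SimpleGraph.card_neighborFinset_eq_degree] at h
  rw [nbrSum, Finset.sum_const, nsmul_eq_mul, mul_one, mul_one]
  have : #{j | (SimpleGraph.cycleGraph (m + 3)).Adj j i} = 2 := by
    rw [← h]
    congr 1
    ext j
    simp [SimpleGraph.adj_comm]
  exact_mod_cast (le_of_eq (by rw [← this]; congr))

/-- A Boolean copy of the adjacency makes the finitely many inequalities computable by `decide`. -/
theorem superharmonic_of_decide {n : ℕ} {H : SimpleGraph (Fin n)} {w : Fin n → ℤ}
    (h0 : ∀ i, 0 < w i) (r : Fin n → Fin n → Bool) (hr : ∀ i j, H.Adj j i ↔ r j i = true)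
    (h : ∀ i, (∑ j, if r j i = true then w j else 0) ≤ 2 * w i) : IsSuperharmonic H w := by
  refine ⟨h0, fun i => (le_of_eq ?_).trans (h i)⟩
  rw [nbrSum, Finset.sum_filter]
  exact Finset.sum_congr rfl fun j _ => by simp only [hr]

theorem nbrSum_lt_of_decide {n : ℕ} {H : SimpleGraph (Fin n)} {w : Fin n → ℤ}
    (r : Fin n → Fin n → Bool) (hr : ∀ i j, H.Adj j i ↔ r j i = true) {i : Fin n}
    (h : (∑ j, if r j i = true then w j else 0) < 2 * w i) : nbrSum H w i < 2 * w i := by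
  refine (le_of_eq ?_).trans_lt h
  rw [nbrSum, Finset.sum_filter]
  exact Finset.sum_congr rfl fun j _ => by simp only [hr]

/-- Adjacency in `graphBranch`, as a Boolean. -/
def branchRel (n k : ℕ) (a b : Fin n) : Bool :=
  (a.val + 1 == b.val && decide (b.val + 1 < n)) || (a.val == k && b.val + 1 == n) ||
    (b.val + 1 == a.val && decide (a.val + 1 < n)) || (b.val == k && a.val + 1 == n)

theorem graphBranch_adj_iff {n k : ℕ} (hk : k + 1 < n) (i j : Fin n) :
    (graphBranch n k).Adj j i ↔ branchRel n k j i = true := by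
  rw [graphBranch_adj, branchRel]
  simp only [Bool.or_eq_true, Bool.and_eq_true, beq_iff_eq, decide_eq_true_eq, ne_eq, Fin.ext_iff]
  omega

/-- Adjacency in `graphExtE6`, as a Boolean. -/
def extE6Rel (a b : Fin 7) : Bool :=
  (a.val + 1 == b.val && decide (b.val ≤ 4)) || (a.val == 2 && b.val == 5) ||
    (a.val == 5 && b.val == 6) || (b.val + 1 == a.val && decide (a.val ≤ 4)) ||
    (b.val == 2 && a.val == 5) || (b.val == 5 && a.val == 6)

theorem graphExtE6_adj_iff (i j : Fin 7) : graphExtE6.Adj j i ↔ extE6Rel j i = true := by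
  rw [graphExtE6_adj, extE6Rel]
  simp only [Bool.or_eq_true, Bool.and_eq_true, beq_iff_eq, decide_eq_true_eq, ne_eq, Fin.ext_iff]
  omega

theorem nbrSum_comp_iso {V V' : Type*} [Fintype V] [Fintype V'] {G : SimpleGraph V}
    {H : SimpleGraph V'} (e : G ≃g H) (w : V' → ℤ) (i : V) :
    nbrSum G (fun j => w (e j)) i = nbrSum H w (e i) := by
  rw [nbrSum, nbrSum, Finset.sum_filter, Finset.sum_filter]
  refine Fintype.sum_equiv e.toEquiv _ _ fun j => ?_
  have : H.Adj (e.toEquiv j) (e i) ↔ G.Adj j i := e.map_adj_iff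
  by_cases h : G.Adj j i
  · rw [if_pos h, if_pos (this.2 h)]; rfl
  · rw [if_neg h, if_neg (mt this.1 h)]

theorem IsSuperharmonic.comp_iso {V V' : Type*} [Fintype V] [Fintype V'] {G : SimpleGraph V}
    {H : SimpleGraph V'} (e : G ≃g H) {w : V' → ℤ} (hw : IsSuperharmonic H w) :
    IsSuperharmonic G fun j => w (e j) :=
  ⟨fun i => hw.1 (e i), fun i => (nbrSum_comp_iso e w i).le.trans (hw.2 (e i))⟩

theorem exists_strict_of_iso {V V' : Type*} [Fintype V] [Fintype V'] {G : SimpleGraph V}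
    {H : SimpleGraph V'} (h : Nonempty (G ≃g H)) (hc : H.Connected) {w : V' → ℤ}
    (hw : IsSuperharmonic H w) (v : V') (hv : nbrSum H w v < 2 * w v) :
    G.Connected ∧ ∃ w, IsSuperharmonic G w ∧ ∃ v, nbrSum G w v < 2 * w v := by
  obtain ⟨e⟩ := h
  refine ⟨e.connected_iff.2 hc, _, hw.comp_iso e, e.symm v, ?_⟩
  rw [nbrSum_comp_iso]
  simpa using hv

theorem exists_eq_one_of_iso {V V' : Type*} [Fintype V] [Fintype V'] {G : SimpleGraph V}
    {H : SimpleGraph V'} (h : Nonempty (G ≃g H)) (hc : H.Connected) {w : V' → ℤ}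
    (hw : IsSuperharmonic H w) (v : V') (hv : w v = 1) :
    G.Connected ∧ ∃ w, IsSuperharmonic G w ∧ ∃ v, w v = 1 := by
  obtain ⟨e⟩ := h
  exact ⟨e.connected_iff.2 hc, _, hw.comp_iso e, e.symm v, by simpa using hv⟩

/-- The exceptional weights restrict minimal imaginary roots of larger extended graphs, of type
`E_6` for the first and `E_8` for the other two. Strictness holds at an end of the graph that has
lost a neighbour. -/
theorem IsDynkin.exists_strict {V : Type*} [Fintype V] {G : SimpleGraph V} (h : IsDynkin G) :
    G.Connected ∧ ∃ w, IsSuperharmonic G w ∧ ∃ v, nbrSum G w v < 2 * w v := by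
  obtain ⟨n, hn, h⟩ | ⟨n, hn, h⟩ | h | h | h := h
  · obtain ⟨m, rfl⟩ : ∃ m, n = m + 1 := ⟨n - 1, by omega⟩
    exact exists_strict_of_iso h (SimpleGraph.pathGraph_connected m)
      (superharmonic_pathGraph hn).1 _ (superharmonic_pathGraph hn).2
  · exact exists_strict_of_iso h (graphD_connected hn) (superharmonic_graphD hn).1 _
      (superharmonic_graphD hn).2
  · exact exists_strict_of_iso h (graphBranch_connected (by norm_num))
      (w := ![1, 2, 3, 2, 1, 2])
      (superharmonic_of_decide (by decide) _ (graphBranch_adj_iff (by norm_num)) (by decide)) 5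
      (nbrSum_lt_of_decide _ (graphBranch_adj_iff (by norm_num)) (by decide))
  · exact exists_strict_of_iso h (graphBranch_connected (by norm_num))
      (w := ![2, 4, 6, 5, 4, 3, 3])
      (superharmonic_of_decide (by decide) _ (graphBranch_adj_iff (by norm_num)) (by decide)) 5
      (nbrSum_lt_of_decide _ (graphBranch_adj_iff (by norm_num)) (by decide))
  · exact exists_strict_of_iso h (graphBranch_connected (by norm_num))
      (w := ![2, 4, 6, 5, 4, 3, 2, 3])
      (superharmonic_of_decide (by decide) _ (graphBranch_adj_iff (by norm_num)) (by decide)) 6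
      (nbrSum_lt_of_decide _ (graphBranch_adj_iff (by norm_num)) (by decide))

/-- Only inequalities are checked here; that these weights are harmonic and equal to `δ` follows
later from the existence of an imaginary root. -/
theorem IsExtendedDynkin.exists_eq_one {V : Type*} [Fintype V] {G : SimpleGraph V}
    (h : IsExtendedDynkin G) : G.Connected ∧ ∃ w, IsSuperharmonic G w ∧ ∃ v, w v = 1 := by
  obtain ⟨n, hn, h⟩ | ⟨n, hn, h⟩ | h | h | h := h
  · obtain ⟨m, rfl⟩ : ∃ m, n = m + 1 := ⟨n - 1, by omega⟩
    exact exists_eq_one_of_iso h SimpleGraph.cycleGraph_connected (superharmonic_cycleGraph hn)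
      0 rfl
  · exact exists_eq_one_of_iso h (graphExtD_connected hn) (superharmonic_graphExtD hn) 0
      (if_neg (by simp))
  · exact exists_eq_one_of_iso h graphExtE6_connected (w := ![1, 2, 3, 2, 1, 2, 1])
      (superharmonic_of_decide (by decide) _ graphExtE6_adj_iff (by decide)) 0 rfl
  · exact exists_eq_one_of_iso h (graphBranch_connected (by norm_num))
      (w := ![1, 2, 3, 4, 3, 2, 1, 2])
      (superharmonic_of_decide (by decide) _ (graphBranch_adj_iff (by norm_num)) (by decide)) 0 rfl
  · exact exists_eq_one_of_iso h (graphBranch_connected (by norm_num))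
      (w := ![2, 4, 6, 5, 4, 3, 2, 1, 3])
      (superharmonic_of_decide (by decide) _ (graphBranch_adj_iff (by norm_num)) (by decide)) 7 rfl

end DynkinGraphs
end Orthoscalar

namespace Orthoscalar

/-! ### Translation between Hilbert space representations and matrices. -/

section HilbertRepresentations

open Finset Matrix
open scoped Classical InnerProductSpace
set_option linter.unusedSectionVars false

variable {V : Type u} [Fintype V] [Quiver.{v + 1} V] [∀ j i : V, Fintype (j ⟶ i)] {n : V → ℕ}

/-- The matrix, in orthonormal bases, of the arrows from `j` to `i` and of the adjoints of the
arrows from `i` to `j`. -/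
noncomputable def repMatrix (T : HilbertRep.{u, v, w} V)
    (b : ∀ i, OrthonormalBasis (Fin (n i)) ℂ (T.space i)) (i j : V) :
    Matrix (Fin (n i)) (Fin (n j)) ℂ :=
  ∑ a : (j ⟶ i), LinearMap.toMatrix (b j).toBasis (b i).toBasis (T.map a) +
    ∑ a : (i ⟶ j), (LinearMap.toMatrix (b i).toBasis (b j).toBasis (T.map a))ᴴ

variable {ev : Set V} {T : HilbertRep.{u, v, w} V}
  {b : ∀ i, OrthonormalBasis (Fin (n i)) ℂ (T.space i)}

theorem quiverGraph_adj {i j : V} :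
    (quiverGraph V).Adj i j ↔ i ≠ j ∧ (Nonempty (i ⟶ j) ∨ Nonempty (j ⟶ i)) := Iff.rfl

theorem IsSeparated.isEmpty_symm (hsep : IsSeparated ev) {i j : V} (a : j ⟶ i) :
    IsEmpty (i ⟶ j) :=
  ⟨fun a' => (hsep _ _ a').2 (hsep _ _ a).1⟩

theorem IsSeparated.adj (hsep : IsSeparated ev) {i j : V} (a : j ⟶ i) :
    (quiverGraph V).Adj i j := by
  refine quiverGraph_adj.2 ⟨?_, Or.inr ⟨a⟩⟩
  rintro rfl
  exact (hsep _ _ a).2 (hsep _ _ a).1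

theorem IsSeparated.isSide (hsep : IsSeparated ev) : IsSide (quiverGraph V) ev := by
  rintro i j ⟨-, ⟨⟨a⟩⟩ | ⟨⟨a⟩⟩⟩
  · exact iff_of_true (hsep _ _ a).1 (hsep _ _ a).2
  · exact iff_of_false (hsep _ _ a).2 (not_not.2 (hsep _ _ a).1)

theorem repMatrix_of_arrow (hsep : IsSeparated ev) (hthin : Quiver.IsThin V) {i j : V}
    (a : j ⟶ i) :
    repMatrix T b i j = LinearMap.toMatrix (b j).toBasis (b i).toBasis (T.map a) := by
  have := hsep.isEmpty_symm a
  have := hthin j i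
  rw [repMatrix, Fintype.sum_subsingleton _ a, Fintype.sum_empty, add_zero]

theorem repMatrix_conjTranspose (i j : V) : (repMatrix T b i j)ᴴ = repMatrix T b j i := by
  simp only [repMatrix, Matrix.conjTranspose_add, Matrix.conjTranspose_sum,
    Matrix.conjTranspose_conjTranspose]
  rw [add_comm]

theorem isGraphRep_repMatrix (hsep : IsSeparated ev) :
    IsGraphRep (quiverGraph V) (repMatrix T b) := by
  refine ⟨fun i j hij => ?_, repMatrix_conjTranspose⟩
  have h1 : IsEmpty (j ⟶ i) := ⟨fun a => hij (hsep.adj a)⟩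
  have h2 : IsEmpty (i ⟶ j) := ⟨fun a => hij (hsep.adj a).symm⟩
  rw [repMatrix, Fintype.sum_empty, Fintype.sum_empty, add_zero]

theorem repMatrix_mul_of_odd (hsep : IsSeparated ev) (hthin : Quiver.IsThin V) {i : V}
    (hi : i ∉ ev) (j : V) :
    repMatrix T b i j * repMatrix T b j i = LinearMap.toMatrix (b i).toBasis (b i).toBasis
      (∑ a : (j ⟶ i), T.map a ∘ₗ LinearMap.adjoint (T.map a)) := by
  by_cases h : Nonempty (j ⟶ i)
  · obtain ⟨a⟩ := h
    have := hthin j i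
    rw [← repMatrix_conjTranspose i j, repMatrix_of_arrow hsep hthin a,
      ← LinearMap.toMatrix_adjoint, ← LinearMap.toMatrix_comp, Fintype.sum_subsingleton _ a]
  · have h1 := not_nonempty_iff.1 h
    have h2 : IsEmpty (i ⟶ j) := ⟨fun a => hi (hsep _ _ a).1⟩
    rw [repMatrix, Fintype.sum_empty, Fintype.sum_empty, Fintype.sum_empty, add_zero,
      Matrix.zero_mul, map_zero]

theorem repMatrix_mul_of_even (hsep : IsSeparated ev) (hthin : Quiver.IsThin V) {j : V}
    (hj : j ∈ ev) (i : V) :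
    repMatrix T b j i * repMatrix T b i j = LinearMap.toMatrix (b j).toBasis (b j).toBasis
      (∑ a : (j ⟶ i), LinearMap.adjoint (T.map a) ∘ₗ T.map a) := by
  by_cases h : Nonempty (j ⟶ i)
  · obtain ⟨a⟩ := h
    have := hthin j i
    rw [← repMatrix_conjTranspose i j, repMatrix_of_arrow hsep hthin a,
      ← LinearMap.toMatrix_adjoint, ← LinearMap.toMatrix_comp, Fintype.sum_subsingleton _ a]
  · have h1 := not_nonempty_iff.1 h
    have h2 : IsEmpty (i ⟶ j) := ⟨fun a => (hsep _ _ a).2 hj⟩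
    rw [repMatrix, Fintype.sum_empty, Fintype.sum_empty, Fintype.sum_empty, add_zero,
      Matrix.zero_mul, map_zero]

theorem hasCharacter_iff (hsep : IsSeparated ev) (hthin : Quiver.IsThin V) {χ : V → ℝ} :
    T.HasCharacter ev χ ↔ (∀ i, 0 ≤ χ i) ∧ HasScalar (repMatrix T b) χ := by
  have key : ∀ i (f : T.space i →ₗ[ℂ] T.space i), f = (χ i : ℂ) • LinearMap.id ↔
      LinearMap.toMatrix (b i).toBasis (b i).toBasis f = (χ i : ℂ) • 1 := fun i f => by
    rw [← LinearMap.toMatrix_id (b i).toBasis, ← map_smul, EmbeddingLike.apply_eq_iff_eq]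
  have h1 : ∀ i, i ∉ ev → ((∑ j, ∑ a : (j ⟶ i), T.map a ∘ₗ LinearMap.adjoint (T.map a) =
      (χ i : ℂ) • LinearMap.id) ↔
      ∑ j, repMatrix T b i j * repMatrix T b j i = (χ i : ℂ) • 1) := fun i hi => by
    rw [key, map_sum]
    simp only [repMatrix_mul_of_odd hsep hthin hi]
  have h2 : ∀ i, i ∈ ev → ((∑ j, ∑ a : (i ⟶ j), LinearMap.adjoint (T.map a) ∘ₗ T.map a =
      (χ i : ℂ) • LinearMap.id) ↔
      ∑ j, repMatrix T b i j * repMatrix T b j i = (χ i : ℂ) • 1) := fun i hi => by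
    rw [key, map_sum]
    simp only [repMatrix_mul_of_even hsep hthin hi]
  refine and_congr_right fun _ => ⟨fun h i => ?_, fun h => ⟨fun i hi => (h1 i hi).2 (h i),
    fun i hi => (h2 i hi).2 (h i)⟩⟩
  by_cases hi : i ∈ ev
  · exact (h2 i hi).1 (h.2 i hi)
  · exact (h1 i hi).1 (h.1 i hi)

theorem nontrivial_space_iff (b : ∀ i, OrthonormalBasis (Fin (n i)) ℂ (T.space i)) (i : V) :
    Nontrivial (T.space i) ↔ n i ≠ 0 := by
  rw [← Module.finrank_pos_iff (R := ℂ), Module.finrank_eq_card_basis (b i).toBasis,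
    Fintype.card_fin, Nat.pos_iff_ne_zero]

/-- A commuting family intertwines the maps and their adjoints, so its eigenspaces for one
eigenvalue and their orthogonal complements are both subrepresentations; indecomposability makes the
eigenspaces everything. -/
theorem isIrred_of_isIndecomposable (hsep : IsSeparated ev) (hthin : Quiver.IsThin V)
    (hT : T.IsIndecomposable) : IsIrred (repMatrix T b) := by
  obtain ⟨⟨i₀, hi₀⟩, hT⟩ := hT
  refine ⟨⟨i₀, (nontrivial_space_iff b i₀).1 hi₀⟩, fun f hf => ?_⟩
  set F : ∀ i, T.space i →ₗ[ℂ] T.space i := fun i =>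
    Matrix.toLin (b i).toBasis (b i).toBasis (f i) with hF
  have hFm : ∀ i, LinearMap.toMatrix (b i).toBasis (b i).toBasis (F i) = f i := fun i =>
    LinearMap.toMatrix_toLin _ _ _
  have h1 : ∀ {j i : V} (a : j ⟶ i), F i ∘ₗ T.map a = T.map a ∘ₗ F j := fun {j i} a => by
    apply (LinearMap.toMatrix (b j).toBasis (b i).toBasis).injective
    rw [LinearMap.toMatrix_comp _ (b i).toBasis, LinearMap.toMatrix_comp _ (b j).toBasis, hFm, hFm,
      ← repMatrix_of_arrow hsep hthin a, hf]
  have h2 : ∀ {j i : V} (a : j ⟶ i),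
      F j ∘ₗ LinearMap.adjoint (T.map a) = LinearMap.adjoint (T.map a) ∘ₗ F i := fun {j i} a => by
    apply (LinearMap.toMatrix (b i).toBasis (b j).toBasis).injective
    rw [LinearMap.toMatrix_comp _ (b j).toBasis, LinearMap.toMatrix_comp _ (b i).toBasis, hFm, hFm,
      LinearMap.toMatrix_adjoint, ← repMatrix_of_arrow hsep hthin a, repMatrix_conjTranspose, hf]
  obtain ⟨c, hc⟩ := Module.End.exists_eigenvalue (F i₀)
  refine ⟨c, ?_⟩
  refine (hT (fun i => Module.End.eigenspace (F i) c) (fun j i a x hx => ?_)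
    (fun j i a x hx => ?_)).elim (fun h => absurd (h i₀) hc) fun h i => ?_
  · rw [Module.End.mem_eigenspace_iff] at hx ⊢
    rw [← LinearMap.comp_apply, h1, LinearMap.comp_apply, hx, map_smul]
  · rw [Submodule.mem_orthogonal] at hx ⊢
    intro y hy
    rw [← LinearMap.adjoint_inner_left]
    refine hx _ ?_
    rw [Module.End.mem_eigenspace_iff] at hy ⊢
    rw [← LinearMap.comp_apply, h2, LinearMap.comp_apply, hy, map_smul]
  · rw [← hFm i]
    have : F i = c • LinearMap.id := by
      ext x
      have hx : x ∈ Module.End.eigenspace (F i) c := by rw [h i]; trivial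
      exact Module.End.mem_eigenspace_iff.1 hx
    rw [this, map_smul, LinearMap.toMatrix_id]

/-- The orthogonal projections onto a direct summand form a commuting family. A scalar projection is
0 or 1, with the same scalar at all vertices. -/
theorem isIndecomposable_of_isIrred (hsep : IsSeparated ev) (hthin : Quiver.IsThin V)
    (hA : IsIrred (repMatrix T b)) : T.IsIndecomposable := by
  obtain ⟨⟨i₀, hi₀⟩, hA⟩ := hA
  refine ⟨⟨i₀, (nontrivial_space_iff b i₀).2 hi₀⟩, fun W hW hW' => ?_⟩
  set P : ∀ i, T.space i →ₗ[ℂ] T.space i := fun i => ((W i).starProjection).toLinearMap with hP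
  set f := fun i => LinearMap.toMatrix (b i).toBasis (b i).toBasis (P i) with hf
  have hPT : ∀ {j i : V} (a : j ⟶ i), P i ∘ₗ T.map a = T.map a ∘ₗ P j := fun {j i} a => by
    ext x
    refine Submodule.eq_starProjection_of_mem_orthogonal (hW j i a _ ?_) ?_
    · exact Submodule.starProjection_apply_mem _ _
    · rw [LinearMap.comp_apply, ← map_sub]
      exact hW' j i a _ (Submodule.sub_starProjection_mem_orthogonal _)
  have hfs : ∀ i, (f i)ᴴ = f i := fun i => by
    rw [hf]
    simp only
    rw [← LinearMap.toMatrix_adjoint]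
    congr 1
    symm
    rw [LinearMap.eq_adjoint_iff]
    exact fun x y => Submodule.inner_starProjection_left_eq_right _ x y
  have hfA : ∀ {j i : V} (a : j ⟶ i), f i * repMatrix T b i j = repMatrix T b i j * f j :=
    fun {j i} a => by
      rw [repMatrix_of_arrow hsep hthin a, ← LinearMap.toMatrix_comp, ← LinearMap.toMatrix_comp,
        hPT]
  obtain ⟨c, hc⟩ := hA f fun i j => by
    by_cases h1 : Nonempty (j ⟶ i)
    · exact hfA h1.some
    by_cases h2 : Nonempty (i ⟶ j)
    · have := congrArg Matrix.conjTranspose (hfA h2.some)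
      rw [Matrix.conjTranspose_mul, Matrix.conjTranspose_mul, repMatrix_conjTranspose, hfs,
        hfs] at this
      exact this.symm
    · rw [(isGraphRep_repMatrix hsep).zero i j fun h => h.2.elim h2 h1, Matrix.zero_mul,
        Matrix.mul_zero]
  have hPc : ∀ i x, P i x = c • x := fun i x => by
    have : P i = c • LinearMap.id := by
      apply (LinearMap.toMatrix (b i).toBasis (b i).toBasis).injective
      rw [map_smul, LinearMap.toMatrix_id]
      exact hc i
    rw [this]; rfl
  by_cases hbot : ∀ i, W i = ⊥
  · exact Or.inl hbot
  right
  push Not at hbot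
  obtain ⟨k, hk⟩ := hbot
  obtain ⟨x, hx, hx0⟩ := Submodule.exists_mem_ne_zero_of_ne_bot hk
  have hc1 : c = 1 := by
    have h1 := hPc k x
    have h2 : P k x = x := Submodule.starProjection_eq_self_iff.2 hx
    rw [h2] at h1
    have : (c - 1) • x = 0 := by rw [sub_smul, ← h1, one_smul, sub_self]
    exact sub_eq_zero.1 ((smul_eq_zero.1 this).resolve_right hx0)
  intro i
  rw [Submodule.eq_top_iff']
  intro y
  have := hPc i y
  rw [hc1, one_smul] at this
  exact Submodule.starProjection_eq_self_iff.1 this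

theorem exists_repMatrix_eq (hsep : IsSeparated ev) (hthin : Quiver.IsThin V)
    {A : ∀ i j, Matrix (Fin (n i)) (Fin (n j)) ℂ} (hA : IsGraphRep (quiverGraph V) A) :
    ∃ (T : HilbertRep.{u, v, w} V) (b : ∀ i, OrthonormalBasis (Fin (n i)) ℂ (T.space i)),
      repMatrix T b = A := by
  let b : ∀ i, OrthonormalBasis (Fin (n i)) ℂ (EuclideanSpace ℂ (ULift.{w} (Fin (n i)))) :=
    fun i => (EuclideanSpace.basisFun _ ℂ).reindex Equiv.ulift
  let T : HilbertRep.{u, v, w} V :=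
    { space := fun i => EuclideanSpace ℂ (ULift.{w} (Fin (n i)))
      map := fun {j i} _ => Matrix.toLin (b j).toBasis (b i).toBasis (A i j) }
  have key : ∀ {j i : V} (a : j ⟶ i), repMatrix T b i j = A i j := fun {j i} a =>
    (repMatrix_of_arrow (T := T) (b := b) hsep hthin a).trans (LinearMap.toMatrix_toLin _ _ _)
  refine ⟨T, b, ?_⟩
  funext i j
  by_cases h1 : Nonempty (j ⟶ i)
  · exact key h1.some
  by_cases h2 : Nonempty (i ⟶ j)
  · rw [← repMatrix_conjTranspose, key h2.some, hA.conj]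
  · have h : ¬ (quiverGraph V).Adj i j := fun h => h.2.elim h2 h1
    rw [hA.zero i j h, (isGraphRep_repMatrix hsep).zero i j h]

theorem unitarilyEquivalent_of_unitary (hsep : IsSeparated ev) (hthin : Quiver.IsThin V)
    {T' : HilbertRep.{u, v, w} V} {b' : ∀ i, OrthonormalBasis (Fin (n i)) ℂ (T'.space i)}
    {U : ∀ i, Matrix (Fin (n i)) (Fin (n i)) ℂ} (hU : ∀ i, (U i)ᴴ * U i = 1)
    (hUT : ∀ i j, U i * repMatrix T b i j = repMatrix T' b' i j * U j) :
    T.UnitarilyEquivalent T' := by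
  set F : ∀ i, T.space i →ₗ[ℂ] T'.space i := fun i =>
    Matrix.toLin (b i).toBasis (b' i).toBasis (U i) with hF
  have hFm : ∀ i, LinearMap.toMatrix (b i).toBasis (b' i).toBasis (F i) = U i := fun i =>
    LinearMap.toMatrix_toLin _ _ _
  have hadj : ∀ i, LinearMap.adjoint (F i) ∘ₗ F i = LinearMap.id := fun i => by
    apply (LinearMap.toMatrix (b i).toBasis (b i).toBasis).injective
    rw [LinearMap.toMatrix_comp _ (b' i).toBasis, LinearMap.toMatrix_adjoint, hFm, hU,
      LinearMap.toMatrix_id]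
  have hinner : ∀ i x y, ⟪F i x, F i y⟫_ℂ = ⟪x, y⟫_ℂ := fun i x y => by
    rw [← LinearMap.adjoint_inner_right, ← LinearMap.comp_apply, hadj, LinearMap.id_apply]
  have hrank : ∀ i, Module.finrank ℂ (T.space i) = Module.finrank ℂ (T'.space i) := fun i => by
    rw [Module.finrank_eq_card_basis (b i).toBasis, Module.finrank_eq_card_basis (b' i).toBasis]
  refine ⟨fun i => ((F i).isometryOfInner (hinner i)).toLinearIsometryEquiv (hrank i),
    fun j i a x => ?_⟩
  have : F i ∘ₗ T.map a = T'.map a ∘ₗ F j := by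
    apply (LinearMap.toMatrix (b j).toBasis (b' i).toBasis).injective
    rw [LinearMap.toMatrix_comp _ (b i).toBasis, LinearMap.toMatrix_comp _ (b' j).toBasis, hFm, hFm,
      ← repMatrix_of_arrow hsep hthin a, ← repMatrix_of_arrow hsep hthin a, hUT]
  exact LinearMap.congr_fun this x

/-- Carrying the bases along the unitaries leaves the matrices unchanged, so equivalent
representations have the same character. -/
theorem HilbertRep.UnitarilyEquivalent.exists_repMatrix_eq {T' : HilbertRep.{u, v, w} V}
    (h : T.UnitarilyEquivalent T') (b : ∀ i, OrthonormalBasis (Fin (n i)) ℂ (T.space i)) :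
    ∃ b' : ∀ i, OrthonormalBasis (Fin (n i)) ℂ (T'.space i), repMatrix T' b' = repMatrix T b := by
  obtain ⟨U, hU⟩ := h
  have key : ∀ {j i : V} (a : j ⟶ i),
      LinearMap.toMatrix ((b j).map (U j)).toBasis ((b i).map (U i)).toBasis (T'.map a) =
        LinearMap.toMatrix (b j).toBasis (b i).toBasis (T.map a) := fun {j i} a => by
    ext r s
    simp only [LinearMap.toMatrix_apply, OrthonormalBasis.coe_toBasis,
      OrthonormalBasis.coe_toBasis_repr_apply, OrthonormalBasis.repr_apply_apply,
      OrthonormalBasis.map_apply]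
    rw [← hU, LinearIsometryEquiv.inner_map_map]
  refine ⟨fun i => (b i).map (U i), ?_⟩
  funext i j
  simp only [repMatrix, key]

theorem HasScalar.eq {A : ∀ i j, Matrix (Fin (n i)) (Fin (n j)) ℂ} {χ ψ : V → ℝ}
    (hn : ∀ i, n i ≠ 0) (hχ : HasScalar A χ) (hψ : HasScalar A ψ) : χ = ψ := by
  funext i
  have h := (hχ i).symm.trans (hψ i)
  have h0 := congrFun (congrFun h ⟨0, Nat.pos_of_ne_zero (hn i)⟩) ⟨0, Nat.pos_of_ne_zero (hn i)⟩
  simpa using h0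

theorem exists_orthonormalBasis (hT : T.dim = fun i => (n i : ℤ)) :
    Nonempty (∀ i, OrthonormalBasis (Fin (n i)) ℂ (T.space i)) := by
  refine ⟨fun i => (stdOrthonormalBasis ℂ (T.space i)).reindex (finCongr ?_)⟩
  have : (Module.finrank ℂ (T.space i) : ℤ) = n i := congrFun hT i
  exact_mod_cast this

theorem dim_eq_of_basis (b : ∀ i, OrthonormalBasis (Fin (n i)) ℂ (T.space i)) :
    T.dim = fun i => (n i : ℤ) := by
  funext i
  rw [HilbertRep.dim, Module.finrank_eq_card_basis (b i).toBasis, Fintype.card_fin]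

theorem realizes_of_isIndecomposable (hsep : IsSeparated ev) (hthin : Quiver.IsThin V)
    (hT : T.IsIndecomposable) (hd : T.dim = fun i => (n i : ℤ)) {χ : V → ℝ}
    (hχ : T.HasCharacter ev χ) : Realizes (quiverGraph V) n χ := by
  obtain ⟨b⟩ := exists_orthonormalBasis hd
  exact ⟨repMatrix T b, isGraphRep_repMatrix hsep, ((hasCharacter_iff hsep hthin).1 hχ).2,
    isIrred_of_isIndecomposable hsep hthin hT⟩

theorem exists_rep_of_realizes (hsep : IsSeparated ev) (hthin : Quiver.IsThin V)
    (hn : ∀ i, n i ≠ 0) {χ : V → ℝ} (h : Realizes (quiverGraph V) n χ) :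
    ∃ T : HilbertRep.{u, v, w} V, T.IsIndecomposable ∧ T.dim = (fun i => (n i : ℤ)) ∧
      T.HasCharacter ev χ := by
  obtain ⟨A, hA, hχ, hirr⟩ := h
  obtain ⟨T, b, rfl⟩ := exists_repMatrix_eq.{u, v, w} hsep hthin hA
  exact ⟨T, isIndecomposable_of_isIrred hsep hthin hirr, dim_eq_of_basis b,
    (hasCharacter_iff hsep hthin).2 ⟨fun i => scalar_nonneg hA hχ (hn i), hχ⟩⟩

theorem unitarilyEquivalent_of_hasCharacter (hsep : IsSeparated ev) (hthin : Quiver.IsThin V)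
    (hq : 0 < form (quiverGraph V) ev fun i => (n i : ℤ)) {T' : HilbertRep.{u, v, w} V}
    (hT : T.IsIndecomposable) (hd : T.dim = fun i => (n i : ℤ))
    (hd' : T'.dim = fun i => (n i : ℤ)) {χ : V → ℝ} (hχ : T.HasCharacter ev χ)
    (hχ' : T'.HasCharacter ev χ) : T.UnitarilyEquivalent T' := by
  obtain ⟨b⟩ := exists_orthonormalBasis hd
  obtain ⟨b'⟩ := exists_orthonormalBasis hd'
  obtain ⟨U, hU, hUT⟩ := exists_unitary hsep.isSide (isGraphRep_repMatrix (b := b) hsep)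
    (isGraphRep_repMatrix (b := b') hsep) ((hasCharacter_iff hsep hthin).1 hχ).2
    ((hasCharacter_iff hsep hthin).1 hχ').2 (isIrred_of_isIndecomposable hsep hthin hT) hq
  exact unitarilyEquivalent_of_unitary hsep hthin hU hUT

theorem HilbertRep.UnitarilyEquivalent.character_eq (hsep : IsSeparated ev)
    (hthin : Quiver.IsThin V) (hn : ∀ i, n i ≠ 0) {T' : HilbertRep.{u, v, w} V}
    (h : T.UnitarilyEquivalent T') (hd : T.dim = fun i => (n i : ℤ)) {χ χ' : V → ℝ}
    (hχ : T.HasCharacter ev χ) (hχ' : T'.HasCharacter ev χ') : χ = χ' := by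
  obtain ⟨b⟩ := exists_orthonormalBasis hd
  obtain ⟨b', hb'⟩ := h.exists_repMatrix_eq b
  have h2 := ((hasCharacter_iff (b := b') hsep hthin).1 hχ').2
  rw [hb'] at h2
  exact ((hasCharacter_iff hsep hthin).1 hχ).2.eq hn h2

theorem HasCone.dependOnPositiveParameters (hsep : IsSeparated ev) (hthin : Quiver.IsThin V)
    (hn : ∀ i, n i ≠ 0) (hq : 0 < form (quiverGraph V) ev fun i => (n i : ℤ))
    (h : HasCone (quiverGraph V) n) :
    DependOnPositiveParameters.{u, v, w} ev (fun i => (n i : ℤ)) (Fintype.card V - 1) := by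
  obtain ⟨ι, hι, L, hL, hcard, -, hR⟩ := h
  have hcard : Fintype.card ι = Fintype.card V - 1 := by
    rw [Finset.filter_true_of_mem fun i _ => hn i, Finset.card_univ] at hcard
    omega
  have hR : ∀ χ, Realizes (quiverGraph V) n χ ↔ ∃ p : ι → ℝ, (∀ s, 0 < p s) ∧ L p = χ := fun χ =>
    hR χ fun i hi => absurd hi (hn i)
  let e : ι ≃ Fin (Fintype.card V - 1) := Fintype.equivFinOfCardEq hcard
  let L' : (Fin (Fintype.card V - 1) → ℝ) →ₗ[ℝ] (V → ℝ) := L ∘ₗ LinearMap.funLeft ℝ ℝ e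
  have hL' : Function.Injective L' :=
    hL.comp (LinearMap.funLeft_injective_of_surjective ℝ ℝ e e.surjective)
  have hF : ∀ p : {p : Fin (Fintype.card V - 1) → ℝ // ∀ s, 0 < p s},
      ∃ T : HilbertRep.{u, v, w} V, T.IsIndecomposable ∧ T.dim = (fun i => (n i : ℤ)) ∧
        T.HasCharacter ev (L' p.1) := fun p =>
    exists_rep_of_realizes hsep hthin hn ((hR _).2 ⟨_, fun s => p.2 (e s), rfl⟩)
  choose F hF using hF
  refine ⟨F, L', hL', hF, fun T hT hd ⟨χ, hχ⟩ => ?_⟩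
  obtain ⟨p, hp, rfl⟩ := (hR χ).1 (realizes_of_isIndecomposable hsep hthin hT hd hχ)
  have hp' : L' (fun s => p (e.symm s)) = L p := by
    show L _ = L p
    congr 1
    funext s
    simp [LinearMap.funLeft_apply]
  refine ⟨⟨fun s => p (e.symm s), fun s => hp _⟩, ?_, fun q hq' => ?_⟩
  · refine unitarilyEquivalent_of_hasCharacter hsep hthin hq hT hd (hF _).2.1 hχ ?_
    rw [← hp']
    exact (hF _).2.2
  · have := hq'.character_eq hsep hthin hn hd hχ (hF q).2.2
    rw [← hp'] at this
    exact Subtype.ext (hL' this.symm)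

end HilbertRepresentations
end Orthoscalar

namespace Orthoscalar

/-! ### Regular vectors and imaginary roots of the quiver. -/

section RootsOfQuivers

open Finset
open scoped Classical
set_option linter.unusedSectionVars false

variable {V : Type u} [Fintype V] [Quiver.{v + 1} V] {ev : Set V}

theorem reflection_eq_refl (S : Set V) : reflection S = refl (R := ℤ) (quiverGraph V) S := by
  funext x i
  by_cases hi : i ∈ S
  · rw [refl_of_mem x hi, reflection, if_pos hi, nbrSum]
  · rw [refl_of_notMem x hi, reflection, if_neg hi]

/-- Regularity is restated for every single half-step of the Coxeter transformation, the form in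
which the reflection functor is applied. -/
theorem isRegularVector_iff {x : V → ℤ} : IsRegularVector ev x ↔
    (∀ t, 0 ≤ alternate (quiverGraph V) t evᶜ x) ∧ ∀ t, 0 ≤ alternate (quiverGraph V) t ev x := by
  have h1 : ∀ t, (reflection ev ∘ reflection evᶜ)^[t] x =
      alternate (quiverGraph V) (2 * t) evᶜ x := fun t => by
    rw [alternate_two_mul, compl_compl, reflection_eq_refl, reflection_eq_refl]
  have h2 : ∀ t, (reflection evᶜ ∘ reflection ev)^[t] x =
      alternate (quiverGraph V) (2 * t) ev x := fun t => by
    rw [alternate_two_mul, reflection_eq_refl, reflection_eq_refl]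
  simp only [IsRegularVector, h1, h2]
  exact ⟨fun h => ⟨alternate_nonneg_of_even fun t => (h t).1,
    alternate_nonneg_of_even fun t => (h t).2⟩, fun h t => ⟨h.1 _, h.2 _⟩⟩

variable [∀ j i : V, Fintype (j ⟶ i)]

theorem titsForm_eq_form (hsep : IsSeparated ev) (hthin : Quiver.IsThin V) (x : V → ℤ) :
    titsForm x = form (quiverGraph V) ev x := by
  rw [titsForm, form, Finset.sum_filter]
  congr 1
  refine Finset.sum_congr rfl fun j _ => ?_
  split_ifs with hj
  · rw [nbrSum, Finset.sum_filter, Finset.mul_sum]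
    refine Finset.sum_congr rfl fun i _ => ?_
    by_cases h : Nonempty (j ⟶ i)
    · obtain ⟨a⟩ := h
      have := hthin j i
      rw [Fintype.sum_subsingleton _ a, if_pos (hsep.adj a)]
    · have h1 := not_nonempty_iff.1 h
      rw [Fintype.sum_empty, if_neg, mul_zero]
      exact fun hij => hij.2.elim (fun ⟨a⟩ => (hsep _ _ a).2 hj) h
  · refine Finset.sum_eq_zero fun i _ => ?_
    have : IsEmpty (j ⟶ i) := ⟨fun a => hj (hsep _ _ a).1⟩
    exact Fintype.sum_empty _

theorem exists_natCast_eq {d : V → ℤ} (h : ∀ i, 0 < d i) :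
    ∃ n : V → ℕ, (∀ i, n i ≠ 0) ∧ d = fun i => (n i : ℤ) :=
  ⟨fun i => (d i).toNat, fun i => ne_of_gt (Int.lt_toNat.2 (h i)),
    funext fun i => (Int.toNat_of_nonneg (h i).le).symm⟩

/-- A superharmonic vector with an entry `1` is the minimal imaginary root, if there is one. -/
theorem eq_of_isLeast_isImaginaryRoot (hsep : IsSeparated ev) (hthin : Quiver.IsThin V)
    (hconn : (quiverGraph V).Connected) {w δ : V → ℤ} (hw : IsSuperharmonic (quiverGraph V) w)
    {v : V} (hv : w v = 1) (hδ : IsLeast {x : V → ℤ | IsImaginaryRoot x} δ) :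
    δ = w ∧ ∀ i, nbrSum (quiverGraph V) w i = 2 * w i := by
  obtain ⟨⟨hδ0, hδ1, hδ2⟩, hmin⟩ := hδ
  rw [titsForm_eq_form hsep hthin] at hδ2
  obtain ⟨h1, h2⟩ := eq_of_form_eq_zero hconn hsep.isSide hw hδ2
  have hδv : ∀ i, δ i = δ v * w i := fun i => by
    have := h1 i v
    rwa [hv, mul_one] at this
  have hv0 : δ v ≠ 0 := fun h => hδ0 (funext fun i => by rw [hδv, h, zero_mul]; rfl)
  have hharm : ∀ i, nbrSum (quiverGraph V) w i = 2 * w i := fun i =>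
    h2 i (by rw [hδv]; exact mul_ne_zero hv0 (hw.1 i).ne')
  refine ⟨?_, hharm⟩
  have hw1 : IsImaginaryRoot w := by
    refine ⟨fun h => ?_, fun i => (hw.1 i).le, ?_⟩
    · rw [h] at hv; exact zero_ne_one hv
    · rw [titsForm_eq_form hsep hthin]
      have := two_mul_form hsep.isSide w
      simp only [hharm, sub_self, mul_zero, Finset.sum_const_zero] at this
      omega
  -- The weights are themselves an imaginary root with entry 1 at `v`, so minimality of `δ` leaves
  -- the multiple 1.
  have h3 : δ v ≤ 1 := hv ▸ hmin hw1 v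
  have h4 : 0 ≤ δ v := hδ1 v
  have h5 : δ v = 1 := by omega
  funext i
  rw [hδv, h5, one_mul]

end RootsOfQuivers
end Orthoscalar

/-! ### The theorem. -/

open Orthoscalar in
theorem theorem2 {V : Type u} [Fintype V] [Quiver.{v + 1} V] [∀ j i : V, Fintype (j ⟶ i)]
    (ev : Set V) (hsep : Orthoscalar.IsSeparated ev) (hthin : Quiver.IsThin V)
    (d : V → ℤ) (hreal : Orthoscalar.IsRealRoot d) (hexact : ∀ i, 0 < d i) :
    (Orthoscalar.IsDynkin (Orthoscalar.quiverGraph V) →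
      Orthoscalar.DependOnPositiveParameters.{u, v, w} ev d (Fintype.card V - 1)) ∧
    (Orthoscalar.IsExtendedDynkin (Orthoscalar.quiverGraph V) →
      ∀ δ : V → ℤ, IsLeast {x : V → ℤ | Orthoscalar.IsImaginaryRoot x} δ →
        (¬ Orthoscalar.IsRegularVector ev d ∨ d < δ →
          Orthoscalar.DependOnPositiveParameters.{u, v, w} ev d (Fintype.card V - 1)) ∧
        (Orthoscalar.IsRegularVector ev d → ¬ d < δ →
          ∀ T : Orthoscalar.HilbertRep.{u, v, w} V, T.IsIndecomposable → T.dim = d →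
            ¬ T.IsOrthoscalar ev)) := by
  obtain ⟨n, hn, rfl⟩ := exists_natCast_eq hexact
  have hO := hsep.isSide
  have hq : form (quiverGraph V) ev (fun i => (n i : ℤ)) = 1 :=
    (titsForm_eq_form hsep hthin _).symm.trans hreal.2.2
  have hqc : form (quiverGraph V) evᶜ (fun i => (n i : ℤ)) = 1 := by rw [form_compl hO, hq]
  have hq0 : 0 < form (quiverGraph V) ev (fun i => (n i : ℤ)) := hq.symm ▸ one_pos
  refine ⟨fun hG => ?_, fun hG δ hδ => ?_⟩
  · obtain ⟨hconn, w, hw, v, hv⟩ := hG.exists_strict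
    exact (HasCone.of_isPosDef hw hO
      (isPosDef_of_superharmonic hconn hO hw hv) hq).dependOnPositiveParameters hsep hthin hn hq0
  obtain ⟨hconn, w, hw, v, hv⟩ := hG.exists_eq_one
  obtain ⟨rfl, hharm⟩ := eq_of_isLeast_isImaginaryRoot hsep hthin hconn hw hv hδ
  refine ⟨fun h => ?_, fun hreg hlt T hT hd hTo => ?_⟩
  · refine HasCone.dependOnPositiveParameters hsep hthin hn hq0 ?_
    -- The nonpositive coordinate may occur in either time direction; the descent then begins at the
    -- corresponding side.
    have key : ∃ t i, alternate (quiverGraph V) t ev (fun i => (n i : ℤ)) i ≤ 0 ∨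
        alternate (quiverGraph V) t evᶜ (fun i => (n i : ℤ)) i ≤ 0 := by
      rcases h with h | h
      · rw [isRegularVector_iff] at h
        by_contra! hc
        exact h ⟨fun t i => (hc t i).2.le, fun t i => (hc t i).1.le⟩
      · exact exists_alternate_nonpos_of_lt hw.1 hharm hconn hO hv hq h
    obtain ⟨t, i, h | h⟩ := key
    · exact HasCone.of_alternate_nonpos hw hconn hO hq hn h
    · exact HasCone.of_alternate_nonpos hw hconn hO.compl hqc hn h
  · obtain ⟨χ, hχ⟩ := hTo
    rw [isRegularVector_iff] at hreg
    exact not_realizes_of_regular hw.1 hharm hconn hO hq hlt hreg.2 hreg.1 χ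
      (realizes_of_isIndecomposable hsep hthin hT hd hχ)
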